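/- Let $d\ge 2$ be an integer, and let $\Gamma$ and $\Lambda$ be discrete groups. Suppose that either (i) $\Gamma$ and $\Lambda$ are countable and measure equivalent, i.e. there are a nonzero $\sigma$-finite standard measure space $(X,m)$ and commuting, measure preserving, (essentially) free actions of $\Gamma$ and $\Lambda$ on $(X,m)$, each of which has a fundamental domain of finite measure; or (ii) $\Gamma$ and $\Lambda$ are $W^*$-equivalent, i.e. their group von Neumann algebras $L(\Gamma)$ and $L(\Lambda)$ are $*$-isomorphic. Then: 1. $\Gamma$ has the $M_d$-approximation-property if and only if $\Lambda$ does; 2. $\Gamma$ is $M_d$-weakly-amenable if and only if $\Lambda$ is, and $\Lambda_{CH}(\Gamma,d)=\Lambda_{CH}(\Lambda,d)$; 3. $\Gamma$ has the $M_d$-weak-Haagerup-property if and only if $\Lambda$ does, and $\Lambda_{WH}(\Gamma,d)=\Lambda_{WH}(\Lambda,d)$. Here, for a discrete group $G$, $M_d(G)$ is the space of functions $\varphi:G\to\mathbb C$ for which there are Hilbert spaces $\mathcal H_0=\mathbb C,\mathcal H_1,\dots,\mathcal H_{d-1},\mathcal H_d=\mathbb C$ and bounded maps $\xi_i:G\to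 B(\mathcal H_i,\mathcal H_{i-1})$ with $\varphi(g_1\cdots g_d)=\xi_1(g_1)\cdots\xi_d(g_d)$ for all $g_1,\dots,g_d\in G$; its norm $\|\varphi\|_{M_d}$ is the infimum of $\prod_{i=1}^d\sup_{g\in G}\|\xi_i(g)\|$ over all such choices. $X_d(G)$ is the norm closure in $M_d(G)^*$ of $\ell^1(G)$, where $f\in\ell^1(G)$ acts by $\varphi\mapsto\sum_{g}f(g)\varphi(g)$. $A(G)$ is the Fourier algebra, consisting of the coefficients of the left regular representation on $\ell^2(G)$. The group $G$ has the $M_d$-approximation-property if there is a net in $A(G)$ converging to $1$ in $\sigma(M_d(G),X_d(G))$; it is $M_d$-weakly-amenable if such a net $(\varphi_i)$ exists with $\sup_i\|\varphi_i\|_{M_d}<\infty$; and it has the $M_d$-weak-Haagerup-property if there is a net $(\varphi_i)$ in $M_d(G)\cap c_0(G)$ with $\sup_i\|\varphi_i\|_{M_d}<\infty$ converging to $1$ in $\sigma(M_d(G),X_d(G))$. The $M_d$-Cowling–Haagerup constant $\Lambda_{CH}(G,d)$ and the $M_d$-weak-Haagerup constant $\Lambda_{WH}(G,d)$ are the least possible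 values of $\sup_i\|\varphi_i\|_{M_d}$ over the nets in the second and third definition respectively, and are $\infty$ if there is no such net. -/

import Mathlib

open Filter Topology MeasureTheory
open scoped ENNReal lp

universe u v w

noncomputable section

/-! ### `M_d`-multipliers of a discrete group -/

namespace MdMult

section Chain

variable {G : Type v} {H : ℕ → Type u} [∀ i, NormedAddCommGroup (H i)]
  [∀ i, InnerProductSpace ℂ (H i)]

/-- The composition `mid 0 (g 1) ∘ mid 1 (g 2) ∘ ⋯ ∘ mid (n - 1) (g n) : H n → H 0`. -/
def chain (mid : ∀ i, G → H (i + 1) →L[ℂ] H i) (g : ℕ → G) : ∀ n, H n →L[ℂ] H 0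
  | 0 => ContinuousLinearMap.id ℂ (H 0)
  | n + 1 => (chain mid g n).comp (mid n (g (n + 1)))

end Chain

/-- A factorization `φ (g₁ ⋯ g_d) = ξ₁ (g₁) ⋯ ξ_d (g_d)` for `d ≥ 2`, with bounded maps
`ξ_i : G → B(𝓗_i, 𝓗_{i-1})`, Hilbert spaces `𝓗_i`, and `𝓗_0 = 𝓗_d = ℂ`.
The intermediate Hilbert spaces `𝓗_1, …, 𝓗_{d-1}` are `H 0, …, H (d - 2)`; the maps are
`ξ₁ = first`, `ξ_{i+2} = mid i` for `i < d - 2`, and `ξ_d = last`. The group elements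
`g₁, …, g_d` are `g 0, …, g (d - 1)`. (`H i` and `mid i` at larger indices are irrelevant.)
For `G : Type u` the spaces are taken in `Type u`: this is no restriction, as they may be cut down
to the closed linear spans of the vectors `ξ_i (x_i) ⋯ ξ_d (x_d) (1)`. -/
structure Factorization (d : ℕ) {G : Type u} [Group G] (φ : G → ℂ) where
  H : ℕ → Type u
  [normed : ∀ i, NormedAddCommGroup (H i)]
  [inner : ∀ i, InnerProductSpace ℂ (H i)]
  [complete : ∀ i, CompleteSpace (H i)]
  first : G → H 0 →L[ℂ] ℂ
  mid : ∀ i, G → H (i + 1) →L[ℂ] H i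
  last : G → ℂ →L[ℂ] H (d - 2)
  first_bdd : BddAbove (Set.range fun x => ‖first x‖)
  mid_bdd : ∀ i < d - 2, BddAbove (Set.range fun x => ‖mid i x‖)
  last_bdd : BddAbove (Set.range fun x => ‖last x‖)
  factor : ∀ g : ℕ → G,
    φ ((List.range d).map g).prod = first (g 0) (chain mid g (d - 2) (last (g (d - 1)) 1))

attribute [instance] Factorization.normed Factorization.inner Factorization.complete

variable {d : ℕ} {G : Type u} [Group G]

/-- The number `sup ‖ξ₁‖ ⋯ sup ‖ξ_d‖`. -/
def Factorization.cost {φ : G → ℂ} (F : Factorization d φ) : ℝ :=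
  (⨆ x, ‖F.first x‖) * (∏ i ∈ Finset.range (d - 2), ⨆ x, ‖F.mid i x‖) * ⨆ x, ‖F.last x‖

/-- `φ` is an `M_d`-multiplier. -/
def IsMultiplier (d : ℕ) (φ : G → ℂ) : Prop := Nonempty (Factorization d φ)

/-- The `M_d`-norm of an `M_d`-multiplier. -/
def mdNorm (d : ℕ) (φ : G → ℂ) : ℝ := ⨅ F : Factorization d φ, F.cost

/-! The multipliers form a normed space. -/

/-- Auxiliary: a factorization whose middle maps are contractive, and whose two outer maps are
bounded by `√c`. -/
def Bal (d : ℕ) (c : ℝ) (φ : G → ℂ) : Prop :=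
  ∃ F : Factorization d φ, (∀ x, ‖F.first x‖ ≤ √c) ∧ (∀ i < d - 2, ∀ x, ‖F.mid i x‖ ≤ 1) ∧
    ∀ x, ‖F.last x‖ ≤ √c

lemma Factorization.cost_nonneg {φ : G → ℂ} (F : Factorization d φ) : 0 ≤ F.cost := by
  unfold Factorization.cost
  refine mul_nonneg (mul_nonneg (Real.iSup_nonneg fun _ => norm_nonneg _)
    (Finset.prod_nonneg fun _ _ => Real.iSup_nonneg fun _ => norm_nonneg _))
    (Real.iSup_nonneg fun _ => norm_nonneg _)

lemma mdNorm_nonneg (φ : G → ℂ) : 0 ≤ mdNorm d φ :=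
  Real.iInf_nonneg fun F => F.cost_nonneg

lemma mdNorm_le {φ : G → ℂ} (F : Factorization d φ) : mdNorm d φ ≤ F.cost :=
  ciInf_le ⟨0, by rintro _ ⟨F, rfl⟩; exact F.cost_nonneg⟩ F

lemma Bal.isMultiplier {c : ℝ} {φ : G → ℂ} (h : Bal d c φ) : IsMultiplier d φ := ⟨h.choose⟩

lemma Bal.mdNorm_le {c : ℝ} (hc : 0 ≤ c) {φ : G → ℂ} (h : Bal d c φ) : mdNorm d φ ≤ c := by
  obtain ⟨F, h1, h2, h3⟩ := h
  refine (MdMult.mdNorm_le F).trans ?_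
  unfold Factorization.cost
  have a1 : (⨆ x, ‖F.first x‖) ≤ √c := ciSup_le h1
  have a3 : (⨆ x, ‖F.last x‖) ≤ √c := ciSup_le h3
  have a2 : (∏ i ∈ Finset.range (d - 2), ⨆ x, ‖F.mid i x‖) ≤ 1 :=
    Finset.prod_le_one (fun _ _ => Real.iSup_nonneg fun _ => norm_nonneg _)
      fun i hi => ciSup_le (h2 i (Finset.mem_range.1 hi))
  have b1 : 0 ≤ ⨆ x, ‖F.first x‖ := Real.iSup_nonneg fun _ => norm_nonneg _
  have b2 : 0 ≤ ∏ i ∈ Finset.range (d - 2), ⨆ x, ‖F.mid i x‖ :=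
    Finset.prod_nonneg fun _ _ => Real.iSup_nonneg fun _ => norm_nonneg _
  have b3 : 0 ≤ ⨆ x, ‖F.last x‖ := Real.iSup_nonneg fun _ => norm_nonneg _
  calc _ ≤ √c * 1 * √c := by gcongr
    _ = c := by rw [mul_one, Real.mul_self_sqrt hc]

lemma chain_smul {K : Type v} {H : ℕ → Type u} [∀ i, NormedAddCommGroup (H i)]
    [∀ i, InnerProductSpace ℂ (H i)] (mid : ∀ i, K → H (i + 1) →L[ℂ] H i) (r : ℕ → ℂ)
    (g : ℕ → K) (n : ℕ) :
    chain (fun i x => r i • mid i x) g n = (∏ i ∈ Finset.range n, r i) • chain mid g n := by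
  induction n with
  | zero => simp [chain]
  | succ n ih =>
    ext v
    simp [chain, ih, Finset.prod_range_succ, smul_smul, mul_comm]

/-- Rescaling the maps of a factorization. -/
def Factorization.rescale {φ : G → ℂ} (F : Factorization d φ) (a b : ℂ) (r : ℕ → ℂ) :
    Factorization d ((a * (∏ i ∈ Finset.range (d - 2), r i) * b) • φ) where
  H := F.H
  first x := a • F.first x
  mid i x := r i • F.mid i x
  last x := b • F.last x
  first_bdd := by
    obtain ⟨C, hC⟩ := F.first_bdd
    refine ⟨‖a‖ * C, ?_⟩
    rintro _ ⟨x, rfl⟩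
    simp only [norm_smul]
    exact mul_le_mul_of_nonneg_left (hC ⟨x, rfl⟩) (norm_nonneg _)
  mid_bdd i hi := by
    obtain ⟨C, hC⟩ := F.mid_bdd i hi
    refine ⟨‖r i‖ * C, ?_⟩
    rintro _ ⟨x, rfl⟩
    simp only [norm_smul]
    exact mul_le_mul_of_nonneg_left (hC ⟨x, rfl⟩) (norm_nonneg _)
  last_bdd := by
    obtain ⟨C, hC⟩ := F.last_bdd
    refine ⟨‖b‖ * C, ?_⟩
    rintro _ ⟨x, rfl⟩
    simp only [norm_smul]
    exact mul_le_mul_of_nonneg_left (hC ⟨x, rfl⟩) (norm_nonneg _)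
  factor g := by
    rw [chain_smul, Pi.smul_apply, F.factor g]
    simp [mul_assoc, mul_left_comm]

lemma Factorization.bal {φ : G → ℂ} (F : Factorization d φ) {c : ℝ} (hc : F.cost < c) :
    Bal d c φ := by
  set A := ⨆ x, ‖F.first x‖ with hA
  set B := ⨆ x, ‖F.last x‖ with hB
  set m : ℕ → ℝ := fun i => ⨆ x, ‖F.mid i x‖ with hm
  have c0 : 0 < c := F.cost_nonneg.trans_lt hc
  have A0 : 0 ≤ A := Real.iSup_nonneg fun _ => norm_nonneg _
  have B0 : 0 ≤ B := Real.iSup_nonneg fun _ => norm_nonneg _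
  have m0 : ∀ i, 0 ≤ m i := fun i => Real.iSup_nonneg fun _ => norm_nonneg _
  have hcont : Continuous fun δ : ℝ =>
      (A + δ) * (∏ i ∈ Finset.range (d - 2), (m i + δ)) * (B + δ) := by fun_prop
  have hlim := (hcont.tendsto 0).mono_left (nhdsWithin_le_nhds (s := Set.Ioi 0))
  have hlt : (A + 0) * (∏ i ∈ Finset.range (d - 2), (m i + 0)) * (B + 0) < c := by
    simpa [Factorization.cost, hA, hB, hm] using hc
  obtain ⟨δ, hδc, hδ⟩ := ((hlim.eventually_lt_const hlt).and self_mem_nhdsWithin).exists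
  have hδ : 0 < δ := hδ
  set P := ∏ i ∈ Finset.range (d - 2), (m i + δ) with hP
  have P0 : 0 < P := Finset.prod_pos fun i _ => by have := m0 i; linarith
  have s0 : 0 < √c := Real.sqrt_pos.2 c0
  have A1 : 0 < A + δ := by linarith
  have hA1 : A + δ ≠ 0 := A1.ne'
  have key : ((√c / (A + δ) : ℝ) : ℂ) *
      (∏ i ∈ Finset.range (d - 2), (((m i + δ)⁻¹ : ℝ) : ℂ)) * (((A + δ) * P / √c : ℝ) : ℂ) = 1 := by
    rw [← Complex.ofReal_prod, ← Complex.ofReal_mul, ← Complex.ofReal_mul, Finset.prod_inv_distrib,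
      ← hP]
    have : √c / (A + δ) * P⁻¹ * ((A + δ) * P / √c) = 1 := by field_simp
    rw [this, Complex.ofReal_one]
  suffices h : Bal d c ((((√c / (A + δ) : ℝ) : ℂ) *
      (∏ i ∈ Finset.range (d - 2), (((m i + δ)⁻¹ : ℝ) : ℂ)) *
      (((A + δ) * P / √c : ℝ) : ℂ)) • φ) by
    rwa [key, one_smul] at h
  refine ⟨F.rescale ((√c / (A + δ) : ℝ) : ℂ) (((A + δ) * P / √c : ℝ) : ℂ)
    (fun i => (((m i + δ)⁻¹ : ℝ) : ℂ)), fun x => ?_, fun i hi x => ?_, fun x => ?_⟩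
  · have hx : ‖F.first x‖ ≤ A := le_ciSup F.first_bdd x
    change ‖((√c / (A + δ) : ℝ) : ℂ) • F.first x‖ ≤ √c
    rw [norm_smul, Complex.norm_real, Real.norm_of_nonneg (by positivity), div_mul_eq_mul_div,
      div_le_iff₀ A1]
    exact mul_le_mul_of_nonneg_left (by linarith) s0.le
  · have hx : ‖F.mid i x‖ ≤ m i := le_ciSup (F.mid_bdd i hi) x
    have m1 : 0 < m i + δ := by have := m0 i; linarith
    change ‖(((m i + δ)⁻¹ : ℝ) : ℂ) • F.mid i x‖ ≤ 1
    rw [norm_smul, Complex.norm_real, Real.norm_of_nonneg (by positivity),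
      inv_mul_le_iff₀ m1]
    linarith
  · have hx : ‖F.last x‖ ≤ B := le_ciSup F.last_bdd x
    change ‖(((A + δ) * P / √c : ℝ) : ℂ) • F.last x‖ ≤ √c
    rw [norm_smul, Complex.norm_real,
      Real.norm_of_nonneg (div_nonneg (mul_pos A1 P0).le s0.le), div_mul_eq_mul_div,
      div_le_iff₀ s0, Real.mul_self_sqrt c0.le]
    have hx' : ‖F.last x‖ ≤ B + δ := by linarith
    have hAP : 0 ≤ (A + δ) * P := (mul_pos A1 P0).le
    have hfin : (A + δ) * P * (B + δ) < c := hδc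
    exact (mul_le_mul_of_nonneg_left hx' hAP).trans hfin.le

section Sum

variable {E₁ E₂ E₃ E₄ : Type u} [NormedAddCommGroup E₁] [InnerProductSpace ℂ E₁]
  [NormedAddCommGroup E₂] [InnerProductSpace ℂ E₂] [NormedAddCommGroup E₃]
  [InnerProductSpace ℂ E₃] [NormedAddCommGroup E₄] [InnerProductSpace ℂ E₄]

/-- `S ⊕ T` on Hilbert sums. -/
def diag (S : E₁ →L[ℂ] E₂) (T : E₃ →L[ℂ] E₄) : WithLp 2 (E₁ × E₃) →L[ℂ] WithLp 2 (E₂ × E₄) :=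
  ((WithLp.prodContinuousLinearEquiv 2 ℂ E₂ E₄).symm : _ →L[ℂ] _).comp
    ((S.prodMap T).comp (WithLp.prodContinuousLinearEquiv 2 ℂ E₁ E₃ : _ →L[ℂ] _))

/-- The row operator of two functionals. -/
def row (S : E₁ →L[ℂ] ℂ) (T : E₃ →L[ℂ] ℂ) : WithLp 2 (E₁ × E₃) →L[ℂ] ℂ :=
  (S.coprod T).comp (WithLp.prodContinuousLinearEquiv 2 ℂ E₁ E₃ : _ →L[ℂ] _)

/-- The column operator of two vectors. -/
def col (S : ℂ →L[ℂ] E₂) (T : ℂ →L[ℂ] E₄) : ℂ →L[ℂ] WithLp 2 (E₂ × E₄) :=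
  ((WithLp.prodContinuousLinearEquiv 2 ℂ E₂ E₄).symm : _ →L[ℂ] _).comp (S.prod T)

lemma diag_toLp (S : E₁ →L[ℂ] E₂) (T : E₃ →L[ℂ] E₄) (x : E₁) (y : E₃) :
    diag S T (WithLp.toLp 2 (x, y)) = WithLp.toLp 2 (S x, T y) := rfl

lemma norm_diag_le {S : E₁ →L[ℂ] E₂} {T : E₃ →L[ℂ] E₄} {C : ℝ} (hS : ‖S‖ ≤ C) (hT : ‖T‖ ≤ C) :
    ‖diag S T‖ ≤ C := by
  have C0 : 0 ≤ C := (norm_nonneg _).trans hS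
  refine ContinuousLinearMap.opNorm_le_bound _ C0 fun z => ?_
  refine le_of_sq_le_sq ?_ (by positivity)
  rw [mul_pow, WithLp.prod_norm_sq_eq_of_L2, WithLp.prod_norm_sq_eq_of_L2]
  have h1 : ‖S z.fst‖ ≤ C * ‖z.fst‖ := S.le_of_opNorm_le hS _
  have h2 : ‖T z.snd‖ ≤ C * ‖z.snd‖ := T.le_of_opNorm_le hT _
  change ‖S z.fst‖ ^ 2 + ‖T z.snd‖ ^ 2 ≤ _
  calc _ ≤ (C * ‖z.fst‖) ^ 2 + (C * ‖z.snd‖) ^ 2 := by gcongr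
    _ = _ := by ring

lemma norm_row_le {S : E₁ →L[ℂ] ℂ} {T : E₃ →L[ℂ] ℂ} {a b : ℝ} (ha : 0 ≤ a) (hb : 0 ≤ b)
    (hS : ‖S‖ ≤ √a) (hT : ‖T‖ ≤ √b) : ‖row S T‖ ≤ √(a + b) := by
  refine ContinuousLinearMap.opNorm_le_bound _ (Real.sqrt_nonneg _) fun z => ?_
  have h1 : ‖S z.fst‖ ≤ √a * ‖z.fst‖ := S.le_of_opNorm_le hS _
  have h2 : ‖T z.snd‖ ≤ √b * ‖z.snd‖ := T.le_of_opNorm_le hT _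
  change ‖S z.fst + T z.snd‖ ≤ _
  refine (norm_add_le _ _).trans ((add_le_add h1 h2).trans ?_)
  refine le_of_sq_le_sq ?_ (by positivity)
  rw [mul_pow, WithLp.prod_norm_sq_eq_of_L2, Real.sq_sqrt (by positivity)]
  nlinarith [sq_nonneg (√a * ‖z.snd‖ - √b * ‖z.fst‖), Real.sq_sqrt ha, Real.sq_sqrt hb]

lemma norm_col_le {S : ℂ →L[ℂ] E₂} {T : ℂ →L[ℂ] E₄} {a b : ℝ} (ha : 0 ≤ a) (hb : 0 ≤ b)
    (hS : ‖S‖ ≤ √a) (hT : ‖T‖ ≤ √b) : ‖col S T‖ ≤ √(a + b) := by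
  refine ContinuousLinearMap.opNorm_le_bound _ (Real.sqrt_nonneg _) fun z => ?_
  have h1 : ‖S z‖ ≤ √a * ‖z‖ := S.le_of_opNorm_le hS _
  have h2 : ‖T z‖ ≤ √b * ‖z‖ := T.le_of_opNorm_le hT _
  refine le_of_sq_le_sq ?_ (by positivity)
  rw [mul_pow, WithLp.prod_norm_sq_eq_of_L2, Real.sq_sqrt (by positivity)]
  change ‖S z‖ ^ 2 + ‖T z‖ ^ 2 ≤ _
  calc _ ≤ (√a * ‖z‖) ^ 2 + (√b * ‖z‖) ^ 2 := by gcongr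
    _ = _ := by rw [mul_pow, mul_pow, Real.sq_sqrt ha, Real.sq_sqrt hb]; ring

end Sum

lemma chain_diag {K : Type v} {H H' : ℕ → Type u} [∀ i, NormedAddCommGroup (H i)]
    [∀ i, InnerProductSpace ℂ (H i)] [∀ i, NormedAddCommGroup (H' i)]
    [∀ i, InnerProductSpace ℂ (H' i)] (mid : ∀ i, K → H (i + 1) →L[ℂ] H i)
    (mid' : ∀ i, K → H' (i + 1) →L[ℂ] H' i) (g : ℕ → K) (n : ℕ) (x : H n) (y : H' n) :
    chain (H := fun i => WithLp 2 (H i × H' i)) (fun i x => diag (mid i x) (mid' i x)) g n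
      (WithLp.toLp 2 (x, y)) = WithLp.toLp 2 (chain mid g n x, chain mid' g n y) := by
  induction n with
  | zero => rfl
  | succ n ih =>
    simp only [chain, ContinuousLinearMap.comp_apply, diag_toLp]
    exact ih _ _

lemma Bal.add {a b : ℝ} (ha : 0 ≤ a) (hb : 0 ≤ b) {φ ψ : G → ℂ} (hφ : Bal d a φ)
    (hψ : Bal d b ψ) : Bal d (a + b) (φ + ψ) := by
  obtain ⟨F, f1, f2, f3⟩ := hφ
  obtain ⟨F', f1', f2', f3'⟩ := hψ
  have h1 : ∀ x, ‖row (F.first x) (F'.first x)‖ ≤ √(a + b) := fun x =>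
    norm_row_le ha hb (f1 x) (f1' x)
  have h2 : ∀ i < d - 2, ∀ x, ‖diag (F.mid i x) (F'.mid i x)‖ ≤ 1 := fun i hi x =>
    norm_diag_le (f2 i hi x) (f2' i hi x)
  have h3 : ∀ x, ‖col (F.last x) (F'.last x)‖ ≤ √(a + b) := fun x =>
    norm_col_le ha hb (f3 x) (f3' x)
  exact ⟨{
    H := fun i => WithLp 2 (F.H i × F'.H i)
    first := fun x => row (F.first x) (F'.first x)
    mid := fun i x => diag (F.mid i x) (F'.mid i x)
    last := fun x => col (F.last x) (F'.last x)
    first_bdd := ⟨_, by rintro _ ⟨x, rfl⟩; exact h1 x⟩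
    mid_bdd := fun i hi => ⟨_, by rintro _ ⟨x, rfl⟩; exact h2 i hi x⟩
    last_bdd := ⟨_, by rintro _ ⟨x, rfl⟩; exact h3 x⟩
    factor := fun g => by
      rw [Pi.add_apply, F.factor g, F'.factor g]
      have : col (F.last (g (d - 1))) (F'.last (g (d - 1))) 1 =
        WithLp.toLp 2 (F.last (g (d - 1)) 1, F'.last (g (d - 1)) 1) := rfl
      rw [this, chain_diag]
      rfl }, h1, h2, h3⟩

lemma exists_bal {φ : G → ℂ} (h : IsMultiplier d φ) {ε : ℝ} (hε : 0 < ε) :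
    Bal d (mdNorm d φ + ε) φ := by
  have : Nonempty (Factorization d φ) := h
  obtain ⟨F, hF⟩ := exists_lt_of_ciInf_lt (show mdNorm d φ < mdNorm d φ + ε by linarith)
  exact F.bal hF

lemma IsMultiplier.add {φ ψ : G → ℂ} (hφ : IsMultiplier d φ) (hψ : IsMultiplier d ψ) :
    IsMultiplier d (φ + ψ) := by
  have h1 := mdNorm_nonneg (d := d) φ
  have h2 := mdNorm_nonneg (d := d) ψ
  exact ((exists_bal hφ one_pos).add (by linarith) (by linarith) (exists_bal hψ one_pos)).isMultiplier

lemma mdNorm_add_le {φ ψ : G → ℂ} (hφ : IsMultiplier d φ) (hψ : IsMultiplier d ψ) :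
    mdNorm d (φ + ψ) ≤ mdNorm d φ + mdNorm d ψ := by
  have h1 := mdNorm_nonneg (d := d) φ
  have h2 := mdNorm_nonneg (d := d) ψ
  refine le_of_forall_pos_le_add fun ε hε => ?_
  have h := ((exists_bal hφ (half_pos hε)).add (by positivity) (by positivity)
    (exists_bal hψ (half_pos hε))).mdNorm_le (by positivity)
  linarith

lemma IsMultiplier.smul {φ : G → ℂ} (hφ : IsMultiplier d φ) (a : ℂ) :
    IsMultiplier d (a • φ) := by
  obtain ⟨F⟩ := hφ
  have := F.rescale a 1 1
  simp only [Pi.one_apply, Finset.prod_const_one, mul_one] at this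
  exact ⟨this⟩

lemma mdNorm_smul_le {φ : G → ℂ} (hφ : IsMultiplier d φ) (a : ℂ) :
    mdNorm d (a • φ) ≤ ‖a‖ * mdNorm d φ := by
  have : Nonempty (Factorization d φ) := hφ
  unfold mdNorm
  rw [Real.mul_iInf_of_nonneg (norm_nonneg a)]
  refine le_ciInf fun F => ?_
  have e : a * (∏ i ∈ Finset.range (d - 2), (1 : ℕ → ℂ) i) * 1 = a := by simp
  suffices h : mdNorm d ((a * (∏ i ∈ Finset.range (d - 2), (1 : ℕ → ℂ) i) * 1) • φ) ≤
      ‖a‖ * F.cost by rwa [e] at h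
  refine (mdNorm_le (F.rescale a 1 1)).trans (le_of_eq ?_)
  change (⨆ x, ‖a • F.first x‖) * (∏ i ∈ Finset.range (d - 2), ⨆ x, ‖(1 : ℂ) • F.mid i x‖) *
    (⨆ x, ‖(1 : ℂ) • F.last x‖) = ‖a‖ * F.cost
  simp only [Factorization.cost, norm_smul, norm_one, one_mul]
  rw [← Real.mul_iSup_of_nonneg (norm_nonneg a)]
  ring

lemma mdNorm_smul {φ : G → ℂ} (hφ : IsMultiplier d φ) (a : ℂ) :
    mdNorm d (a • φ) = ‖a‖ * mdNorm d φ := by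
  refine le_antisymm (mdNorm_smul_le hφ a) ?_
  rcases eq_or_ne a 0 with rfl | ha
  · simpa using mdNorm_nonneg _
  have h := mdNorm_smul_le (hφ.smul a) a⁻¹
  rw [smul_smul, inv_mul_cancel₀ ha, one_smul, norm_inv] at h
  rwa [← le_inv_mul_iff₀ (norm_pos_iff.2 ha)]

lemma isMultiplier_one : IsMultiplier d (1 : G → ℂ) := by
  let e : EuclideanSpace ℂ PUnit.{u + 1} := EuclideanSpace.single PUnit.unit 1
  refine ⟨{
    H := fun _ => EuclideanSpace ℂ PUnit.{u + 1}
    first := fun _ => innerSL ℂ e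
    mid := fun _ _ => ContinuousLinearMap.id ℂ _
    last := fun _ => ContinuousLinearMap.toSpanSingleton ℂ e
    first_bdd := ⟨_, by rintro _ ⟨x, rfl⟩; exact le_rfl⟩
    mid_bdd := fun _ _ => ⟨_, by rintro _ ⟨x, rfl⟩; exact le_rfl⟩
    last_bdd := ⟨_, by rintro _ ⟨x, rfl⟩; exact le_rfl⟩
    factor := fun g => ?_ }⟩
  have h : ∀ n, chain (H := fun _ => EuclideanSpace ℂ PUnit.{u + 1})
      (fun _ (_ : G) => ContinuousLinearMap.id ℂ _) g n = ContinuousLinearMap.id ℂ _ := by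
    intro n
    induction n with
    | zero => rfl
    | succ n ih => simp only [chain, ih]; rfl
  rw [h]
  simp [e]

lemma isMultiplier_zero : IsMultiplier d (0 : G → ℂ) := by
  simpa using (isMultiplier_one (d := d) (G := G)).smul 0

lemma norm_chain_le {K : Type v} {H : ℕ → Type u} [∀ i, NormedAddCommGroup (H i)]
    [∀ i, InnerProductSpace ℂ (H i)] (mid : ∀ i, K → H (i + 1) →L[ℂ] H i) (g : ℕ → K)
    (n : ℕ) (m : ℕ → ℝ) (hm : ∀ i < n, ‖mid i (g (i + 1))‖ ≤ m i) :
    ‖chain mid g n‖ ≤ ∏ i ∈ Finset.range n, m i := by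
  induction n with
  | zero => simpa [chain] using ContinuousLinearMap.norm_id_le
  | succ n ih =>
    rw [Finset.prod_range_succ]
    have h := ih fun i hi => hm i (by omega)
    exact (ContinuousLinearMap.opNorm_comp_le _ _).trans
      (mul_le_mul h (hm n (by omega)) (norm_nonneg _) ((norm_nonneg _).trans h))

lemma norm_apply_le_mdNorm [hd : d.AtLeastTwo] {φ : G → ℂ} (hφ : IsMultiplier d φ) (x : G) :
    ‖φ x‖ ≤ mdNorm d φ := by
  have : Nonempty (Factorization d φ) := hφ
  refine le_ciInf fun F => ?_
  let g : ℕ → G := fun i => if i = 0 then x else 1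
  have hg : ((List.range d).map g).prod = x := by
    obtain ⟨k, rfl⟩ : ∃ k, d = k + 1 := ⟨d - 1, by have := hd.prop; omega⟩
    rw [List.range_succ_eq_map]
    have : (g ∘ Nat.succ) = fun _ => (1 : G) := by ext i; simp [g]
    simp [this, g]
  have h1 : ‖F.first (g 0)‖ ≤ ⨆ x, ‖F.first x‖ := le_ciSup F.first_bdd _
  have h2 := norm_chain_le F.mid g (d - 2) _ fun i hi => le_ciSup (F.mid_bdd i hi) (g (i + 1))
  have h3 : ‖F.last (g (d - 1)) 1‖ ≤ ⨆ x, ‖F.last x‖ := by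
    refine ((F.last (g (d - 1))).le_opNorm 1).trans ?_
    rw [norm_one, mul_one]
    exact le_ciSup F.last_bdd _
  rw [← hg, F.factor g, Factorization.cost, mul_assoc]
  refine (ContinuousLinearMap.le_of_opNorm_le _ h1 _).trans ?_
  refine mul_le_mul_of_nonneg_left ?_ ((norm_nonneg _).trans h1)
  refine (ContinuousLinearMap.le_of_opNorm_le _ h2 _).trans ?_
  exact mul_le_mul_of_nonneg_left h3 ((norm_nonneg _).trans h2)

/-- The space of `M_d`-multipliers, as a space of functions. -/
def mdSubmodule (d : ℕ) (G : Type u) [Group G] : Submodule ℂ (G → ℂ) where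
  carrier := {φ | IsMultiplier d φ}
  add_mem' := IsMultiplier.add
  zero_mem' := isMultiplier_zero
  smul_mem' a _ h := IsMultiplier.smul h a

end MdMult

open MdMult

/-- The space `M_d(G)` of `M_d`-multipliers of the discrete group `G`. -/
def MdSpace (d : ℕ) (G : Type u) [Group G] : Type u := MdMult.mdSubmodule d G

namespace MdSpace

variable {d : ℕ} {G : Type u} [Group G]

instance : AddCommGroup (MdSpace d G) := inferInstanceAs (AddCommGroup (MdMult.mdSubmodule d G))
instance : Module ℂ (MdSpace d G) := inferInstanceAs (Module ℂ (MdMult.mdSubmodule d G))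
instance : CoeFun (MdSpace d G) fun _ => G → ℂ := ⟨fun φ => φ.1⟩
instance : One (MdSpace d G) := ⟨⟨1, isMultiplier_one⟩⟩
instance : Norm (MdSpace d G) := ⟨fun φ => mdNorm d φ.1⟩

lemma core (d : ℕ) [d.AtLeastTwo] (G : Type u) [Group G] :
    NormedSpace.Core ℂ (MdSpace d G) where
  norm_nonneg φ := mdNorm_nonneg φ.1
  norm_smul a φ := mdNorm_smul φ.2 a
  norm_triangle φ ψ := mdNorm_add_le φ.2 ψ.2
  norm_eq_zero_iff φ := by
    constructor
    · intro h
      refine Subtype.ext (funext fun x => ?_)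
      have h' := norm_apply_le_mdNorm φ.2 x
      have h0 : mdNorm d φ.1 = 0 := h
      rw [h0] at h'
      exact norm_le_zero_iff.1 h'
    · rintro rfl
      have h := mdNorm_smul (d := d) (G := G) isMultiplier_zero 0
      rw [zero_smul, norm_zero, zero_mul] at h
      exact h

instance [d.AtLeastTwo] : NormedAddCommGroup (MdSpace d G) := NormedAddCommGroup.ofCore (core d G)
instance [d.AtLeastTwo] : NormedSpace ℂ (MdSpace d G) := NormedSpace.ofCore (core d G)

end MdSpace

/-- `X_d(G)`, as a subset of the Banach dual `M_d(G)^*`: the norm closure of `ℓ¹(G)`, where `f` acts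
by `φ ↦ ∑ x, f x * φ x`. -/
def MdPredual (d : ℕ) [d.AtLeastTwo] (G : Type u) [Group G] : Set (StrongDual ℂ (MdSpace d G)) :=
  closure {ω | ∃ f : G → ℂ, (Summable fun x => ‖f x‖) ∧ ∀ φ : MdSpace d G, ω φ = ∑' x, f x * φ x}

/-! ### The regular representation, the Fourier algebra, the group von Neumann algebra -/

/-- The Hilbert space `ℓ²(G)`. -/
abbrev EllTwo (G : Type u) : Type u := lp (fun _ : G => ℂ) 2

section Regular

variable {G : Type u} [Group G]

lemma memℓp_translate (x : G) (f : EllTwo G) :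
    Memℓp (fun y => (f : G → ℂ) (x⁻¹ * y)) 2 := by
  have h := (memℓp_gen_iff (p := 2) (by norm_num)).1 (lp.memℓp f)
  exact memℓp_gen ((Equiv.mulLeft x⁻¹).summable_iff.2 h)

/-- The left regular representation: `(λ(x) f)(y) = f(x⁻¹ y)`. -/
def leftReg (x : G) : EllTwo G →L[ℂ] EllTwo G :=
  LinearMap.mkContinuous
    { toFun := fun f => ⟨fun y => (f : G → ℂ) (x⁻¹ * y), memℓp_translate x f⟩
      map_add' := fun _ _ => rfl
      map_smul' := fun _ _ => rfl } 1 (fun f => by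
        rw [one_mul, lp.norm_eq_tsum_rpow (by norm_num), lp.norm_eq_tsum_rpow (by norm_num)]
        refine le_of_eq ?_
        congr 1
        exact (Equiv.mulLeft x⁻¹).tsum_eq fun y => ‖(f : G → ℂ) y‖ ^ (2 : ℝ≥0∞).toReal)

@[simp] lemma leftReg_apply (x : G) (f : EllTwo G) (y : G) :
    (leftReg x f : G → ℂ) y = (f : G → ℂ) (x⁻¹ * y) := rfl

/-- Membership in the Fourier algebra `A(G)`: `φ(x) = ⟨λ(x) ζ, η⟩` for some `ζ, η ∈ ℓ²(G)`. -/
def MemFourier (φ : G → ℂ) : Prop :=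
  ∃ ζ η : EllTwo G, ∀ x, φ x = inner ℂ η (leftReg x ζ)

/-- Membership in `c₀(G)`. -/
def MemCZero (φ : G → ℂ) : Prop := Tendsto φ cofinite (𝓝 0)

variable (G) in
/-- The group von Neumann algebra `L(G) = λ(G)''` on `ℓ²(G)`. (The adjoint of `λ(x)` is `λ(x⁻¹)`, so
passing to star-closures, as `StarSubalgebra.centralizer` does, changes nothing.) -/
def groupVN : VonNeumannAlgebra (EllTwo G) where
  toStarSubalgebra := StarSubalgebra.centralizer ℂ
    (StarSubalgebra.centralizer ℂ (Set.range (leftReg (G := G))) : Set (EllTwo G →L[ℂ] EllTwo G))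
  centralizer_centralizer' := Set.centralizer_centralizer_centralizer _

end Regular

/-- `W*`-equivalence: the group von Neumann algebras are `*`-isomorphic. -/
def WStarEquivalent (Γ : Type u) (Λ : Type v) [Group Γ] [Group Λ] : Prop :=
  Nonempty ((groupVN Γ).toStarSubalgebra ≃⋆ₐ[ℂ] (groupVN Λ).toStarSubalgebra)

/-! ### The approximation properties -/

section Properties

variable (d : ℕ) [d.AtLeastTwo] {G : Type u} [Group G]

/-- Convergence of a net to the constant function `1` in `σ(M_d(G), X_d(G))`. -/
def TendstoOne {ι : Type w} [Preorder ι] (φ : ι → MdSpace d G) : Prop :=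
  ∀ ω ∈ MdPredual d G, Tendsto (fun i => ω (φ i)) atTop (𝓝 (ω 1))

/-- There is a net in `M_d(G)` of functions satisfying `S`, converging to `1` in
`σ(M_d(G), X_d(G))`, whose norms have supremum `C`. Index sets in the universe of `G` suffice:
one may always reindex by pairs of a finite subset of `X_d(G)` and a natural number. -/
def HasNet (S : (G → ℂ) → Prop) (C : ℝ≥0∞) : Prop :=
  ∃ (ι : Type u) (_ : Preorder ι) (_ : IsDirectedOrder ι) (_ : Nonempty ι) (φ : ι → MdSpace d G),
    (∀ i, S (φ i)) ∧ TendstoOne d φ ∧ ⨆ i, ENNReal.ofReal ‖φ i‖ = C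

variable (G)

/-- The `M_d`-approximation-property: there is a net in `A(G)` converging to `1` in
`σ(M_d(G), X_d(G))`, with no condition on the norms (`C = ∞` is allowed). -/
def MdAP : Prop := ∃ C, HasNet d (G := G) MemFourier C

/-- `M_d`-weak-amenability. -/
def MdWeaklyAmenable : Prop := ∃ C < ∞, HasNet d (G := G) MemFourier C

/-- The `M_d`-weak-Haagerup-property. -/
def MdWeakHaagerup : Prop := ∃ C < ∞, HasNet d (G := G) MemCZero C

/-- The `M_d`-Cowling–Haagerup constant (`∞` if `G` is not `M_d`-weakly-amenable). -/
def cowlingHaagerupConst : ℝ≥0∞ := sInf {C | HasNet d (G := G) MemFourier C}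

/-- The `M_d`-weak-Haagerup constant (`∞` if `G` fails the `M_d`-weak-Haagerup-property). -/
def weakHaagerupConst : ℝ≥0∞ := sInf {C | HasNet d (G := G) MemCZero C}

end Properties

/-! ### Measure equivalence -/

/-- `(X, m)` is a measure equivalence coupling of `Γ` and `Λ`: a nonzero `σ`-finite standard
measure space with commuting, measure preserving, (essentially) free actions of `Γ` and `Λ`, each
of which has a fundamental domain of finite measure. -/
structure IsMECoupling (Γ : Type u) (Λ : Type v) [Group Γ] [Group Λ] (X : Type w)
    [MeasurableSpace X] (m : Measure X) [MulAction Γ X] [MulAction Λ X] : Prop where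
  standard : StandardBorelSpace X
  sigmaFinite : SigmaFinite m
  ne_zero : m ≠ 0
  commute : ∀ (γ : Γ) (s : Λ) (x : X), γ • s • x = s • γ • x
  preserving_left : ∀ γ : Γ, MeasurePreserving (fun x : X => γ • x) m m
  preserving_right : ∀ s : Λ, MeasurePreserving (fun x : X => s • x) m m
  free_left : ∀ᵐ x ∂m, ∀ γ : Γ, γ • x = x → γ = 1
  free_right : ∀ᵐ x ∂m, ∀ s : Λ, s • x = x → s = 1
  domain_left : ∃ Ω : Set X, IsFundamentalDomain Γ Ω m ∧ m Ω < ∞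
  domain_right : ∃ Ω : Set X, IsFundamentalDomain Λ Ω m ∧ m Ω < ∞

/-- Measure equivalence of countable groups. -/
def MeasureEquivalent (Γ : Type u) (Λ : Type v) [Group Γ] [Group Λ] : Prop :=
  Countable Γ ∧ Countable Λ ∧
    ∃ (X : Type w) (_ : MeasurableSpace X) (m : Measure X) (_ : MulAction Γ X) (_ : MulAction Λ X),
      IsMECoupling Γ Λ X m

end

/-! Everything is carried by Markov kernels. In both cases there is a kernel `k : Γ → Λ → ℝ` with
rows of mass 1 such that the averaging map `φ ↦ (γ ↦ ∑ s, k γ s * φ s)` is a contraction `M_d(Λ) →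
M_d(Γ)`, and such that every column `k · s` is an `M_d`-norm limit of finitely supported functions
(`IsTransferKernel`). Averaging fixes 1 and is dual to a map `ℓ¹(Γ) → ℓ¹(Λ)`, so it is continuous
for the topologies `σ(M_d, X_d)`. By the condition on columns it preserves `c₀`. Elements of `A(Λ)`
are `M_d`-norm limits of finitely supported functions (`MemFourier.finApprox`), hence so are their
averages, and finitely supported functions on `Γ` lie in `A(Γ)`. Nets therefore pass from `Λ` to `Γ`
at an arbitrarily small cost in norm (`IsTransferKernel.transfer`). Both hypotheses are symmetric,
whence equivalences and equal constants.

Measure equivalence: a fundamental domain `Ω` of `Λ`, with normalised measure, carries an action of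
`Γ` and a `Λ`-valued cocycle `β`, and `k γ s` is the measure of `{β γ = s}`. The operators `f ↦ (x ↦
ξ_i (β g x) (f (S g x)))` on `L²(Ω, H_i)` compose by the cocycle identity, and their coefficient at
the constant function 1 is the averaged multiplier (`IsCocycle.bal`). Up to a scalar, a column is `γ
↦ m (Ω ∩ γ s Ω)`, a coefficient of the Koopman representation; it can be truncated because `Γ` has a
fundamental domain (`finApprox_measureReal_inter`).

`W*`-equivalence: an isomorphism `θ` sends `λ(γ)` to a left convolution `A` by a unit vector `a_γ`,
and `J A J` is the right convolution `B` given by the conjugate; the kernel is `k γ s = |a_γ(s)|²`.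
The maps `ξ_i`, as diagonal operators on `ℓ²(Λ, H_i)`, are placed between copies of `A` and `B` in
alternating order. After evaluation at 1 the two convolutions can be exchanged, absorbing one `ξ_i`
at a time (`exchange_right_left`, `Bal.conv`), provided that `ξ₁(g₁) ⋯ ξ_i(g_i)` depends on `g₁ ⋯
g_i` only; cutting down the Hilbert spaces achieves this (`normalBal_of_data`). For the columns,
`δ₁` is a limit of sums of vectors `S η` with `S` intertwining the identity representation and `θ`,
and `⟨z, θ(λ(γ)) S η⟩ = ⟨S* z, λ(γ) η⟩` is a coefficient of the regular representation of `Γ`. The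
supply of intertwiners (`mem_closure_span_intertwiners`) replaces automatic normality of `θ`. -/

namespace MdMult

/-! ### Norm limits of finitely supported multipliers -/

variable {d : ℕ} {G : Type u} [Group G]

lemma Bal.mono {a b : ℝ} (hab : a ≤ b) {φ : G → ℂ} (h : Bal d a φ) : Bal d b φ := by
  obtain ⟨F, h1, h2, h3⟩ := h
  exact ⟨F, fun x => (h1 x).trans (Real.sqrt_le_sqrt hab), h2,
    fun x => (h3 x).trans (Real.sqrt_le_sqrt hab)⟩

lemma Bal.norm_apply_le [d.AtLeastTwo] {c : ℝ} (hc : 0 ≤ c) {φ : G → ℂ} (h : Bal d c φ) (x : G) :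
    ‖φ x‖ ≤ c :=
  (norm_apply_le_mdNorm h.isMultiplier x).trans (h.mdNorm_le hc)

lemma Bal.smul {c : ℝ} {φ : G → ℂ} (h : Bal d c φ) (a : ℂ) :
    Bal d (‖a‖ * c) (a • φ) := by
  obtain ⟨F, h1, h2, h3⟩ := h
  -- A square root of `a` goes on each outer map, so that both bounds grow by the same factor.
  obtain ⟨b, hb⟩ : ∃ b : ℂ, b * b = a := ⟨a ^ (1 / 2 : ℂ), by
    rw [← sq, ← Complex.cpow_nat_mul]; simp⟩
  have hs : √(‖a‖ * c) = ‖b‖ * √c := by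
    rw [← hb, norm_mul, Real.sqrt_mul (by positivity), Real.sqrt_mul_self (norm_nonneg _)]
  have key : b * (∏ i ∈ Finset.range (d - 2), (1 : ℕ → ℂ) i) * b = a := by simp [hb]
  suffices h : Bal d (‖a‖ * c)
      ((b * (∏ i ∈ Finset.range (d - 2), (1 : ℕ → ℂ) i) * b) • φ) by rwa [key] at h
  rw [Bal, hs]
  refine ⟨F.rescale b b 1, fun x => ?_, fun i hi x => ?_, fun x => ?_⟩
  · change ‖b • F.first x‖ ≤ _
    rw [norm_smul]
    exact mul_le_mul_of_nonneg_left (h1 x) (norm_nonneg _)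
  · change ‖(1 : ℂ) • F.mid i x‖ ≤ _
    rw [one_smul]
    exact h2 i hi x
  · change ‖b • F.last x‖ ≤ _
    rw [norm_smul]
    exact mul_le_mul_of_nonneg_left (h3 x) (norm_nonneg _)

/-- `f` can be approximated in the `M_d`-norm by finitely supported functions. -/
def FinApprox (d : ℕ) (f : G → ℂ) : Prop :=
  ∀ ε > 0, ∃ g : G → ℂ, g.support.Finite ∧ Bal d ε (f - g)

/-- Closedness: half of `ε` is spent on reaching `g`, half on going from there to a finitely
supported function. -/
lemma FinApprox.of_forall_bal {f : G → ℂ}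
    (h : ∀ ε > 0, ∃ g, FinApprox d g ∧ Bal d ε (f - g)) : FinApprox d f := by
  intro ε hε
  obtain ⟨g, hg, hfg⟩ := h (ε / 2) (half_pos hε)
  obtain ⟨g', hg', hgg'⟩ := hg (ε / 2) (half_pos hε)
  refine ⟨g', hg', ?_⟩
  have := hfg.add (half_pos hε).le (half_pos hε).le hgg'
  rwa [add_halves, sub_add_sub_cancel] at this

lemma bal_zero {c : ℝ} (hc : 0 < c) : Bal d c (0 : G → ℂ) := by
  have h := exists_bal (d := d) (G := G) isMultiplier_one one_pos
  have h' := h.smul 0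
  rw [zero_smul, norm_zero, zero_mul] at h'
  exact h'.mono hc.le

lemma FinApprox.of_finite_support {f : G → ℂ} (hf : f.support.Finite) : FinApprox d f :=
  fun ε hε => ⟨f, hf, by rw [sub_self]; exact bal_zero hε⟩

lemma FinApprox.add {f g : G → ℂ} (hf : FinApprox d f) (hg : FinApprox d g) :
    FinApprox d (f + g) := by
  intro ε hε
  obtain ⟨f', hf', h1⟩ := hf (ε / 2) (half_pos hε)
  obtain ⟨g', hg', h2⟩ := hg (ε / 2) (half_pos hε)
  refine ⟨f' + g', (hf'.union hg').subset (Function.support_add f' g'), ?_⟩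
  have := h1.add (half_pos hε).le (half_pos hε).le h2
  rwa [add_halves, sub_add_sub_comm] at this

lemma FinApprox.smul {f : G → ℂ} (hf : FinApprox d f) (a : ℂ) : FinApprox d (a • f) := by
  intro ε hε
  have h0 : 0 < ‖a‖ + 1 := by positivity
  obtain ⟨f', hf', h1⟩ := hf (ε / (‖a‖ + 1)) (div_pos hε h0)
  refine ⟨a • f', hf'.subset (Function.support_const_smul_subset a f'), ?_⟩
  rw [← smul_sub]
  refine (h1.smul a).mono ?_
  rw [mul_div_assoc', div_le_iff₀ h0]
  nlinarith

lemma FinApprox.sum {ι : Type*} (s : Finset ι) {f : ι → G → ℂ} (h : ∀ i ∈ s, FinApprox d (f i)) :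
    FinApprox d (∑ i ∈ s, f i) := by
  classical
  induction s using Finset.induction_on with
  | empty =>
    rw [Finset.sum_empty]
    exact FinApprox.of_finite_support (by simp)
  | insert i s hi ih =>
    rw [Finset.sum_insert hi]
    exact (h i (by simp)).add (ih fun j hj => h j (by simp [hj]))

/-- The `M_d`-norm dominates the supremum norm, so the approximation is uniform. -/
lemma FinApprox.memCZero [d.AtLeastTwo] {f : G → ℂ} (hf : FinApprox d f) : MemCZero f := by
  refine Metric.tendsto_nhds.2 fun ε hε => ?_
  obtain ⟨g, hg, hfg⟩ := hf (ε / 2) (half_pos hε)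
  filter_upwards [hg.compl_mem_cofinite] with x hx
  have hx' : g x = 0 := by simpa using hx
  have := hfg.norm_apply_le (half_pos hε).le x
  rw [Pi.sub_apply, hx', sub_zero] at this
  rw [dist_zero_right]
  linarith

end MdMult

open MdMult

/-! ### Nets converging to 1, without nets -/

section Approx

variable (d : ℕ) [d.AtLeastTwo] {G : Type u} [Group G]

/-- The constant function `1` lies in the `σ(M_d(G), X_d(G))`-closure of the set of multipliers of
norm at most `C` which satisfy `S`. -/
def ApproxOne (S : (G → ℂ) → Prop) (C : ℝ≥0∞) : Prop :=
  ∀ F : Finset (StrongDual ℂ (MdSpace d G)), ↑F ⊆ MdPredual d G → ∀ ε > 0,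
    ∃ φ : MdSpace d G, S φ ∧ ENNReal.ofReal ‖φ‖ ≤ C ∧ ∀ ω ∈ F, ‖ω φ - ω 1‖ < ε

variable {d}

lemma HasNet.approxOne {S : (G → ℂ) → Prop} {C : ℝ≥0∞} (h : HasNet d S C) : ApproxOne d S C := by
  obtain ⟨ι, _, _, _, φ, hS, ht, hC⟩ := h
  intro F hF ε hε
  have : ∀ᶠ i in atTop, ∀ ω ∈ F, ‖ω (φ i) - ω 1‖ < ε := by
    refine (eventually_all_finset F).2 fun ω hω => ?_
    have := Metric.tendsto_nhds.1 (ht ω (hF hω)) ε hε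
    simpa only [dist_eq_norm] using this
  obtain ⟨i, hi⟩ := this.exists
  exact ⟨φ i, hS i, hC ▸ le_iSup (fun i => ENNReal.ofReal ‖φ i‖) i, hi⟩

/-- The net is indexed by a finite set of functionals and a precision. Its supremum of norms may be
smaller than `C`, hence the `C'`. -/
lemma ApproxOne.exists_hasNet {S : (G → ℂ) → Prop} {C : ℝ≥0∞} (h : ApproxOne d S C) :
    ∃ C' ≤ C, HasNet d S C' := by
  classical
  have h' : ∀ p : Finset (MdPredual d G) × ℕ, ∃ φ : MdSpace d G, S φ ∧ ENNReal.ofReal ‖φ‖ ≤ C ∧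
      ∀ ω ∈ p.1, ‖ω.1 φ - ω.1 1‖ < 1 / ((p.2 : ℝ) + 1) := by
    intro p
    obtain ⟨φ, h1, h2, h3⟩ := h (p.1.image Subtype.val) (by
      intro ω hω
      obtain ⟨ω', _, rfl⟩ := Finset.mem_image.1 (Finset.mem_coe.1 hω)
      exact ω'.2) (1 / ((p.2 : ℝ) + 1)) (by positivity)
    exact ⟨φ, h1, h2, fun ω hω => h3 ω (Finset.mem_image_of_mem _ hω)⟩
  choose φ h1 h2 h3 using h'
  refine ⟨⨆ p, ENNReal.ofReal ‖φ p‖, iSup_le h2, _, inferInstance, inferInstance, inferInstance, φ,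
    h1, fun ω hω => ?_, rfl⟩
  refine Metric.tendsto_atTop.2 fun ε hε => ?_
  obtain ⟨n, hn⟩ := exists_nat_one_div_lt hε
  refine ⟨({⟨ω, hω⟩}, n), fun p hp => ?_⟩
  rw [dist_eq_norm]
  refine (h3 p ⟨ω, hω⟩ (hp.1 (Finset.mem_singleton_self _))).trans (lt_of_le_of_lt ?_ hn)
  have : (n : ℝ) ≤ p.2 := Nat.cast_le.2 hp.2
  gcongr

end Approx

/-! ### Transfer kernels and what they preserve -/

section Kernel

/-- A Markov kernel from `Γ` to `Λ` which turns `M_d`-multipliers of `Λ` into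
`M_d`-multipliers of `Γ`. -/
structure IsTransferKernel (d : ℕ) {Γ : Type u} {Λ : Type v} [Group Γ] [Group Λ]
    (k : Γ → Λ → ℝ) : Prop where
  nonneg : ∀ γ s, 0 ≤ k γ s
  hasSum : ∀ γ, HasSum (k γ) 1
  bal : ∀ (c : ℝ) (φ : Λ → ℂ), 0 ≤ c → Bal d c φ → Bal d c fun γ => ∑' s, (k γ s : ℂ) * φ s
  finApprox : ∀ s, FinApprox d fun γ => (k γ s : ℂ)

variable {d : ℕ} {Γ : Type u} {Λ : Type v} [Group Γ] [Group Λ] {k : Γ → Λ → ℝ}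

namespace IsTransferKernel

lemma summable_norm (hk : IsTransferKernel d k) (γ : Γ) {φ : Λ → ℂ} {C : ℝ}
    (hC : ∀ s, ‖φ s‖ ≤ C) : Summable fun s => ‖(k γ s : ℂ) * φ s‖ := by
  refine Summable.of_nonneg_of_le (fun _ => norm_nonneg _) (fun s => ?_)
    ((hk.hasSum γ).summable.mul_right C)
  rw [norm_mul, Complex.norm_real, Real.norm_of_nonneg (hk.nonneg γ s)]
  exact mul_le_mul_of_nonneg_left (hC s) (hk.nonneg γ s)

lemma norm_tsum_le (hk : IsTransferKernel d k) (γ : Γ) {φ : Λ → ℂ} {C : ℝ}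
    (hC : ∀ s, ‖φ s‖ ≤ C) : ‖∑' s, (k γ s : ℂ) * φ s‖ ≤ C := by
  have h := (hk.hasSum γ).mul_right C
  rw [one_mul] at h
  refine tsum_of_norm_bounded h fun s => ?_
  rw [norm_mul, Complex.norm_real, Real.norm_of_nonneg (hk.nonneg γ s)]
  exact mul_le_mul_of_nonneg_left (hC s) (hk.nonneg γ s)

lemma isMultiplier (hk : IsTransferKernel d k) {φ : Λ → ℂ} (hφ : IsMultiplier d φ) :
    IsMultiplier d fun γ => ∑' s, (k γ s : ℂ) * φ s :=
  (hk.bal _ φ (by have := mdNorm_nonneg (d := d) φ; linarith) (exists_bal hφ one_pos)).isMultiplier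

lemma mdNorm_le (hk : IsTransferKernel d k) {φ : Λ → ℂ} (hφ : IsMultiplier d φ) :
    mdNorm d (fun γ => ∑' s, (k γ s : ℂ) * φ s) ≤ mdNorm d φ := by
  have h0 := mdNorm_nonneg (d := d) φ
  refine le_of_forall_pos_le_add fun ε hε => ?_
  exact (hk.bal _ φ (by linarith) (exists_bal hφ hε)).mdNorm_le (by linarith)

variable [d.AtLeastTwo]

/-- The contraction `M_d(Λ) → M_d(Γ)` given by a transfer kernel. -/
noncomputable def map (hk : IsTransferKernel d k) : MdSpace d Λ →L[ℂ] MdSpace d Γ :=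
  LinearMap.mkContinuous
    { toFun := fun φ => ⟨fun γ => ∑' s, (k γ s : ℂ) * φ s, hk.isMultiplier φ.2⟩
      map_add' := fun φ ψ => by
        refine Subtype.ext (funext fun γ => ?_)
        have h1 := (hk.summable_norm γ (norm_apply_le_mdNorm φ.2)).of_norm
        have h2 := (hk.summable_norm γ (norm_apply_le_mdNorm ψ.2)).of_norm
        change ∑' s, (k γ s : ℂ) * (φ s + ψ s) = _
        simp only [mul_add]
        exact h1.tsum_add h2
      map_smul' := fun a φ => by
        refine Subtype.ext (funext fun γ => ?_)
        change ∑' s, (k γ s : ℂ) * (a * φ s) = a * ∑' s, (k γ s : ℂ) * φ s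
        rw [← tsum_mul_left]
        exact tsum_congr fun s => by ring } 1 fun φ => by
    rw [one_mul]
    exact hk.mdNorm_le φ.2

lemma map_apply (hk : IsTransferKernel d k) (φ : MdSpace d Λ) (γ : Γ) :
    hk.map φ γ = ∑' s, (k γ s : ℂ) * φ s := rfl

lemma map_one (hk : IsTransferKernel d k) : hk.map 1 = 1 := by
  refine Subtype.ext (funext fun γ => ?_)
  rw [map_apply]
  change ∑' s, (k γ s : ℂ) * (1 : ℂ) = 1
  simp only [mul_one]
  rw [← Complex.ofReal_tsum, (hk.hasSum γ).tsum_eq, Complex.ofReal_one]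

/-- By Fubini, averaging followed by summation against `f` is summation against `s ↦ ∑ γ, f γ * k γ
s`, again in `ℓ¹`; the closure follows by continuity of composition. -/
lemma comp_map_mem (hk : IsTransferKernel d k) {ω : StrongDual ℂ (MdSpace d Γ)}
    (hω : ω ∈ MdPredual d Γ) : ω.comp hk.map ∈ MdPredual d Λ := by
  have hcont : Continuous fun ω : StrongDual ℂ (MdSpace d Γ) => ω.comp hk.map := by fun_prop
  refine map_mem_closure (f := fun ω : StrongDual ℂ (MdSpace d Γ) => ω.comp hk.map) hcont hω ?_
  rintro ω ⟨f, hf, hω⟩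
  -- The rows have mass 1, so the double sum is the `ℓ¹`-norm of `f`. This justifies both the
  -- summability of the new function and the interchange of sums.
  have hs : Summable fun p : Γ × Λ => ‖f p.1‖ * k p.1 p.2 := by
    have h0 : ∀ p : Γ × Λ, 0 ≤ ‖f p.1‖ * k p.1 p.2 := fun p =>
      mul_nonneg (norm_nonneg _) (hk.nonneg _ _)
    have h1 : ∀ γ, HasSum (fun s => ‖f γ‖ * k γ s) ‖f γ‖ := fun γ => by
      have := (hk.hasSum γ).mul_left ‖f γ‖
      rwa [mul_one] at this
    rw [summable_prod_of_nonneg h0]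
    refine ⟨fun γ => (h1 γ).summable, ?_⟩
    have h2 : (fun γ => ∑' s, ‖f γ‖ * k γ s) = fun γ => ‖f γ‖ := funext fun γ => (h1 γ).tsum_eq
    change Summable fun γ => ∑' s, ‖f γ‖ * k γ s
    rw [h2]
    exact hf
  have hn : ∀ p : Γ × Λ, ‖f p.1 * (k p.1 p.2 : ℂ)‖ = ‖f p.1‖ * k p.1 p.2 := fun p => by
    rw [norm_mul, Complex.norm_real, Real.norm_of_nonneg (hk.nonneg _ _)]
  refine ⟨fun s => ∑' γ, f γ * (k γ s : ℂ), ?_, fun φ => ?_⟩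
  · have hs' : Summable fun p : Λ × Γ => ‖f p.2‖ * k p.2 p.1 :=
      (Equiv.prodComm Λ Γ).summable_iff.2 hs
    have h2 := hs'.prod
    refine Summable.of_nonneg_of_le (fun _ => norm_nonneg _) (fun s => ?_) h2
    refine tsum_of_norm_bounded (hs'.prod_factor s).hasSum fun γ => (hn (γ, s)).le
  · rw [ContinuousLinearMap.comp_apply, hω]
    simp only [map_apply, ← tsum_mul_left, ← tsum_mul_right]
    have hsum : Summable (Function.uncurry fun (γ : Γ) (s : Λ) => f γ * ((k γ s : ℂ) * φ s)) := by
      refine Summable.of_norm_bounded (hs.mul_right (mdNorm d φ.1)) fun p => ?_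
      change ‖f p.1 * ((k p.1 p.2 : ℂ) * φ p.2)‖ ≤ _
      rw [← mul_assoc, norm_mul, hn]
      exact mul_le_mul_of_nonneg_left (norm_apply_le_mdNorm φ.2 _)
        (mul_nonneg (norm_nonneg _) (hk.nonneg _ _))
    refine hsum.tsum_comm.symm.trans ?_
    exact tsum_congr fun s => tsum_congr fun γ => by ring

lemma memCZero_map (hk : IsTransferKernel d k) {φ : MdSpace d Λ} (hφ : MemCZero φ) :
    MemCZero (hk.map φ) := by
  classical
  refine Metric.tendsto_nhds.2 fun ε hε => ?_
  have hfin : {s | ¬ ‖φ s‖ < ε / 2}.Finite := by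
    have := Metric.tendsto_nhds.1 hφ (ε / 2) (half_pos hε)
    simp only [dist_zero_right] at this
    exact this
  set F := hfin.toFinset with hF
  have h1 : Tendsto (fun γ => ∑ s ∈ F, (k γ s : ℂ) * φ s) cofinite (𝓝 0) := by
    rw [show (0 : ℂ) = ∑ s ∈ F, 0 * φ s by simp]
    exact tendsto_finsetSum _ fun s _ => (hk.finApprox s).memCZero.mul_const _
  filter_upwards [Metric.tendsto_nhds.1 h1 (ε / 2) (half_pos hε)] with γ hγ
  rw [dist_zero_right] at hγ ⊢
  -- Off the finite set `F` the average is at most `ε / 2`, the rows being probability vectors; on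
  -- `F` it is a finite combination of columns, which vanish at infinity.
  let φ' : Λ → ℂ := fun s => if s ∈ F then 0 else φ s
  have hφ' : ∀ s, ‖φ' s‖ ≤ ε / 2 := by
    intro s
    by_cases hs : s ∈ F
    · simp [φ', hs, (half_pos hε).le]
    · have : ‖φ s‖ < ε / 2 := by simpa [hF] using hs
      simpa [φ', hs] using this.le
  have e : hk.map φ γ = ∑ s ∈ F, (k γ s : ℂ) * φ s + ∑' s, (k γ s : ℂ) * φ' s := by
    have h3 : ∑ s ∈ F, (k γ s : ℂ) * φ s = ∑' s, if s ∈ F then (k γ s : ℂ) * φ s else 0 := by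
      rw [tsum_eq_sum (s := F) (fun s hs => by simp [hs])]
      exact Finset.sum_congr rfl fun s hs => by simp [hs]
    rw [h3, map_apply, ← Summable.tsum_add]
    · refine tsum_congr fun s => ?_
      by_cases hs : s ∈ F <;> simp [φ', hs]
    · exact summable_of_ne_finset_zero (s := F) fun s hs => by simp [hs]
    · exact (hk.summable_norm γ hφ').of_norm
  rw [e]
  refine (norm_add_le _ _).trans_lt ?_
  have := hk.norm_tsum_le γ hφ'
  linarith

lemma approxOne_memCZero (hk : IsTransferKernel d k) {C : ℝ≥0∞}
    (h : ApproxOne d (G := Λ) MemCZero C) : ApproxOne d (G := Γ) MemCZero C := by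
  classical
  intro F hF ε hε
  obtain ⟨φ, h1, h2, h3⟩ := h (F.image fun ω => ω.comp hk.map) (by
    intro ω hω
    obtain ⟨ω', hω', rfl⟩ := Finset.mem_image.1 (Finset.mem_coe.1 hω)
    exact hk.comp_map_mem (hF hω')) ε hε
  refine ⟨hk.map φ, hk.memCZero_map h1, (ENNReal.ofReal_le_ofReal (hk.mdNorm_le φ.2)).trans h2,
    fun ω hω => ?_⟩
  have := h3 _ (Finset.mem_image_of_mem _ hω)
  rwa [ContinuousLinearMap.comp_apply, ContinuousLinearMap.comp_apply, map_one] at this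

end IsTransferKernel

/-- The translates of `δ₁` are the `δ_x`, which read off the coordinates of a finite vector. -/
lemma memFourier_of_finite_support {G : Type u} [Group G] {f : G → ℂ} (hf : f.support.Finite) :
    MemFourier f := by
  classical
  refine ⟨lp.single 2 1 1, ∑ s ∈ hf.toFinset, lp.single 2 s (starRingEnd ℂ (f s)), fun x => ?_⟩
  have hx : leftReg x (lp.single 2 1 1 : EllTwo G) = lp.single 2 x 1 := by
    ext y
    rw [leftReg_apply, lp.single_apply, lp.single_apply, Pi.single_apply, Pi.single_apply]
    simp only [inv_mul_eq_one, eq_comm]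
  rw [hx, lp.inner_single_right, lp.coeFn_sum, Finset.sum_apply]
  simp only [lp.single_apply, Pi.single_apply]
  rw [Finset.sum_ite_eq hf.toFinset x]
  by_cases h : f x = 0 <;> simp [h]

lemma MdSpace.norm_sub_le_of_bal [d.AtLeastTwo] {G : Type u} [Group G] {φ ψ : MdSpace d G} {c : ℝ} (hc : 0 ≤ c)
    (h : Bal d c ((φ : G → ℂ) - (ψ : G → ℂ))) : ‖φ - ψ‖ ≤ c :=
  h.mdNorm_le hc

variable [d.AtLeastTwo]

lemma exists_finite_support_norm_sub_le {G : Type u} [Group G] {φ : MdSpace d G}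
    (h : FinApprox d (φ : G → ℂ)) {ε : ℝ} (hε : 0 < ε) :
    ∃ ψ : MdSpace d G, (Function.support (ψ : G → ℂ)).Finite ∧ ‖φ - ψ‖ ≤ ε := by
  obtain ⟨g, hg, hb⟩ := h ε hε
  have hgm : IsMultiplier d g := by
    have := φ.2.add (hb.isMultiplier.smul (-1))
    rwa [neg_one_smul, ← sub_eq_add_neg, sub_sub_cancel] at this
  exact ⟨⟨g, hgm⟩, hg, MdSpace.norm_sub_le_of_bal hε.le hb⟩

/-- The average itself is only seen to be a norm limit of finitely supported functions. It is
replaced by one of these, and `δ` pays for the change of norm. -/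
lemma IsTransferKernel.approxOne_memFourier (hk : IsTransferKernel d k)
    (hΛ : ∀ φ : Λ → ℂ, MemFourier φ → FinApprox d φ) {C : ℝ≥0∞}
    (h : ApproxOne d (G := Λ) MemFourier C) {δ : ℝ} (hδ : 0 < δ) :
    ApproxOne d (G := Γ) MemFourier (C + ENNReal.ofReal δ) := by
  classical
  intro F hF ε hε
  set M := ∑ ω ∈ F, ‖ω‖ with hM
  have hM0 : 0 ≤ M := Finset.sum_nonneg fun _ _ => norm_nonneg _
  -- Two replacements cost `η` each: `φ` by a finitely supported `φ'` on `Λ`, and the average of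
  -- `φ'` by a finitely supported `ψ` on `Γ`. Since `M` bounds every `‖ω‖`, they move each `ω` by
  -- less than `ε / 2`.
  obtain ⟨η, hη, hηδ, hηε⟩ : ∃ η > 0, 2 * η ≤ δ ∧ M * (2 * η) < ε / 2 := by
    refine ⟨min (δ / 2) (ε / (8 * (M + 1))), by positivity, ?_, ?_⟩
    · linarith [min_le_left (δ / 2) (ε / (8 * (M + 1)))]
    · have h1 := min_le_right (δ / 2) (ε / (8 * (M + 1)))
      have h2 : M * (2 * (ε / (8 * (M + 1)))) ≤ ε / 4 := by
        rw [show M * (2 * (ε / (8 * (M + 1)))) = ε / 4 * (M / (M + 1)) by field_simp; ring]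
        have : M / (M + 1) ≤ 1 := (div_le_one (by linarith)).2 (by linarith)
        nlinarith
      have h3 : M * (2 * min (δ / 2) (ε / (8 * (M + 1)))) ≤ M * (2 * (ε / (8 * (M + 1)))) := by
        gcongr
      linarith
  obtain ⟨φ, h1, h2, h3⟩ := h (F.image fun ω => ω.comp hk.map) (by
    intro ω hω
    obtain ⟨ω', hω', rfl⟩ := Finset.mem_image.1 (Finset.mem_coe.1 hω)
    exact hk.comp_map_mem (hF hω')) (ε / 2) (half_pos hε)
  obtain ⟨φ', hφ', hφφ'⟩ := exists_finite_support_norm_sub_le (hΛ _ h1) hη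
  have happ : FinApprox d (hk.map φ' : Γ → ℂ) := by
    have e : (hk.map φ' : Γ → ℂ) = ∑ s ∈ hφ'.toFinset, φ' s • fun γ => (k γ s : ℂ) := by
      funext γ
      rw [hk.map_apply, Finset.sum_apply, tsum_eq_sum (s := hφ'.toFinset) (fun s hs => by
        have : φ' s = 0 := by simpa using hs
        rw [this, mul_zero])]
      exact Finset.sum_congr rfl fun s _ => mul_comm _ _
    rw [e]
    exact FinApprox.sum _ fun s _ => (hk.finApprox s).smul _
  obtain ⟨ψ, hψ, hψφ⟩ := exists_finite_support_norm_sub_le happ hη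
  have hT : ∀ χ : MdSpace d Λ, ‖hk.map χ‖ ≤ ‖χ‖ := fun χ => hk.mdNorm_le χ.2
  have hd : ‖hk.map φ - ψ‖ ≤ 2 * η := by
    have := hT (φ - φ')
    rw [map_sub] at this
    calc ‖hk.map φ - ψ‖ ≤ ‖hk.map φ - hk.map φ'‖ + ‖hk.map φ' - ψ‖ := norm_sub_le_norm_sub_add_norm_sub _ _ _
      _ ≤ η + η := by gcongr; exact this.trans hφφ'
      _ = 2 * η := by ring
  refine ⟨ψ, memFourier_of_finite_support hψ, ?_, fun ω hω => ?_⟩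
  · have : ‖ψ‖ ≤ ‖φ‖ + δ := by
      have h4 : ‖ψ‖ ≤ ‖hk.map φ‖ + ‖hk.map φ - ψ‖ := by
        rw [norm_sub_rev]
        exact norm_le_norm_add_norm_sub' _ _
      linarith [hT φ]
    refine (ENNReal.ofReal_le_ofReal this).trans ?_
    rw [ENNReal.ofReal_add (norm_nonneg _) hδ.le]
    gcongr
  · have h5 := h3 _ (Finset.mem_image_of_mem _ hω)
    rw [ContinuousLinearMap.comp_apply, ContinuousLinearMap.comp_apply, hk.map_one] at h5
    have h6 : ‖ω (hk.map φ) - ω ψ‖ ≤ M * (2 * η) := by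
      rw [← map_sub]
      refine (ω.le_opNorm _).trans ?_
      have : ‖ω‖ ≤ M := Finset.single_le_sum (f := fun ω => ‖ω‖) (fun _ _ => norm_nonneg _) hω
      gcongr
    calc ‖ω ψ - ω 1‖ ≤ ‖ω ψ - ω (hk.map φ)‖ + ‖ω (hk.map φ) - ω 1‖ :=
          norm_sub_le_norm_sub_add_norm_sub _ _ _
      _ < ε := by rw [norm_sub_rev (ω ψ)]; linarith

/-- The properties and constants which a transfer kernel from `Γ` to `Λ` carries from `Λ`
to `Γ`. -/
lemma IsTransferKernel.transfer (hk : IsTransferKernel d k)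
    (hΛ : ∀ φ : Λ → ℂ, MemFourier φ → FinApprox d φ) :
    (MdAP d Λ → MdAP d Γ) ∧ (MdWeaklyAmenable d Λ → MdWeaklyAmenable d Γ) ∧
    (MdWeakHaagerup d Λ → MdWeakHaagerup d Γ) ∧
    cowlingHaagerupConst d Γ ≤ cowlingHaagerupConst d Λ ∧
    weakHaagerupConst d Γ ≤ weakHaagerupConst d Λ := by
  have hA : ∀ C, HasNet d (G := Λ) MemFourier C → ∀ δ : ℝ, 0 < δ →
      ∃ C' ≤ C + ENNReal.ofReal δ, HasNet d (G := Γ) MemFourier C' := fun C hC δ hδ =>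
    (hk.approxOne_memFourier hΛ hC.approxOne hδ).exists_hasNet
  have hZ : ∀ C, HasNet d (G := Λ) MemCZero C → ∃ C' ≤ C, HasNet d (G := Γ) MemCZero C' :=
    fun C hC => (hk.approxOne_memCZero hC.approxOne).exists_hasNet
  refine ⟨?_, ?_, ?_, ?_, ?_⟩
  · rintro ⟨C, hC⟩
    obtain ⟨C', -, h⟩ := hA C hC 1 one_pos
    exact ⟨C', h⟩
  · rintro ⟨C, hC, hn⟩
    obtain ⟨C', h', h⟩ := hA C hn 1 one_pos
    exact ⟨C', h'.trans_lt (ENNReal.add_lt_top.2 ⟨hC, ENNReal.ofReal_lt_top⟩), h⟩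
  · rintro ⟨C, hC, hn⟩
    obtain ⟨C', h', h⟩ := hZ C hn
    exact ⟨C', h'.trans_lt hC, h⟩
  -- The loss `δ` is arbitrary, so it disappears in the infimum.
  · refine le_sInf fun C hC => ENNReal.le_of_forall_pos_le_add fun δ hδ _ => ?_
    obtain ⟨C', h', h⟩ := hA C hC δ hδ
    rw [ENNReal.ofReal_coe_nnreal] at h'
    exact (sInf_le (show C' ∈ {C | HasNet d (G := Γ) MemFourier C} from h)).trans h'
  · refine le_sInf fun C hC => ?_
    obtain ⟨C', h', h⟩ := hZ C hC
    exact (sInf_le (show C' ∈ {C | HasNet d (G := Γ) MemCZero C} from h)).trans h'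

end Kernel

/-! ### Normal form of factorizations, and change of universe -/

namespace MdMult

section Reduction

/-- Used to bring Hilbert spaces from any universe into that of the group. The span of a small set
is an image of finitely supported families, and points of the closure are determined by sequences in
the span, so the closed span is small and has a Hilbert basis with small index set. -/
lemma exists_isometry_range_eq {E : Type w} [NormedAddCommGroup E] [InnerProductSpace ℂ E]
    [CompleteSpace E] (s : Set E) [Small.{u} s] :
    ∃ (ι : Type u) (J : lp (fun _ : ι => ℂ) 2 →ₗᵢ[ℂ] E),
      LinearMap.range J.toLinearMap = (Submodule.span ℂ s).topologicalClosure := by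
  classical
  set W := (Submodule.span ℂ s).topologicalClosure with hW
  have h1 : Small.{u} (Submodule.span ℂ s) := by
    have : Function.Surjective (fun f : Shrink.{u} s →₀ ℂ =>
        (⟨Finsupp.linearCombination ℂ (fun x => ((equivShrink s).symm x : E)) f, by
          have := Submodule.mem_top (R := ℂ) (x := f)
          rw [Finsupp.linearCombination_apply]
          exact Submodule.sum_mem _ fun x _ =>
            Submodule.smul_mem _ _ (Submodule.subset_span (Subtype.coe_prop _))⟩ :
          Submodule.span ℂ s)) := by
      rintro ⟨v, hv⟩
      have hr : Set.range (fun x : Shrink.{u} s => ((equivShrink s).symm x : E)) = s := by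
        ext y
        constructor
        · rintro ⟨x, rfl⟩
          exact Subtype.coe_prop _
        · intro hy
          exact ⟨equivShrink s ⟨y, hy⟩, by simp⟩
      rw [← hr, Finsupp.mem_span_range_iff_exists_finsupp] at hv
      obtain ⟨c, hc⟩ := hv
      exact ⟨c, Subtype.ext hc⟩
    exact small_of_surjective this
  have h2 : Small.{u} W := by
    have h : ∀ x : W, ∃ y : ℕ → Submodule.span ℂ s, Tendsto (fun n => (y n : E)) atTop (𝓝 x) := by
      intro x
      have hx : (x : E) ∈ closure (Submodule.span ℂ s : Set E) := x.2
      obtain ⟨y, hy, hyx⟩ := mem_closure_iff_seq_limit.1 hx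
      exact ⟨fun n => ⟨y n, hy n⟩, hyx⟩
    choose y hy using h
    refine small_of_injective (f := y) fun a b hab => Subtype.ext ?_
    exact tendsto_nhds_unique (hy a) (hab ▸ hy b)
  have : CompleteSpace W := (Submodule.isClosed_topologicalClosure _).completeSpace_coe
  obtain ⟨B, b, hb⟩ := exists_hilbertBasis ℂ W
  let e := (equivShrink.{u} B).symm
  have ho : Orthonormal ℂ fun i : Shrink.{u} B => ((b (e i) : W) : E) :=
    (b.orthonormal.comp e e.injective).comp_linearIsometry W.subtypeₗᵢ
  refine ⟨Shrink.{u} B, ho.orthogonalFamily.linearIsometry, ?_⟩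
  rw [ho.orthogonalFamily.range_linearIsometry]
  refine le_antisymm ?_ ?_
  · refine Submodule.topologicalClosure_minimal _ (iSup_le fun i => ?_)
      (Submodule.isClosed_topologicalClosure _)
    rintro _ ⟨z, rfl⟩
    exact W.smul_mem z (b (e i)).2
  · intro x hx
    have hd := b.dense_span
    have hx' : (⟨x, hx⟩ : W) ∈ (Submodule.span ℂ (Set.range b)).topologicalClosure := by
      rw [hd]; trivial
    have hm : Set.MapsTo (Subtype.val : W → E) (Submodule.span ℂ (Set.range b) : Set W)
        ((⨆ i, LinearMap.range (LinearIsometry.toSpanSingleton ℂ E (ho.1 i)).toLinearMap :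
          Submodule ℂ E) : Set E) := by
      have : Submodule.span ℂ (Set.range b) ≤ Submodule.comap W.subtype
          (⨆ i, LinearMap.range (LinearIsometry.toSpanSingleton ℂ E (ho.1 i)).toLinearMap) := by
        refine Submodule.span_le.2 ?_
        rintro _ ⟨j, rfl⟩
        refine Submodule.mem_iSup_of_mem (e.symm j) ⟨1, ?_⟩
        simp [e]
      exact this
    exact map_mem_closure continuous_subtype_val hx' hm

variable {d : ℕ} {G : Type u} [Group G] {φ : G → ℂ}

section Reach

variable {H : ℕ → Type w} [∀ i, NormedAddCommGroup (H i)] [∀ i, InnerProductSpace ℂ (H i)]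
  (mid : ∀ i, G → H (i + 1) →L[ℂ] H i) (last : G → ℂ →L[ℂ] H (d - 2))

/-- `Reach mid last i v p` says that `v = ξ_{i+2} (x_{i+2}) ⋯ ξ_d (x_d) 1` for some group elements
with product `p`. -/
inductive Reach : ∀ i, H i → G → Prop
  | last (x : G) : Reach (d - 2) (last x 1) x
  | mid (i : ℕ) (v : H (i + 1)) (p x : G) : i < d - 2 → Reach (i + 1) v p →
      Reach i (mid i x v) (x * p)

variable {mid last}

omit [Group G] in
lemma chain_congr {g g' : ℕ → G} (n : ℕ) (h : ∀ i < n, g (i + 1) = g' (i + 1)) :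
    chain mid g n = chain mid g' n := by
  induction n with
  | zero => rfl
  | succ n ih =>
    rw [chain, chain, ih fun i hi => h i (by omega), h n (by omega)]

lemma prod_range_succ (g : ℕ → G) (n : ℕ) :
    ((List.range (n + 1)).map g).prod = ((List.range n).map g).prod * g n := by
  rw [List.range_succ, List.map_append, List.prod_append]
  simp

lemma prod_range_congr {g g' : ℕ → G} (n : ℕ) (h : ∀ i < n, g i = g' i) :
    ((List.range n).map g).prod = ((List.range n).map g').prod := by
  congr 1
  exact List.map_congr_left fun i hi => h i (List.mem_range.1 hi)

/-- Each step of the induction overwrites one entry of `g` by the group element used last in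
building `v`. Hence, on reachable vectors, `ξ₁(g₁) ⋯ ξ_{i+1}(g_{i+1})` sees only the product of its
arguments. -/
lemma Reach.first_chain (hd : 2 ≤ d) {first : G → H 0 →L[ℂ] ℂ}
    (factor : ∀ g : ℕ → G,
      φ ((List.range d).map g).prod = first (g 0) (chain mid g (d - 2) (last (g (d - 1)) 1)))
    {i : ℕ} {v : H i} {p : G} (h : Reach mid last i v p) (g : ℕ → G) :
    first (g 0) (chain mid g i v) = φ (((List.range (i + 1)).map g).prod * p) := by
  induction h generalizing g with
  | last x =>
    obtain ⟨k, rfl⟩ : ∃ k, d = k + 2 := ⟨d - 2, by omega⟩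
    have hf := factor (Function.update g (k + 1) x)
    simp only [Nat.add_sub_cancel, Nat.add_succ_sub_one] at hf ⊢
    rw [prod_range_succ, Function.update_self, Function.update_of_ne (by omega),
      chain_congr (g' := g) (k + 2 - 2) fun i hi => Function.update_of_ne (by omega) _ _,
      prod_range_congr (g' := g) (k + 1) fun i hi => Function.update_of_ne (by omega) _ _] at hf
    exact hf.symm
  | mid i v p x hi h ih =>
    have h' := ih (Function.update g (i + 1) x)
    rw [prod_range_succ, chain, Function.update_self, Function.update_of_ne (by omega),
      chain_congr (g' := g) i fun i hi => Function.update_of_ne (by omega) _ _,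
      prod_range_congr (g' := g) (i + 1) fun i hi => Function.update_of_ne (by omega) _ _,
      mul_assoc] at h'
    exact h'

/-- Downward induction on the level: one vector per group element at level `d - 2`, nothing above
it, and each lower level is an image of `G` times the previous one. -/
lemma small_reach (n : ℕ) : ∀ i, d - 2 - i = n → Small.{u} {v | ∃ p, Reach mid last i v p} := by
  induction n with
  | zero =>
    intro i hi
    by_cases h : i = d - 2
    · subst h
      refine small_subset (s := Set.range fun x => last x 1) ?_
      rintro v ⟨p, hv⟩
      -- The level is made a variable so that case analysis applies; back at `d - 2` the cast is
      -- trivial.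
      have key : ∀ j (w : H j) q, Reach mid last j w q → j < d - 2 ∨
          ∃ (h : d - 2 = j) (x : G), h ▸ last x 1 = w := by
        intro j w q hw
        cases hw with
        | last => exact Or.inr ⟨rfl, q, rfl⟩
        | mid _ v p x hi h => exact Or.inl hi
      rcases key _ v p hv with h | ⟨h, x, hx⟩
      · omega
      · exact ⟨x, hx⟩
    · refine small_subset (s := ∅) ?_
      rintro v ⟨p, hv⟩
      cases hv with
      | last x => exact absurd rfl h
      | mid _ v p x hi h => omega
  | succ n ih =>
    intro i hi
    have := ih (i + 1) (by omega)
    refine small_subset (s := Set.range fun q : G × {v | ∃ p, Reach mid last (i + 1) v p} =>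
      mid i q.1 q.2) ?_
    rintro v ⟨p, hv⟩
    cases hv with
    | last x => omega
    | mid _ v p x hi h => exact ⟨(x, ⟨v, p, h⟩), rfl⟩

end Reach

/-- A factorization of `φ` in which the functionals `L i g = ξ₁ (g₁) ⋯ ξ_{i+1} (g_{i+1})` only
depend on the product `g = g₁ ⋯ g_{i+1}`. -/
def NormalBal (d : ℕ) (c : ℝ) {G : Type u} [Group G] (φ : G → ℂ) : Prop :=
  ∃ (H : ℕ → Type w) (_ : ∀ i, NormedAddCommGroup (H i)) (_ : ∀ i, InnerProductSpace ℂ (H i))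
    (_ : ∀ i, CompleteSpace (H i)) (L : ∀ i, G → H i →L[ℂ] ℂ) (mid : ∀ i, G → H (i + 1) →L[ℂ] H i)
    (last : G → ℂ →L[ℂ] H (d - 2)),
    (∀ i ≤ d - 2, ∀ x, ‖L i x‖ ≤ √c) ∧ (∀ i < d - 2, ∀ x, ‖mid i x‖ ≤ 1) ∧
    (∀ x, ‖last x‖ ≤ √c) ∧ (∀ i < d - 2, ∀ g h, (L i g).comp (mid i h) = L (i + 1) (g * h)) ∧
    ∀ g h, L (d - 2) g (last h 1) = φ (g * h)

/-- The spaces are cut down to the closed spans of the reachable vectors. The maps send reachable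
vectors to reachable vectors, so compression by `J i` loses nothing, and on such vectors the
functionals are determined by the values `φ (g * p)`. -/
lemma normalBal_of_data (hd : 2 ≤ d) {c : ℝ} {H : ℕ → Type w} [∀ i, NormedAddCommGroup (H i)]
    [∀ i, InnerProductSpace ℂ (H i)] [∀ i, CompleteSpace (H i)] (first : G → H 0 →L[ℂ] ℂ)
    (mid : ∀ i, G → H (i + 1) →L[ℂ] H i) (last : G → ℂ →L[ℂ] H (d - 2))
    (h1 : ∀ x, ‖first x‖ ≤ √c) (h2 : ∀ i < d - 2, ∀ x, ‖mid i x‖ ≤ 1) (h3 : ∀ x, ‖last x‖ ≤ √c)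
    (factor : ∀ g : ℕ → G,
      φ ((List.range d).map g).prod = first (g 0) (chain mid g (d - 2) (last (g (d - 1)) 1))) :
    NormalBal.{u, u} d c φ := by
  classical
  have hsmall : ∀ i, Small.{u} {v | ∃ p, Reach mid last i v p} := fun i => small_reach _ i rfl
  choose ι J hJ using fun i => exists_isometry_range_eq.{u} {v | ∃ p, Reach mid last i v p}
  have hproj : ∀ i v p, Reach mid last i v p →
      (J i).toContinuousLinearMap (ContinuousLinearMap.adjoint (J i).toContinuousLinearMap v) =
        v := by
    intro i v p h
    have hv : v ∈ LinearMap.range (J i).toLinearMap := by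
      rw [hJ i]
      exact Submodule.le_topologicalClosure _ (Submodule.subset_span ⟨p, h⟩)
    obtain ⟨z, rfl⟩ := hv
    have := ContinuousLinearMap.ext_iff.1
      (ContinuousLinearMap.norm_map_iff_adjoint_comp_self (J i).toContinuousLinearMap |>.1
        fun x => (J i).norm_map x) z
    exact congrArg (J i) this
  have nJ : ∀ i, ‖(J i).toContinuousLinearMap‖ ≤ 1 := fun i => (J i).norm_toContinuousLinearMap_le
  have nJ' : ∀ i, ‖ContinuousLinearMap.adjoint (J i).toContinuousLinearMap‖ ≤ 1 := fun i => by
    rw [LinearIsometryEquiv.norm_map]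
    exact nJ i
  have hL : ∀ i v p, Reach mid last i v p → ∀ g : G, first g (chain mid (fun _ => 1) i v) =
      φ (g * p) := by
    intro i v p h g
    have := h.first_chain hd factor (fun j => if j = 0 then g else 1)
    rw [if_pos rfl, chain_congr (g' := fun _ => 1) i fun j _ => if_neg (Nat.succ_ne_zero j)] at this
    rw [this, List.range_succ_eq_map]
    congr 2
    have e : ((fun j : ℕ => if j = 0 then g else 1) ∘ Nat.succ) = fun _ => (1 : G) := by
      funext j; simp
    simp [e]
  -- As only the product counts, `L i g` may be defined with first argument `g` and all later ones
  -- 1.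
  refine ⟨fun i => lp (fun _ : ι i => ℂ) 2, inferInstance, inferInstance, inferInstance,
    fun i g => (first g).comp ((chain mid (fun _ => 1) i).comp (J i).toContinuousLinearMap),
    fun i g => (ContinuousLinearMap.adjoint (J i).toContinuousLinearMap).comp
      ((mid i g).comp (J (i + 1)).toContinuousLinearMap),
    fun g => (ContinuousLinearMap.adjoint (J (d - 2)).toContinuousLinearMap).comp (last g),
    fun i hi x => ?_, fun i hi x => ?_, fun x => ?_, fun i hi g h => ?_, fun g h => ?_⟩
  · have hc : ‖chain mid (fun _ => (1 : G)) i‖ ≤ 1 := by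
      have := norm_chain_le mid (fun _ => (1 : G)) i (fun _ => 1) fun j hj => h2 j (by omega) _
      simpa using this
    calc _ ≤ ‖first x‖ * (‖chain mid (fun _ => (1 : G)) i‖ * ‖(J i).toContinuousLinearMap‖) :=
          (ContinuousLinearMap.opNorm_comp_le _ _).trans
            (mul_le_mul_of_nonneg_left (ContinuousLinearMap.opNorm_comp_le _ _) (norm_nonneg _))
      _ ≤ √c * (1 * 1) := by gcongr; exacts [h1 x, nJ i]
      _ = √c := by ring
  · calc _ ≤ ‖ContinuousLinearMap.adjoint (J i).toContinuousLinearMap‖ *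
          (‖mid i x‖ * ‖(J (i + 1)).toContinuousLinearMap‖) :=
          (ContinuousLinearMap.opNorm_comp_le _ _).trans
            (mul_le_mul_of_nonneg_left (ContinuousLinearMap.opNorm_comp_le _ _) (norm_nonneg _))
      _ ≤ 1 * (1 * 1) := by gcongr; exacts [nJ' i, h2 i hi x, nJ (i + 1)]
      _ = 1 := by ring
  · calc _ ≤ ‖ContinuousLinearMap.adjoint (J (d - 2)).toContinuousLinearMap‖ * ‖last x‖ :=
          ContinuousLinearMap.opNorm_comp_le _ _
      _ ≤ 1 * √c := by gcongr; exacts [nJ' _, h3 x]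
      _ = √c := by ring
  · refine ContinuousLinearMap.ext fun z => ?_
    have hz : J (i + 1) z ∈ closure
        (Submodule.span ℂ {v | ∃ p, Reach mid last (i + 1) v p} : Set (H (i + 1))) := by
      have : J (i + 1) z ∈ LinearMap.range (J (i + 1)).toLinearMap := ⟨z, rfl⟩
      rw [hJ] at this
      exact this
    let A : H (i + 1) →L[ℂ] ℂ := (first g).comp ((chain mid (fun _ => 1) i).comp
      ((J i).toContinuousLinearMap.comp
        ((ContinuousLinearMap.adjoint (J i).toContinuousLinearMap).comp (mid i h))))
    let B : H (i + 1) →L[ℂ] ℂ := (first (g * h)).comp (chain mid (fun _ => 1) (i + 1))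
    -- On a reachable vector with product `p` both functionals equal `φ (g * h * p)`.
    have hAB : Set.EqOn A B (Submodule.span ℂ {v | ∃ p, Reach mid last (i + 1) v p} : Set _) := by
      refine LinearMap.eqOn_span (f := A.toLinearMap) (g := B.toLinearMap) ?_
      rintro v ⟨p, hv⟩
      have hv' := Reach.mid (mid := mid) (last := last) i v p h hi hv
      change first g (chain mid (fun _ => 1) i ((J i).toContinuousLinearMap
        (ContinuousLinearMap.adjoint (J i).toContinuousLinearMap (mid i h v)))) =
        first (g * h) (chain mid (fun _ => 1) (i + 1) v)
      rw [hproj i _ _ hv', hL _ _ _ hv', hL _ _ _ hv, mul_assoc]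
    exact hAB.closure A.continuous B.continuous hz
  · have hv := Reach.last (mid := mid) (last := last) h
    change first g (chain mid (fun _ => 1) (d - 2) ((J (d - 2)).toContinuousLinearMap
        (ContinuousLinearMap.adjoint (J (d - 2)).toContinuousLinearMap (last h 1)))) = _
    rw [hproj _ _ _ hv, hL _ _ _ hv]

/-- With `L 0` as first map, the chain telescopes through the relations between the `L i`. -/
lemma NormalBal.bal (hd : 2 ≤ d) {c : ℝ} (h : NormalBal.{u, u} d c φ) : Bal d c φ := by
  obtain ⟨H, i1, i2, i3, L, mid, last, h1, h2, h3, h4, h5⟩ := h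
  have key : ∀ (g : ℕ → G) (n : ℕ), n ≤ d - 2 → (L 0 (g 0)).comp (chain mid g n) =
      L n ((List.range (n + 1)).map g).prod := by
    intro g n
    induction n with
    | zero => intro _; ext; simp [chain]
    | succ n ih =>
      intro hn
      rw [chain, ← ContinuousLinearMap.comp_assoc, ih (by omega), h4 n (by omega),
        ← prod_range_succ]
  refine ⟨⟨H, L 0, mid, last, ⟨_, by rintro _ ⟨x, rfl⟩; exact h1 0 (by omega) x⟩,
    fun i hi => ⟨_, by rintro _ ⟨x, rfl⟩; exact h2 i hi x⟩, ⟨_, by rintro _ ⟨x, rfl⟩; exact h3 x⟩,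
    fun g => ?_⟩, h1 0 (by omega), h2, h3⟩
  rw [← ContinuousLinearMap.comp_apply, key g _ le_rfl, h5]
  obtain ⟨k, rfl⟩ : ∃ k, d = k + 2 := ⟨d - 2, by omega⟩
  rw [prod_range_succ]
  rfl

lemma Bal.normalBal (hd : 2 ≤ d) {c : ℝ} (h : Bal d c φ) : NormalBal.{u, u} d c φ := by
  obtain ⟨F, h1, h2, h3⟩ := h
  exact normalBal_of_data hd F.first F.mid F.last h1 h2 h3 F.factor

end Reduction

end MdMult

/-! ### The operators `U ⊗ 1` on `ℓ²(ι, E)` -/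

namespace MdMult

section Amplification

variable {ι : Type*} {E E' E'' : Type*} [NormedAddCommGroup E] [InnerProductSpace ℂ E]
  [NormedAddCommGroup E'] [InnerProductSpace ℂ E'] [NormedAddCommGroup E'']
  [InnerProductSpace ℂ E'']

lemma memℓp_tens (v : lp (fun _ : ι => ℂ) 2) (h : E) : Memℓp (fun i => v i • h) 2 := by
  refine memℓp_gen ?_
  have := ((memℓp_gen_iff (p := 2) (by norm_num)).1 (lp.memℓp v)).mul_right
    (‖h‖ ^ (2 : ℝ≥0∞).toReal)
  refine this.congr fun i => ?_
  rw [norm_smul, Real.mul_rpow (norm_nonneg _) (norm_nonneg _)]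

/-- The elementary tensor `v ⊗ h`, as an element of `ℓ²(ι, E)`. -/
noncomputable def tens (v : lp (fun _ : ι => ℂ) 2) (h : E) : lp (fun _ : ι => E) 2 :=
  ⟨fun i => v i • h, memℓp_tens v h⟩

@[simp] lemma tens_apply (v : lp (fun _ : ι => ℂ) 2) (h : E) (i : ι) : tens v h i = v i • h := rfl

lemma inner_tens (v v' : lp (fun _ : ι => ℂ) 2) (h h' : E) :
    inner ℂ (tens v h) (tens v' h') = inner ℂ v v' * inner ℂ h h' := by
  refine (lp.hasSum_inner (tens v h) (tens v' h')).unique ?_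
  have := (lp.hasSum_inner v v').mul_right (inner ℂ h h')
  refine this.congr_fun fun i => ?_
  rw [tens_apply, tens_apply, inner_smul_left, inner_smul_right, RCLike.inner_apply]
  ring

lemma norm_tens (v : lp (fun _ : ι => ℂ) 2) (h : E) : ‖tens v h‖ = ‖v‖ * ‖h‖ := by
  have h1 : ‖tens v h‖ ^ 2 = (‖v‖ * ‖h‖) ^ 2 := by
    have := inner_tens v v h h
    simp only [inner_self_eq_norm_sq_to_K] at this
    rw [mul_pow]
    exact_mod_cast this
  exact (sq_eq_sq₀ (norm_nonneg _) (by positivity)).1 h1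

/-- `v ⊗ h` as a continuous linear function of `v`. -/
noncomputable def tensLeft (h : E) : lp (fun _ : ι => ℂ) 2 →L[ℂ] lp (fun _ : ι => E) 2 :=
  LinearMap.mkContinuous
    { toFun := fun v => tens v h
      map_add' := fun v v' => by ext i; exact add_smul _ _ _
      map_smul' := fun a v => by ext i; exact mul_smul _ _ _ } ‖h‖ fun v => by
    rw [mul_comm]; exact (norm_tens v h).le

@[simp] lemma tensLeft_apply (h : E) (v : lp (fun _ : ι => ℂ) 2) : tensLeft h v = tens v h := rfl

/-- `h ↦ v ⊗ h` for a unit vector `v`. -/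
noncomputable def tensRight (v : lp (fun _ : ι => ℂ) 2) (hv : ‖v‖ = 1) :
    E →ₗᵢ[ℂ] lp (fun _ : ι => E) 2 where
  toFun h := tens v h
  map_add' h h' := by ext i; exact smul_add _ _ _
  map_smul' a h := by ext i; exact smul_comm _ _ _
  norm_map' h := by
    change ‖tens v h‖ = _
    rw [norm_tens, hv, one_mul]

lemma lp_ext_single [DecidableEq ι] {F : Type*} [NormedAddCommGroup F] [NormedSpace ℂ F]
    {S T : lp (fun _ : ι => E) 2 →L[ℂ] F}
    (h : ∀ i x, S (lp.single 2 i x) = T (lp.single 2 i x)) : S = T :=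
  lp.ext_continuousLinearMap (by norm_num) fun i => ContinuousLinearMap.ext fun x => h i x

lemma tens_single [DecidableEq ι] (i : ι) (h : E) :
    tens (lp.single 2 i (1 : ℂ)) h = lp.single 2 i h := by
  ext j
  rw [tens_apply, lp.single_apply, lp.single_apply, Pi.single_apply, Pi.single_apply]
  split_ifs <;> simp

/-- The vectors `U δ_i` stay orthonormal, so the copies `U δ_i ⊗ E` are orthogonal; this is how `U ⊗
1` is built as an isometry. -/
lemma orthogonalFamily_tensRight [DecidableEq ι]
    (U : lp (fun _ : ι => ℂ) 2 →ₗᵢ[ℂ] lp (fun _ : ι => ℂ) 2) :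
    OrthogonalFamily ℂ (fun _ : ι => E) fun i => tensRight (E := E) (U (lp.single 2 i 1))
      (by rw [U.norm_map, lp.norm_single (by norm_num), norm_one]) := by
  intro i j hij x y
  change inner ℂ (tens _ x) (tens _ y) = 0
  rw [inner_tens, U.inner_map_map, lp.inner_single_left, lp.single_apply_ne _ _ _ hij,
    inner_zero_right, zero_mul]

variable [CompleteSpace E] [CompleteSpace E'] [CompleteSpace E'']

open Classical in
/-- The operator `U ⊗ 1` on `ℓ²(ι, E)`. -/
noncomputable def amp (E : Type*) [NormedAddCommGroup E] [InnerProductSpace ℂ E] [CompleteSpace E]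
    (U : lp (fun _ : ι => ℂ) 2 →ₗᵢ[ℂ] lp (fun _ : ι => ℂ) 2) :
    lp (fun _ : ι => E) 2 →L[ℂ] lp (fun _ : ι => E) 2 :=
  (orthogonalFamily_tensRight (E := E) U).linearIsometry.toContinuousLinearMap

variable (U U' : lp (fun _ : ι => ℂ) 2 →ₗᵢ[ℂ] lp (fun _ : ι => ℂ) 2)

lemma norm_amp_le : ‖amp E U‖ ≤ 1 := LinearIsometry.norm_toContinuousLinearMap_le _

lemma amp_single [inst : DecidableEq ι] (i : ι) (h : E) :
    amp E U (lp.single 2 i h) = tens (U (lp.single 2 i 1)) h := by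
  obtain rfl : inst = fun a b => Classical.propDecidable (a = b) := Subsingleton.elim _ _
  classical
  exact (orthogonalFamily_tensRight (E := E) U).linearIsometry_apply_single h

lemma amp_tens (v : lp (fun _ : ι => ℂ) 2) (h : E) : amp E U (tens v h) = tens (U v) h := by
  classical
  have : (amp E U).comp (tensLeft h) = (tensLeft h).comp U.toContinuousLinearMap := by
    refine lp_ext_single fun i x => ?_
    have hx : lp.single 2 i x = x • (lp.single 2 i (1 : ℂ) : lp (fun _ : ι => ℂ) 2) := by
      rw [← lp.single_smul, smul_eq_mul, mul_one]
    rw [hx, map_smul, map_smul]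
    congr 1
    simp only [ContinuousLinearMap.comp_apply, tensLeft_apply, tens_single, amp_single]
    rfl
  exact ContinuousLinearMap.ext_iff.1 this v

lemma amp_amp (f : lp (fun _ : ι => E) 2) : amp E U (amp E U' f) = amp E (U.comp U') f := by
  classical
  have : (amp E U).comp (amp E U') = amp E (U.comp U') := by
    refine lp_ext_single fun i x => ?_
    rw [ContinuousLinearMap.comp_apply, amp_single, amp_single, amp_tens]
    rfl
  exact ContinuousLinearMap.ext_iff.1 this f

lemma amp_mapCLM (A : E →L[ℂ] E') {C : ℝ} (hC : 0 ≤ C) (hA : ∀ _ : ι, ‖A‖ ≤ C)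
    (f : lp (fun _ : ι => E) 2) :
    amp E' U (lp.mapCLM 2 (fun _ : ι => A) hC hA f) =
      lp.mapCLM 2 (fun _ : ι => A) hC hA (amp E U f) := by
  classical
  have hs : ∀ (v : lp (fun _ : ι => ℂ) 2) (x : E),
      lp.mapCLM 2 (fun _ : ι => A) hC hA (tens v x) = tens v (A x) := by
    intro v x
    ext i
    exact A.map_smul _ _
  have : (amp E' U).comp (lp.mapCLM 2 (fun _ : ι => A) hC hA) =
      (lp.mapCLM 2 (fun _ : ι => A) hC hA).comp (amp E U) := by
    refine lp_ext_single fun i x => ?_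
    rw [ContinuousLinearMap.comp_apply, ContinuousLinearMap.comp_apply, ← tens_single, hs,
      amp_tens, amp_tens, hs]
  exact ContinuousLinearMap.ext_iff.1 this f

end Amplification

/-! ### Coefficients of representations as multipliers -/

section Coefficient

variable {d : ℕ} {G : Type u} [Group G]

/-- Coefficients of contractive representations are `M_d`-multipliers. -/
lemma bal_coefficient (hd : 2 ≤ d) {K : Type w} [NormedAddCommGroup K] [InnerProductSpace ℂ K]
    [CompleteSpace K] (π : G → K →L[ℂ] K) (hπ : ∀ g h, π (g * h) = (π g).comp (π h))
    (hn : ∀ g, ‖π g‖ ≤ 1) (ζ η : K) {c : ℝ} (hc : 0 < c) (hζη : ‖ζ‖ * ‖η‖ ≤ c) :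
    Bal d c fun g => inner ℂ η (π g ζ) := by
  rcases eq_or_ne η 0 with rfl | hη
  · simp only [inner_zero_left]
    exact bal_zero hc
  have hη0 : 0 < ‖η‖ := norm_pos_iff.2 hη
  have hs : 0 < √c := Real.sqrt_pos.2 hc
  -- The factor `r` brings `η` to norm `√c`; its inverse goes on `ζ`, whose norm becomes at most
  -- `√c` since `‖ζ‖ * ‖η‖ ≤ c`.
  set r : ℂ := ((√c / ‖η‖ : ℝ) : ℂ) with hr
  have hr0 : r ≠ 0 := Complex.ofReal_ne_zero.2 (div_pos hs hη0).ne'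
  have hrn : ‖r‖ = √c / ‖η‖ := by
    rw [hr, Complex.norm_real, Real.norm_of_nonneg (by positivity)]
  have key : ∀ (g : ℕ → G) (n : ℕ) (v : K), π (g 0) (chain (H := fun _ => K) (fun _ x => π x) g n v)
      = π ((List.range (n + 1)).map g).prod v := by
    intro g n
    induction n with
    | zero => intro v; simp [chain]
    | succ n ih =>
      intro v
      rw [chain, ContinuousLinearMap.comp_apply, ih, prod_range_succ g (n + 1), hπ _ (g (n + 1))]
      rfl
  refine (normalBal_of_data (H := fun _ => K) hd (fun g => r • (innerSL ℂ η).comp (π g))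
    (fun _ g => π g) (fun g => (ContinuousLinearMap.toSpanSingleton ℂ (r⁻¹ • π g ζ)))
    (fun x => ?_) (fun _ _ x => hn x) (fun x => ?_) fun g => ?_).bal hd
  · rw [norm_smul, hrn]
    have : ‖(innerSL ℂ η).comp (π x)‖ ≤ ‖η‖ * 1 := by
      refine (ContinuousLinearMap.opNorm_comp_le _ _).trans ?_
      rw [innerSL_apply_norm]
      gcongr
      exact hn x
    calc √c / ‖η‖ * ‖(innerSL ℂ η).comp (π x)‖ ≤ √c / ‖η‖ * (‖η‖ * 1) := by gcongr
      _ = √c := by field_simp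
  · rw [ContinuousLinearMap.norm_toSpanSingleton, norm_smul, norm_inv, hrn]
    have : ‖π x ζ‖ ≤ ‖ζ‖ := by simpa using (π x).le_of_opNorm_le (hn x) ζ
    calc (√c / ‖η‖)⁻¹ * ‖π x ζ‖ ≤ (√c / ‖η‖)⁻¹ * ‖ζ‖ := by gcongr
      _ = (‖ζ‖ * ‖η‖) / √c := by field_simp
      _ ≤ c / √c := by gcongr
      _ = √c := Real.div_sqrt
  · change _ = r • inner ℂ η (π (g 0) (chain (H := fun _ => K) (fun _ x => π x) g (d - 2)
      ((1 : ℂ) • r⁻¹ • π (g (d - 1)) ζ)))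
    rw [one_smul, map_smul, map_smul, inner_smul_right, smul_eq_mul, mul_inv_cancel_left₀ hr0, key]
    obtain ⟨k, rfl⟩ : ∃ k, d = k + 2 := ⟨d - 2, by omega⟩
    rw [prod_range_succ, hπ]
    rfl

variable {ι : Type v} {K : Type w} [NormedAddCommGroup K] [InnerProductSpace ℂ K] [CompleteSpace K]

/-- Products of coefficients of two isometric representations. -/
lemma bal_mul_coefficient (hd : 2 ≤ d)
    (U : G → lp (fun _ : ι => ℂ) 2 →ₗᵢ[ℂ] lp (fun _ : ι => ℂ) 2)
    (hU : ∀ g h, U (g * h) = (U g).comp (U h)) (v w : lp (fun _ : ι => ℂ) 2)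
    (π : G → K →L[ℂ] K) (hπ : ∀ g h, π (g * h) = (π g).comp (π h)) (hn : ∀ g, ‖π g‖ ≤ 1)
    (ζ η : K) {c : ℝ} (hc : 0 < c) (hζη : (‖v‖ * ‖ζ‖) * (‖w‖ * ‖η‖) ≤ c) :
    Bal d c fun g => inner ℂ w (U g v) * inner ℂ η (π g ζ) := by
  -- The product is the coefficient of `U ⊗ π` at the vectors `v ⊗ ζ` and `w ⊗ η`.
  have h := bal_coefficient hd
    (fun g => (amp K (U g)).comp (lp.mapCLM 2 (fun _ : ι => π g) zero_le_one fun _ => hn g))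
    (fun g h => ?_) (fun g => ?_) (tens v ζ) (tens w η) hc (by rwa [norm_tens, norm_tens])
  · have e : ∀ g, (lp.mapCLM 2 (fun _ : ι => π g) zero_le_one fun _ => hn g) (tens v ζ) =
        tens v (π g ζ) := fun g => by
      ext i
      exact (π g).map_smul _ _
    simpa only [ContinuousLinearMap.comp_apply, e, amp_tens, inner_tens] using h
  · refine ContinuousLinearMap.ext fun f => ?_
    simp only [ContinuousLinearMap.comp_apply]
    rw [← amp_mapCLM, amp_amp, hU]
    congr 1
    ext i
    exact ContinuousLinearMap.ext_iff.1 (hπ g h) (f i)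
  · refine (ContinuousLinearMap.opNorm_comp_le _ _).trans ?_
    have := mul_le_mul (norm_amp_le (E := K) (U g))
      (lp.norm_mapCLM_le 2 (fun _ : ι => π g) zero_le_one fun _ => hn g) (norm_nonneg _) zero_le_one
    rwa [one_mul] at this

lemma norm_leftReg_apply (x : G) (f : EllTwo G) : ‖leftReg x f‖ = ‖f‖ := by
  rw [lp.norm_eq_tsum_rpow (by norm_num), lp.norm_eq_tsum_rpow (by norm_num)]
  congr 1
  exact (Equiv.mulLeft x⁻¹).tsum_eq fun y => ‖(f : G → ℂ) y‖ ^ (2 : ℝ≥0∞).toReal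

lemma norm_leftReg_le (x : G) : ‖leftReg x‖ ≤ 1 :=
  ContinuousLinearMap.opNorm_le_bound _ zero_le_one fun f => by
    rw [one_mul]; exact (norm_leftReg_apply x f).le

lemma leftReg_mul (x y : G) : leftReg (x * y) = (leftReg x).comp (leftReg y) := by
  refine ContinuousLinearMap.ext fun f => ?_
  ext z
  change (f : G → ℂ) _ = (f : G → ℂ) _
  rw [mul_inv_rev, mul_assoc]

lemma exists_finite_support_norm_sub_lt {κ : Type*} (f : lp (fun _ : κ => ℂ) 2) {ε : ℝ}
    (hε : 0 < ε) : ∃ f' : lp (fun _ : κ => ℂ) 2, (Function.support f').Finite ∧ ‖f - f'‖ < ε := by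
  classical
  have h := lp.hasSum_single (p := 2) (by norm_num) f
  obtain ⟨s, hs⟩ := (Metric.tendsto_nhds.1 h ε hε).exists
  refine ⟨∑ i ∈ s, lp.single 2 i (f i), s.finite_toSet.subset fun j hj => ?_, ?_⟩
  · by_contra hjs
    refine hj ?_
    rw [lp.coeFn_sum, Finset.sum_apply]
    refine Finset.sum_eq_zero fun i hi => lp.single_apply_ne _ _ _ ?_
    rintro rfl
    exact hjs hi
  · rwa [dist_comm, dist_eq_norm] at hs

/-- Coefficients of the left regular representation, multiplied by coefficients of isometric
representations, are limits of finitely supported functions. -/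
lemma finApprox_mul_leftReg (hd : 2 ≤ d)
    (U : G → lp (fun _ : ι => ℂ) 2 →ₗᵢ[ℂ] lp (fun _ : ι => ℂ) 2)
    (hU : ∀ g h, U (g * h) = (U g).comp (U h)) (v w : lp (fun _ : ι => ℂ) 2) (ζ η : EllTwo G) :
    FinApprox d fun g => inner ℂ w (U g v) * inner ℂ η (leftReg g ζ) := by
  intro ε hε
  -- These are the errors of truncating `ζ` first and `η` second; the truncated `ζ'` has norm at
  -- most `‖ζ‖ + δ`.
  obtain ⟨δ, hδ, hδε⟩ : ∃ δ > 0, (‖v‖ * δ) * (‖w‖ * ‖η‖) ≤ ε / 2 ∧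
      (‖v‖ * (‖ζ‖ + δ)) * (‖w‖ * δ) ≤ ε / 2 := by
    have h1 : Tendsto (fun δ : ℝ => (‖v‖ * δ) * (‖w‖ * ‖η‖)) (𝓝[>] 0) (𝓝 0) := by
      have : Continuous fun δ : ℝ => (‖v‖ * δ) * (‖w‖ * ‖η‖) := by fun_prop
      simpa using (this.tendsto 0).mono_left (nhdsWithin_le_nhds (s := Set.Ioi 0))
    have h2 : Tendsto (fun δ : ℝ => (‖v‖ * (‖ζ‖ + δ)) * (‖w‖ * δ)) (𝓝[>] 0) (𝓝 0) := by
      have : Continuous fun δ : ℝ => (‖v‖ * (‖ζ‖ + δ)) * (‖w‖ * δ) := by fun_prop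
      simpa using (this.tendsto 0).mono_left (nhdsWithin_le_nhds (s := Set.Ioi 0))
    obtain ⟨δ, hδ, hδ'⟩ := (((h1.eventually_le_const (half_pos hε)).and
      (h2.eventually_le_const (half_pos hε))).and self_mem_nhdsWithin).exists
    exact ⟨δ, hδ', hδ⟩
  obtain ⟨ζ', hζ', hζ⟩ := exists_finite_support_norm_sub_lt ζ hδ
  obtain ⟨η', hη', hη⟩ := exists_finite_support_norm_sub_lt η hδ
  refine ⟨fun g => inner ℂ w (U g v) * inner ℂ η' (leftReg g ζ'), ?_, ?_⟩
  -- If `⟨η', λ(g) ζ'⟩ ≠ 0`, then `g` translates some point of the support of `ζ'` into that of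
  -- `η'`.
  · refine (Set.Finite.image2 (fun x y => x * y⁻¹) hη' hζ').subset fun g hg => ?_
    by_contra hcon
    refine hg ?_
    have : inner ℂ η' (leftReg g ζ') = 0 := by
      rw [lp.inner_eq_tsum]
      refine (tsum_congr fun x => ?_).trans tsum_zero
      rw [leftReg_apply]
      by_cases hx : (η' : G → ℂ) x = 0
      · rw [hx, inner_zero_left]
      · by_cases hy : (ζ' : G → ℂ) (g⁻¹ * x) = 0
        · rw [hy, inner_zero_right]
        · exact absurd ⟨x, hx, g⁻¹ * x, hy, by group⟩ hcon
    change _ * inner ℂ η' (leftReg g ζ') = 0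
    rw [this, mul_zero]
  · have hζn : ‖ζ'‖ ≤ ‖ζ‖ + δ := by
      have := norm_le_norm_add_norm_sub' ζ' ζ
      rw [norm_sub_rev] at this
      linarith
    have b1 := bal_mul_coefficient hd U hU v w leftReg leftReg_mul norm_leftReg_le (ζ - ζ') η
      (half_pos hε) (le_trans (by gcongr) hδε.1)
    have b2 := bal_mul_coefficient hd U hU v w leftReg leftReg_mul norm_leftReg_le ζ' (η - η')
      (half_pos hε) (le_trans (by gcongr) hδε.2)
    have b := b1.add (half_pos hε).le (half_pos hε).le b2
    rw [add_halves] at b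
    refine (congrArg (Bal d ε) ?_).mp b
    funext g
    simp only [Pi.add_apply, Pi.sub_apply, map_sub, inner_sub_left, inner_sub_right]
    ring

lemma MemFourier.finApprox (hd : 2 ≤ d) {φ : G → ℂ} (hφ : MemFourier φ) : FinApprox d φ := by
  classical
  obtain ⟨ζ, η, h⟩ := hφ
  -- The other factor is taken to be the trivial representation on the line `ℓ²(Unit)`.
  have e : φ = fun g => inner ℂ (lp.single 2 () 1 : lp (fun _ : Unit => ℂ) 2)
      (LinearIsometry.id (R := ℂ) (lp.single 2 () 1 : lp (fun _ : Unit => ℂ) 2)) *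
      inner ℂ η (leftReg g ζ) := by
    funext g
    rw [LinearIsometry.id_apply, lp.inner_single_left, h]
    simp
  rw [e]
  exact finApprox_mul_leftReg hd (fun _ => LinearIsometry.id) (fun _ _ => rfl) _ _ ζ η

end Coefficient

end MdMult

/-! ### Intertwiners for an isomorphism of von Neumann algebras -/

section Operators

open scoped ComplexOrder

variable {H : Type*} [NormedAddCommGroup H] [InnerProductSpace ℂ H] [CompleteSpace H]
  {K : Type*} [NormedAddCommGroup K] [InnerProductSpace ℂ K] [CompleteSpace K]

/-- Weak operator compactness of balls, for ultrafilters. -/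
lemma ContinuousLinearMap.exists_tendsto_inner {κ : Type*} (l : Ultrafilter κ) (x : κ → H →L[ℂ] H)
    {C : ℝ} (hC : ∀ i, ‖x i‖ ≤ C) :
    ∃ X : H →L[ℂ] H, ∀ u v, Tendsto (fun i => inner ℂ (x i u) v) l (𝓝 (inner ℂ (X u) v)) := by
  have hb : ∀ u v i, ‖inner ℂ (x i u) v‖ ≤ C * ‖u‖ * ‖v‖ := fun u v i =>
    (norm_inner_le_norm _ _).trans
      (mul_le_mul_of_nonneg_right ((x i).le_of_opNorm_le (hC i) u) (norm_nonneg _))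
  have h : ∀ u v, ∃ z : ℂ, ‖z‖ ≤ C * ‖u‖ * ‖v‖ ∧
      Tendsto (fun i => inner ℂ (x i u) v) l (𝓝 z) := by
    intro u v
    obtain ⟨z, hz, hz'⟩ := (isCompact_closedBall (0 : ℂ) (C * ‖u‖ * ‖v‖)).ultrafilter_le_nhds'
      (l.map fun i => inner ℂ (x i u) v) (Filter.univ_mem' (f := (l : Filter κ)) fun i => by
        simpa using hb u v i)
    exact ⟨z, by simpa using hz, hz'⟩
  choose B hB1 hB2 using h
  let B' : H →L⋆[ℂ] H →L[ℂ] ℂ := LinearMap.mkContinuous₂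
    (LinearMap.mk₂'ₛₗ (starRingEnd ℂ) (RingHom.id ℂ) B
      (fun a b c => tendsto_nhds_unique (hB2 _ _)
        (((hB2 a c).add (hB2 b c)).congr fun i => by rw [map_add, inner_add_left]))
      (fun a b c => tendsto_nhds_unique (hB2 _ _)
        (((hB2 b c).const_mul _).congr fun i => by rw [map_smul, inner_smul_left]))
      (fun a b c => tendsto_nhds_unique (hB2 _ _)
        (((hB2 a b).add (hB2 a c)).congr fun i => by rw [inner_add_right]))
      (fun a b c => tendsto_nhds_unique (hB2 _ _)
        (((hB2 b c).const_mul _).congr fun i => by rw [inner_smul_right]; rfl))) C hB1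
  refine ⟨InnerProductSpace.continuousLinearMapOfBilin B', fun u v => ?_⟩
  rw [InnerProductSpace.continuousLinearMapOfBilin_apply]
  exact hB2 u v

/-- If `‖g a‖ ≤ ‖f a‖` for all `a`, then `g` factors through `f`. -/
lemma LinearMap.exists_factor_of_norm_le {A : Type*} [AddCommGroup A] [Module ℂ A]
    (f : A →ₗ[ℂ] H) (g : A →ₗ[ℂ] K) (h : ∀ a, ‖g a‖ ≤ ‖f a‖) :
    ∃ S : H →L[ℂ] K, (∀ a, S (f a) = g a) ∧ ∀ v ∈ (LinearMap.range f)ᗮ, S v = 0 := by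
  set W := (LinearMap.range f).topologicalClosure with hW
  have hWc : CompleteSpace W := (Submodule.isClosed_topologicalClosure _).completeSpace_coe
  let e : A →ₗ[ℂ] W := f.codRestrict W fun a =>
    Submodule.le_topologicalClosure _ (LinearMap.mem_range_self f a)
  have he : DenseRange e := by
    intro w
    rw [Topology.IsInducing.subtypeVal.closure_eq_preimage_closure_image]
    have : Subtype.val '' Set.range e = (LinearMap.range f : Set H) := by
      rw [← Set.range_comp]; rfl
    have hw : (w : H) ∈ closure (LinearMap.range f : Set H) := w.2
    rw [← this] at hw
    exact hw
  refine ⟨(g.extendOfNorm e).comp W.orthogonalProjectionOnto, fun a => ?_, fun v hv => ?_⟩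
  · have : W.orthogonalProjectionOnto (f a) = e a :=
      Subtype.ext (Submodule.starProjection_eq_self_iff.2 (e a).2)
    rw [ContinuousLinearMap.comp_apply, this]
    exact LinearMap.extendOfNorm_eq he ⟨1, fun a => by rw [one_mul]; exact h a⟩ a
  · have : W.orthogonalProjectionOnto v = 0 := by
      rw [Submodule.orthogonalProjectionOnto_eq_zero_iff, hW, Submodule.orthogonal_closure]
      exact hv
    rw [ContinuousLinearMap.comp_apply, this, map_zero]

namespace VonNeumannAlgebra

variable (M : VonNeumannAlgebra H) (N : VonNeumannAlgebra K)

lemma mem_of_commutant {x : H →L[ℂ] H} (h : ∀ y ∈ M.commutant, y * x = x * y) : x ∈ M := by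
  rw [← M.commutant_commutant, mem_commutant_iff]
  exact h

lemma mul_comm_of_mem {x y : H →L[ℂ] H} (hx : x ∈ M) (hy : y ∈ M.commutant) : x * y = y * x :=
  mem_commutant_iff.1 hy x hx

/-- The functional calculus of `x` commutes with everything that commutes with `x`. -/
lemma sqrt_mem {x : H →L[ℂ] H} (hx : x ∈ M) : CFC.sqrt x ∈ M := by
  refine M.mem_of_commutant fun y hy => ?_
  exact (Commute.cfcₙ_nnreal (show Commute x y from M.mul_comm_of_mem hx hy) _).symm.eq

variable {M N}

/-- The square root of `x` lies in `M`, so `x` is `star b * b` within `M`. -/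
lemma isPositive_map (θ : M.toStarSubalgebra ≃⋆ₐ[ℂ] N.toStarSubalgebra) (x : M.toStarSubalgebra)
    (hx : 0 ≤ (x : H →L[ℂ] H)) : 0 ≤ (θ x : K →L[ℂ] K) := by
  let b : M.toStarSubalgebra := ⟨CFC.sqrt x, M.sqrt_mem x.2⟩
  have hb : x = star b * b := by
    refine Subtype.ext ?_
    change (x : H →L[ℂ] H) = star (CFC.sqrt (x : H →L[ℂ] H)) * CFC.sqrt (x : H →L[ℂ] H)
    rw [(CFC.sqrt_nonneg (x : H →L[ℂ] H)).isSelfAdjoint.star_eq, CFC.sqrt_mul_sqrt_self _ hx]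
  rw [hb, map_mul, map_star]
  exact star_mul_self_nonneg (θ b : K →L[ℂ] K)

variable (θ : M.toStarSubalgebra ≃⋆ₐ[ℂ] N.toStarSubalgebra)

lemma re_inner_map_mono {x y : M.toStarSubalgebra} (h : (x : H →L[ℂ] H) ≤ y) (ζ : K) :
    (inner ℂ ((θ x : K →L[ℂ] K) ζ) ζ).re ≤ (inner ℂ ((θ y : K →L[ℂ] K) ζ) ζ).re := by
  have h0 : 0 ≤ ((y - x : M.toStarSubalgebra) : H →L[ℂ] H) := sub_nonneg.2 h
  have := isPositive_map θ (y - x) h0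
  rw [ContinuousLinearMap.nonneg_iff_isPositive] at this
  have h1 := (Complex.le_def.1 (this.inner_nonneg_left ζ)).1
  have h2 : (θ (y - x) : K →L[ℂ] K) ζ = (θ y : K →L[ℂ] K) ζ - (θ x : K →L[ℂ] K) ζ := by
    rw [map_sub]; rfl
  rw [h2, inner_sub_left, Complex.sub_re] at h1
  simpa using h1

/-- If a vector functional `φ` of `M` exceeds a functional `ψ = ⟨θ (·) ζ, ζ⟩` at the projection
`z`, then `ψ ≤ φ` on some nontrivial order interval `[0, h]` with `h ≤ z`. -/
lemma exists_dominated (z : M.toStarSubalgebra) (hz : 0 ≤ (z : H →L[ℂ] H)) (η : H) (ζ : K)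
    (hlt : (inner ℂ ((θ z : K →L[ℂ] K) ζ) ζ).re < (inner ℂ ((z : H →L[ℂ] H) η) η).re) :
    ∃ h : M.toStarSubalgebra, h ≠ 0 ∧ 0 ≤ (h : H →L[ℂ] H) ∧ (h : H →L[ℂ] H) ≤ z ∧
      ∀ y : M.toStarSubalgebra, 0 ≤ (y : H →L[ℂ] H) → (y : H →L[ℂ] H) ≤ h →
        (inner ℂ ((θ y : K →L[ℂ] K) ζ) ζ).re ≤ (inner ℂ ((y : H →L[ℂ] H) η) η).re := by
  let φ : M.toStarSubalgebra → ℝ := fun x => (inner ℂ ((x : H →L[ℂ] H) η) η).re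
  let ψ : M.toStarSubalgebra → ℝ := fun x => (inner ℂ ((θ x : K →L[ℂ] K) ζ) ζ).re
  have hφ : ∀ x y, φ (x - y) = φ x - φ y := fun x y => by
    change (inner ℂ ((x : H →L[ℂ] H) η - (y : H →L[ℂ] H) η) η).re = _
    rw [inner_sub_left, Complex.sub_re]
  have hψ : ∀ x y, ψ (x - y) = ψ x - ψ y := fun x y => by
    change (inner ℂ ((θ (x - y) : K →L[ℂ] K) ζ) ζ).re = _
    rw [map_sub]
    change (inner ℂ ((θ x : K →L[ℂ] K) ζ - (θ y : K →L[ℂ] K) ζ) ζ).re = _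
    rw [inner_sub_left, Complex.sub_re]
  -- Zorn's lemma gives a maximal element below `z` at which `ψ` is at least `φ`; its difference
  -- from `z` is the required `h`.
  let A : Set (H →L[ℂ] H) :=
    {x | ∃ hx : x ∈ M.toStarSubalgebra, 0 ≤ x ∧ x ≤ z ∧ φ ⟨x, hx⟩ ≤ ψ ⟨x, hx⟩}
  have h0 : (0 : H →L[ℂ] H) ∈ A := by
    refine ⟨zero_mem _, le_rfl, hz, le_of_eq ?_⟩
    have e1 := hφ z z
    have e2 := hψ z z
    rw [sub_self, sub_self] at e1 e2
    exact e1.trans e2.symm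
  obtain ⟨x, -, hx⟩ := zorn_le_nonempty₀ A (fun c hcA hc y hy => by
    have : IsDirectedOrder c := hc.directedOn.isDirectedOrder
    have : Nonempty c := ⟨⟨y, hy⟩⟩
    -- The upper bound of a chain is its weak operator limit along an ultrafilter finer than the
    -- order filter.
    let l : Ultrafilter c := Ultrafilter.of atTop
    have hl : ∀ i : c, ∀ᶠ j in (l : Filter c), i ≤ j := fun i =>
      Ultrafilter.of_le atTop (eventually_ge_atTop i)
    have hbd : ∀ i : c, ‖(i : H →L[ℂ] H)‖ ≤ ‖(z : H →L[ℂ] H)‖ := fun i => by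
      obtain ⟨_, h1, h2, _⟩ := hcA i.2
      exact CStarAlgebra.norm_le_norm_of_nonneg_of_le h1 h2
    obtain ⟨X, hX⟩ := ContinuousLinearMap.exists_tendsto_inner l (fun i : c => (i : H →L[ℂ] H)) hbd
    have hlow : ∀ B : H →L[ℂ] H, (∀ᶠ j : c in (l : Filter c), B ≤ (j : H →L[ℂ] H)) → B ≤ X := by
      intro B hB
      rw [ContinuousLinearMap.le_def, ContinuousLinearMap.isPositive_iff_complex]
      intro v
      have ht : Tendsto (fun i : c => inner ℂ (((i : H →L[ℂ] H) - B) v) v) l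
          (𝓝 (inner ℂ ((X - B) v) v)) := by
        simp only [_root_.sub_apply, inner_sub_left]
        exact (hX v v).sub_const _
      have hnn : 0 ≤ inner ℂ ((X - B) v) v := by
        refine ge_of_tendsto ht (hB.mono fun i hi => ?_)
        exact ContinuousLinearMap.IsPositive.inner_nonneg_left
          ((ContinuousLinearMap.le_def _ _).1 hi) v
      rw [Complex.le_def] at hnn
      exact ⟨Complex.ext rfl hnn.2, hnn.1⟩
    have hup : X ≤ z := by
      rw [ContinuousLinearMap.le_def, ContinuousLinearMap.isPositive_iff_complex]
      intro v
      have ht : Tendsto (fun i : c => inner ℂ (((z : H →L[ℂ] H) - i) v) v) l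
          (𝓝 (inner ℂ (((z : H →L[ℂ] H) - X) v) v)) := by
        simp only [_root_.sub_apply, inner_sub_left]
        exact (hX v v).const_sub _
      have hnn : 0 ≤ inner ℂ (((z : H →L[ℂ] H) - X) v) v := by
        refine ge_of_tendsto ht (Eventually.of_forall fun i => ?_)
        exact ContinuousLinearMap.IsPositive.inner_nonneg_left
          ((ContinuousLinearMap.le_def _ _).1 (hcA i.2).2.2.1) v
      rw [Complex.le_def] at hnn
      exact ⟨Complex.ext rfl hnn.2, hnn.1⟩
    have hXM : X ∈ M := by
      refine M.mem_of_commutant fun y hy => ?_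
      refine ContinuousLinearMap.ext fun u => ext_inner_right ℂ fun v => ?_
      refine tendsto_nhds_unique (f := fun i : c => inner ℂ (y ((i : H →L[ℂ] H) u)) v)
        (l := (l : Filter c)) ?_ ?_
      · have e : ∀ w, inner ℂ (y w) v = inner ℂ w (ContinuousLinearMap.adjoint y v) := fun w =>
          (ContinuousLinearMap.adjoint_inner_right y w v).symm
        change Tendsto _ _ (𝓝 (inner ℂ (y (X u)) v))
        simp only [e]
        exact hX u _
      · refine (hX (y u) v).congr fun i => ?_
        have := M.mul_comm_of_mem (hcA i.2).1 hy
        exact congrArg (fun T : H →L[ℂ] H => inner ℂ (T u) v) this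
    have hle : ∀ i ∈ c, i ≤ X := fun i hi => hlow i (hl ⟨i, hi⟩)
    refine ⟨X, ⟨hXM, (hcA hy).2.1.trans (hle y hy), hup, ?_⟩, hle⟩
    -- The vector functional `φ` is weakly continuous, while for `ψ` monotonicity suffices. Thus
    -- normality of `θ` is not needed.
    have ht : Tendsto (fun i : c => (inner ℂ ((i : H →L[ℂ] H) η) η).re) l (𝓝 (φ ⟨X, hXM⟩)) :=
      (Complex.continuous_re.tendsto _).comp (hX η η)
    refine le_of_tendsto ht (Eventually.of_forall fun i => ?_)
    obtain ⟨hi, _, _, h3⟩ := hcA i.2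
    exact h3.trans (re_inner_map_mono θ (x := ⟨i, hi⟩) (y := ⟨X, hXM⟩) (hle i i.2) ζ)) 0 h0
  obtain ⟨⟨hxM, hx0, hxz, hxφ⟩, hmax⟩ := hx
  let x' : M.toStarSubalgebra := ⟨x, hxM⟩
  refine ⟨z - x', ?_, sub_nonneg.2 hxz, sub_le_self _ hx0, fun y hy0 hyh => ?_⟩
  · intro h
    have hzx : z = x' := sub_eq_zero.1 h
    have : φ z ≤ ψ z := by rw [hzx]; exact hxφ
    exact absurd hlt (not_lt.2 this)
  · by_contra hcon
    have hlt' : φ y < ψ y := not_le.1 hcon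
    have hφa : φ (x' + y) = φ x' + φ y := by
      have := hφ (x' + y) y; rw [add_sub_cancel_right] at this; linarith
    have hψa : ψ (x' + y) = ψ x' + ψ y := by
      have := hψ (x' + y) y; rw [add_sub_cancel_right] at this; linarith
    -- A violating `y` could be added to `x`; by maximality it vanishes, and then it violates
    -- nothing.
    have hmem : x + (y : H →L[ℂ] H) ∈ A := by
      refine ⟨(x' + y).2, add_nonneg hx0 hy0, ?_, ?_⟩
      · have : (y : H →L[ℂ] H) ≤ z - x := hyh
        rw [add_comm]
        exact le_sub_iff_add_le.1 this
      · change φ (x' + y) ≤ ψ (x' + y)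
        rw [hφa, hψa]
        have : φ x' ≤ ψ x' := hxφ
        linarith
    have hle : x ≤ x + y := le_add_of_nonneg_right hy0
    have hle' : x + (y : H →L[ℂ] H) ≤ x := hmax hmem hle
    have hy : (y : H →L[ℂ] H) = 0 := le_antisymm (by simpa using hle') hy0
    have hy' : y = x' - x' := by rw [sub_self]; exact Subtype.ext hy
    rw [hy', hφ, hψ, sub_self, sub_self] at hlt'
    exact lt_irrefl _ hlt'

/-- The bounded operators which intertwine the identity representation of `M` with `θ`. -/
def IsIntertwiner (S : H →L[ℂ] K) : Prop :=
  ∀ x : M.toStarSubalgebra, S.comp (x : H →L[ℂ] H) = (θ x : K →L[ℂ] K).comp S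

/-- The map `x η ↦ θ(x) ζ` is well defined and contractive. It is extended by 0 to the orthogonal
complement of `M η`, which is invariant because `M` is closed under adjoints. -/
lemma exists_isIntertwiner (η : H) (ζ : K) (h : ∀ x : M.toStarSubalgebra,
    ‖(θ x : K →L[ℂ] K) ζ‖ ≤ ‖(x : H →L[ℂ] H) η‖) :
    ∃ S : H →L[ℂ] K, IsIntertwiner θ S ∧ S η = ζ := by
  let f : M.toStarSubalgebra →ₗ[ℂ] H :=
    { toFun := fun x => (x : H →L[ℂ] H) η
      map_add' := fun _ _ => rfl
      map_smul' := fun _ _ => rfl }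
  let g : M.toStarSubalgebra →ₗ[ℂ] K :=
    { toFun := fun x => (θ x : K →L[ℂ] K) ζ
      map_add' := fun x y => by rw [map_add]; rfl
      map_smul' := fun a x => by rw [map_smul]; rfl }
  obtain ⟨S, hS, hS0⟩ := LinearMap.exists_factor_of_norm_le f g h
  refine ⟨S, fun x => ?_, ?_⟩
  · have hc : CompleteSpace (LinearMap.range f).topologicalClosure :=
      (Submodule.isClosed_topologicalClosure _).completeSpace_coe
    have h1 : ∀ v ∈ (LinearMap.range f).topologicalClosure,
        S ((x : H →L[ℂ] H) v) = (θ x : K →L[ℂ] K) (S v) := by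
      intro v hv
      have hE : Set.EqOn (S.comp (x : H →L[ℂ] H)) ((θ x : K →L[ℂ] K).comp S)
          (LinearMap.range f) := by
        rintro _ ⟨y, rfl⟩
        change S (f (x * y)) = (θ x : K →L[ℂ] K) (S (f y))
        rw [hS, hS]
        change (θ (x * y) : K →L[ℂ] K) ζ = _
        rw [map_mul]
        rfl
      exact hE.closure (ContinuousLinearMap.continuous _) (ContinuousLinearMap.continuous _) hv
    refine ContinuousLinearMap.ext fun v => ?_
    obtain ⟨v1, hv1, v2, hv2, rfl⟩ :=
      (LinearMap.range f).topologicalClosure.exists_add_mem_mem_orthogonal v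
    rw [Submodule.orthogonal_closure] at hv2
    have hx2 : (x : H →L[ℂ] H) v2 ∈ (LinearMap.range f)ᗮ := by
      rw [Submodule.mem_orthogonal] at hv2 ⊢
      rintro _ ⟨y, rfl⟩
      rw [← ContinuousLinearMap.adjoint_inner_left]
      exact hv2 _ ⟨star x * y, rfl⟩
    simp only [ContinuousLinearMap.comp_apply, map_add]
    rw [h1 v1 hv1, hS0 v2 hv2, hS0 _ hx2, map_zero]
  · have := hS 1
    change S η = (θ 1 : K →L[ℂ] K) ζ at this
    rw [this, map_one]
    rfl

lemma re_inner_star_mul_self (x : M.toStarSubalgebra) (v : H) :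
    (inner ℂ (((star x * x : M.toStarSubalgebra) : H →L[ℂ] H) v) v).re =
      ‖(x : H →L[ℂ] H) v‖ ^ 2 := by
  change (inner ℂ (ContinuousLinearMap.adjoint (x : H →L[ℂ] H) ((x : H →L[ℂ] H) v)) v).re = _
  rw [ContinuousLinearMap.adjoint_inner_left, inner_self_eq_norm_sq_to_K]
  norm_cast

/-- For a contraction `x`, the element `a x* x a` lies in `[0, h]`, so domination reads `‖θ(x a) ζ‖
≤ ‖x a η‖`; homogeneity extends this to all `x`. -/
lemma exists_isIntertwiner_of_dominated (h a : M.toStarSubalgebra) (ha0 : 0 ≤ (a : H →L[ℂ] H))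
    (haa : a * a = h) (η : H) (ζ : K)
    (hdom : ∀ y : M.toStarSubalgebra, 0 ≤ (y : H →L[ℂ] H) → (y : H →L[ℂ] H) ≤ h →
      (inner ℂ ((θ y : K →L[ℂ] K) ζ) ζ).re ≤ (inner ℂ ((y : H →L[ℂ] H) η) η).re) :
    ∃ S, IsIntertwiner θ S ∧ S ((a : H →L[ℂ] H) η) = (θ a : K →L[ℂ] K) ζ := by
  refine exists_isIntertwiner θ _ _ ?_
  intro x
  -- The summand 1 keeps `r` positive also for `x = 0`.
  set r : ℝ := (‖(x : H →L[ℂ] H)‖ + 1)⁻¹ with hr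
  have hr0 : 0 < r := by positivity
  set x' : M.toStarSubalgebra := (r : ℂ) • x with hx'
  have hx1 : ‖(x' : H →L[ℂ] H)‖ ≤ 1 := by
    change ‖(r : ℂ) • (x : H →L[ℂ] H)‖ ≤ 1
    rw [norm_smul, Complex.norm_real, Real.norm_of_nonneg hr0.le, hr,
      inv_mul_le_iff₀ (by positivity)]
    linarith
  have hy0 : 0 ≤ ((star (x' * a) * (x' * a) : M.toStarSubalgebra) : H →L[ℂ] H) :=
    star_mul_self_nonneg ((x' * a : M.toStarSubalgebra) : H →L[ℂ] H)
  have hyh : ((star (x' * a) * (x' * a) : M.toStarSubalgebra) : H →L[ℂ] H) ≤ h := by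
    have h1 : star (x' : H →L[ℂ] H) * x' ≤ 1 := by
      refine (CStarAlgebra.star_mul_le_algebraMap_norm_sq (a := (x' : H →L[ℂ] H))).trans ?_
      rw [← map_one (algebraMap ℝ (H →L[ℂ] H))]
      exact algebraMap_mono _ (pow_le_one₀ (norm_nonneg _) hx1)
    have h2 := star_left_conjugate_le_conjugate h1 (a : H →L[ℂ] H)
    have e1 : ((star (x' * a) * (x' * a) : M.toStarSubalgebra) : H →L[ℂ] H) =
        star (a : H →L[ℂ] H) * (star (x' : H →L[ℂ] H) * x') * a := by
      change star ((x' : H →L[ℂ] H) * a) * ((x' : H →L[ℂ] H) * a) = _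
      rw [star_mul]
      simp only [mul_assoc]
    have e2 : star (a : H →L[ℂ] H) * 1 * a = h := by
      rw [mul_one, ha0.isSelfAdjoint.star_eq]
      exact congrArg Subtype.val haa
    rw [e1, ← e2]
    exact h2
  have hd := hdom _ hy0 hyh
  rw [re_inner_star_mul_self, map_mul, map_star, re_inner_star_mul_self] at hd
  have hd' := (sq_le_sq₀ (norm_nonneg _) (norm_nonneg _)).1 hd
  have e3 : (θ (x' * a) : K →L[ℂ] K) ζ = (r : ℂ) • (θ x : K →L[ℂ] K) ((θ a : K →L[ℂ] K) ζ) := by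
    rw [hx', smul_mul_assoc, map_smul, map_mul]
    rfl
  have e4 : ((x' * a : M.toStarSubalgebra) : H →L[ℂ] H) η =
      (r : ℂ) • (x : H →L[ℂ] H) ((a : H →L[ℂ] H) η) := rfl
  rw [e3, e4, norm_smul, norm_smul] at hd'
  exact le_of_mul_le_mul_left hd' (by
    rw [Complex.norm_real, Real.norm_of_nonneg hr0.le]; exact hr0)

/-- For `w` in the range of `1 - z` one has `‖a w‖² = ⟨h w, w⟩ ≤ ⟨z w, w⟩ = 0`. -/
lemma mul_one_sub_eq_zero_of_le {h a z : M.toStarSubalgebra} (ha0 : 0 ≤ (a : H →L[ℂ] H))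
    (haa : a * a = h) (hzs : IsStarProjection z) (hhz : (h : H →L[ℂ] H) ≤ z) :
    a * (1 - z) = 0 := by
  have has : star a = a := Subtype.ext ha0.isSelfAdjoint.star_eq
  refine Subtype.ext (ContinuousLinearMap.ext fun v => ?_)
  set w : H := ((1 - z : M.toStarSubalgebra) : H →L[ℂ] H) v with hw
  have hzw : (z : H →L[ℂ] H) w = 0 := by
    have : z * (1 - z) = 0 := by rw [mul_sub, mul_one, hzs.isIdempotentElem, sub_self]
    exact congrArg (fun T : M.toStarSubalgebra => (T : H →L[ℂ] H) v) this
  have h1 : (inner ℂ ((h : H →L[ℂ] H) w) w).re = ‖(a : H →L[ℂ] H) w‖ ^ 2 := by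
    rw [← re_inner_star_mul_self a w, has, haa]
  have h2 := (Complex.le_def.1
    (ContinuousLinearMap.IsPositive.inner_nonneg_left ((ContinuousLinearMap.le_def _ _).1 hhz) w)).1
  rw [_root_.sub_apply, inner_sub_left, hzw, inner_zero_left, zero_sub,
    Complex.neg_re, h1] at h2
  have h3 : ‖(a : H →L[ℂ] H) w‖ = 0 := by
    have : ‖(a : H →L[ℂ] H) w‖ ^ 2 ≤ 0 := by simpa using h2
    nlinarith [norm_nonneg ((a : H →L[ℂ] H) w)]
  exact norm_eq_zero.1 h3

/-- A separating vector of `N` lies in the closed span of the ranges of the intertwiners. -/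
theorem mem_closure_span_intertwiners (Ω : K) (hΩ : ∀ y ∈ N, y Ω = 0 → y = 0) :
    Ω ∈ closure (Submodule.span ℂ {ζ : K | ∃ S, IsIntertwiner θ S ∧ ∃ η, S η = ζ} : Set K) := by
  set R : Set K := {ζ : K | ∃ S, IsIntertwiner θ S ∧ ∃ η, S η = ζ} with hR
  set W := (Submodule.span ℂ R).topologicalClosure with hW
  have hWc : CompleteSpace W := (Submodule.isClosed_topologicalClosure _).completeSpace_coe
  have hinv : ∀ y : K →L[ℂ] K, (∀ ζ ∈ R, y ζ ∈ R) → ∀ v ∈ W, y v ∈ W := by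
    intro y hy v hv
    refine map_mem_closure y.continuous hv fun u hu => ?_
    have : Submodule.span ℂ R ≤ (Submodule.span ℂ R).comap y.toLinearMap :=
      Submodule.span_le.2 fun ζ hζ => Submodule.subset_span (hy ζ hζ)
    exact this hu
  have hinvN : ∀ x : M.toStarSubalgebra, ∀ v ∈ W, (θ x : K →L[ℂ] K) v ∈ W := fun x =>
    hinv _ fun ζ => by
      rintro ⟨S, hS, η, rfl⟩
      exact ⟨S, hS, (x : H →L[ℂ] H) η, ContinuousLinearMap.ext_iff.1 (hS x) η⟩
  -- An intertwiner followed by an element of the commutant of `N` is an intertwiner, so `W` is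
  -- invariant under that commutant.
  have hP : W.starProjection ∈ N := by
    rw [IsStarProjection.mem_iff isStarProjection_starProjection]
    intro y hy
    rw [Submodule.range_starProjection]
    refine (Module.End.mem_invtSubmodule _).2 fun v hv => hinv y ?_ v hv
    rintro _ ⟨S, hS, η, rfl⟩
    refine ⟨y.comp S, fun x => ?_, η, rfl⟩
    have := N.mul_comm_of_mem (θ x).2 hy
    rw [ContinuousLinearMap.comp_assoc, hS x, ← ContinuousLinearMap.comp_assoc,
      ← ContinuousLinearMap.comp_assoc]
    exact congrArg (fun T => ContinuousLinearMap.comp T S) this.symm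
  by_contra hcon
  let P : N.toStarSubalgebra := ⟨W.starProjection, hP⟩
  set Q : N.toStarSubalgebra := 1 - P with hQ
  have hPs : IsStarProjection P := by
    have h := isStarProjection_starProjection (𝕜 := ℂ) (U := W)
    exact ⟨Subtype.ext h.isIdempotentElem, Subtype.ext h.isSelfAdjoint⟩
  have hQs : IsStarProjection Q := hPs.one_sub
  -- If `Ω` is not in `W`, its component `ζ` orthogonal to `W` is nonzero. The contradiction will be
  -- an intertwiner whose range contains a nonzero vector `θ(a) ζ`.
  set ζ : K := (Q : K →L[ℂ] K) Ω with hζ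
  have hζ' : ζ = Ω - W.starProjection Ω := rfl
  have hζ0 : ζ ≠ 0 := by
    intro h
    rw [hζ', sub_eq_zero] at h
    exact hcon (Submodule.starProjection_eq_self_iff.1 h.symm)
  set z : M.toStarSubalgebra := θ.symm Q with hzd
  have hθz : θ z = Q := θ.apply_symm_apply Q
  have hzs : IsStarProjection z :=
    ⟨by change θ.symm Q * θ.symm Q = _; rw [← map_mul, hQs.isIdempotentElem],
      by change star (θ.symm Q) = _; rw [← map_star, hQs.isSelfAdjoint.star_eq]⟩
  have hzz : (z : H →L[ℂ] H) * z = z := congrArg Subtype.val hzs.isIdempotentElem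
  have hz0 : 0 ≤ (z : H →L[ℂ] H) := by
    have h : star (z : H →L[ℂ] H) * z = z :=
      congrArg Subtype.val (show star z * z = z by
        rw [hzs.isSelfAdjoint.star_eq, hzs.isIdempotentElem])
    rw [← h]
    exact star_mul_self_nonneg _
  have hzne : (z : H →L[ℂ] H) ≠ 0 := by
    intro h
    have h' : z = 0 := Subtype.ext h
    rw [h', map_zero] at hθz
    exact hζ0 (by rw [hζ, ← hθz]; rfl)
  -- Any nonzero vector in the range of `z` will do after multiplication by a large scalar.
  obtain ⟨η, hη⟩ : ∃ η : H, (inner ℂ ((θ z : K →L[ℂ] K) ζ) ζ).re <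
      (inner ℂ ((z : H →L[ℂ] H) η) η).re := by
    obtain ⟨η, hη⟩ : ∃ η, (z : H →L[ℂ] H) η ≠ 0 := by
      by_contra! h
      exact hzne (ContinuousLinearMap.ext h)
    have hpos : 0 < ‖(z : H →L[ℂ] H) η‖ ^ 2 := by positivity
    obtain ⟨n, hn⟩ := exists_nat_gt ((inner ℂ ((θ z : K →L[ℂ] K) ζ) ζ).re / ‖(z : H →L[ℂ] H) η‖ ^ 2)
    rw [div_lt_iff₀ hpos] at hn
    refine ⟨((n + 1 : ℝ) : ℂ) • (z : H →L[ℂ] H) η, hn.trans_le ?_⟩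
    have e0 : (z : H →L[ℂ] H) ((z : H →L[ℂ] H) η) = (z : H →L[ℂ] H) η :=
      ContinuousLinearMap.ext_iff.1 hzz η
    rw [map_smul, e0, inner_self_eq_norm_sq_to_K, norm_smul,
      Complex.norm_real, Real.norm_of_nonneg (by positivity)]
    have e : ((((n + 1 : ℝ) * ‖(z : H →L[ℂ] H) η‖ : ℝ) : ℂ) ^ 2).re =
        ((n + 1 : ℝ) * ‖(z : H →L[ℂ] H) η‖) ^ 2 := by
      rw [← Complex.ofReal_pow, Complex.ofReal_re]
    refine le_of_le_of_eq ?_ e.symm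
    rw [mul_pow]
    refine mul_le_mul_of_nonneg_right ?_ hpos.le
    nlinarith [Nat.cast_nonneg (α := ℝ) n]
  obtain ⟨h, hh0, hhnn, hhz, hdom⟩ := exists_dominated θ z hz0 η ζ hη
  let a : M.toStarSubalgebra := ⟨CFC.sqrt h, M.sqrt_mem h.2⟩
  have ha0 : 0 ≤ (a : H →L[ℂ] H) := CFC.sqrt_nonneg _
  have has : star a = a := Subtype.ext ha0.isSelfAdjoint.star_eq
  have haa : a * a = h := Subtype.ext (CFC.sqrt_mul_sqrt_self _ hhnn)
  obtain ⟨S, hS, hSa⟩ := exists_isIntertwiner_of_dominated θ h a ha0 haa η ζ hdom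
  have hmemW : (θ a : K →L[ℂ] K) ζ ∈ W :=
    Submodule.le_topologicalClosure _ (Submodule.subset_span ⟨S, hS, _, hSa⟩)
  -- The self-adjoint `θ(a)` preserves `W`, hence its orthogonal complement, which contains `ζ`.
  have hmemO : (θ a : K →L[ℂ] K) ζ ∈ Wᗮ := by
    rw [Submodule.mem_orthogonal]
    intro u hu
    rw [← ContinuousLinearMap.adjoint_inner_left]
    have h1 : ContinuousLinearMap.adjoint (θ a : K →L[ℂ] K) = (θ a : K →L[ℂ] K) := by
      have : star (θ a) = θ a := by rw [← map_star, has]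
      exact congrArg Subtype.val this
    rw [h1]
    have h2 := hinvN a u hu
    rw [hζ']
    exact Submodule.inner_right_of_mem_orthogonal h2 (W.sub_starProjection_mem_orthogonal Ω)
  have hzero : (θ a : K →L[ℂ] K) ζ = 0 :=
    Submodule.disjoint_def.1 W.orthogonal_disjoint _ hmemW hmemO
  -- Now `θ(a) Q` kills the separating vector `Ω`. Together with `a * (1 - z) = 0` this forces `a =
  -- 0`.
  have haz : a * z = 0 := by
    have h1 : ((θ a * Q : N.toStarSubalgebra) : K →L[ℂ] K) = 0 := hΩ _ (θ a * Q).2 hzero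
    have h2 : θ (a * z) = θ 0 := by
      rw [map_mul, hθz, map_zero]; exact Subtype.ext h1
    exact θ.injective h2
  have ha1 : a * (1 - z) = 0 := mul_one_sub_eq_zero_of_le ha0 haa hzs hhz
  have ha : a = 0 := by
    have : a * z + a * (1 - z) = a := by rw [← mul_add, add_sub_cancel, mul_one]
    rw [← this, haz, ha1, add_zero]
  exact hh0 (by rw [← haa, ha, mul_zero])

end VonNeumannAlgebra

end Operators

/-! ### Exchanging left and right convolutions -/

namespace MdMult

section Alternating

variable {Λ : Type v} [Group Λ]
  {E E' : Type*} [NormedAddCommGroup E] [InnerProductSpace ℂ E] [CompleteSpace E]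
  [NormedAddCommGroup E'] [InnerProductSpace ℂ E'] [CompleteSpace E']

open Classical in
/-- `A` is the left convolution operator by `a`. -/
def IsLeftConv (A : EllTwo Λ →ₗᵢ[ℂ] EllTwo Λ) (a : Λ → ℂ) : Prop :=
  ∀ x y, (A (lp.single 2 y 1) : Λ → ℂ) x = a (x * y⁻¹)

open Classical in
/-- `B` is the right convolution operator by `x ↦ b x⁻¹`. -/
def IsRightConv (B : EllTwo Λ →ₗᵢ[ℂ] EllTwo Λ) (b : Λ → ℂ) : Prop :=
  ∀ x y, (B (lp.single 2 y 1) : Λ → ℂ) x = b (x⁻¹ * y)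

/-- Evaluation at `1`, composed with an isometry. -/
noncomputable def evalOne (A : EllTwo Λ →ₗᵢ[ℂ] EllTwo Λ) : EllTwo Λ →L[ℂ] ℂ :=
  (lp.evalCLM ℂ (fun _ : Λ => ℂ) 2 1).comp A.toContinuousLinearMap

lemma evalOne_apply (A : EllTwo Λ →ₗᵢ[ℂ] EllTwo Λ) (f : EllTwo Λ) : evalOne A f = A f 1 := rfl

lemma norm_evalOne_le (A : EllTwo Λ →ₗᵢ[ℂ] EllTwo Λ) : ‖evalOne A‖ ≤ 1 :=
  ContinuousLinearMap.opNorm_le_bound _ zero_le_one fun f => by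
    rw [one_mul, ← A.norm_map f]
    exact lp.norm_apply_le_norm (by norm_num) _ _

open Classical in
lemma evalOne_eq_tsum (A : EllTwo Λ →ₗᵢ[ℂ] EllTwo Λ) (f : EllTwo Λ) :
    evalOne A f = ∑' x, (A (lp.single 2 x 1) : Λ → ℂ) 1 * f x := by
  have h := (lp.hasSum_single (p := 2) (by norm_num) f).map (evalOne A) (evalOne A).continuous
  rw [← h.tsum_eq]
  refine tsum_congr fun x => ?_
  have hx : lp.single 2 x (f x) = f x • (lp.single 2 x (1 : ℂ) : EllTwo Λ) := by
    rw [← lp.single_smul, smul_eq_mul, mul_one]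
  rw [Function.comp_apply, hx, map_smul, smul_eq_mul, mul_comm, evalOne_apply]

variable {A B : EllTwo Λ →ₗᵢ[ℂ] EllTwo Λ} {a b : Λ → ℂ}

lemma IsLeftConv.evalOne (hA : IsLeftConv A a) (f : EllTwo Λ) :
    evalOne A f = ∑' x, a x⁻¹ * f x := by
  rw [evalOne_eq_tsum]
  exact tsum_congr fun x => by rw [hA, one_mul]

lemma IsRightConv.evalOne (hB : IsRightConv B b) (f : EllTwo Λ) :
    evalOne B f = ∑' x, b x * f x := by
  rw [evalOne_eq_tsum]
  exact tsum_congr fun x => by rw [hB, inv_one, one_mul]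

variable {C C' C'' : ℝ} (hC : 0 ≤ C) (hC' : 0 ≤ C') (hC'' : 0 ≤ C'') {L : Λ → E →L[ℂ] ℂ}
  {ξ : Λ → E' →L[ℂ] E} {L' : Λ → E' →L[ℂ] ℂ} (hL : ∀ x, ‖L x‖ ≤ C) (hξ : ∀ x, ‖ξ x‖ ≤ C')
  (hL' : ∀ x, ‖L' x‖ ≤ C'') (hLξ : ∀ x y, (L x).comp (ξ y) = L' (x * y))

include hLξ

/-- On `δ_y ⊗ h` the left side is `∑ x, b(x) a(x y⁻¹) L'(x y⁻¹) h`, because `L x ∘ ξ y⁻¹` depends on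
`x y⁻¹` only; the substitution `x ↦ x⁻¹ y` turns it into the right side. -/
lemma exchange_right_left (hA : IsLeftConv A a) (hB : IsRightConv B b)
    (f : lp (fun _ : Λ => E') 2) :
    evalOne B (lp.mapCLM 2 L hC hL (amp E A
      (lp.mapCLM 2 (fun x => ξ x⁻¹) hC' (fun x => hξ x⁻¹) f))) =
    evalOne A (lp.mapCLM 2 (fun x => L' x⁻¹) hC'' (fun x => hL' x⁻¹) (amp E' B f)) := by
  classical
  suffices h : (evalOne B).comp ((lp.mapCLM 2 L hC hL).comp ((amp E A).comp
      (lp.mapCLM 2 (fun x => ξ x⁻¹) hC' (fun x => hξ x⁻¹)))) =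
      (evalOne A).comp ((lp.mapCLM 2 (fun x => L' x⁻¹) hC'' (fun x => hL' x⁻¹)).comp
        (amp E' B)) from ContinuousLinearMap.ext_iff.1 h f
  refine lp_ext_single fun y h => ?_
  have hs : lp.mapCLM 2 (fun x => ξ x⁻¹) hC' (fun x => hξ x⁻¹) (lp.single 2 y h) =
      lp.single 2 y (ξ y⁻¹ h) := by
    ext x
    rw [lp.mapCLM_apply_coe, lp.single_apply, lp.single_apply, Pi.single_apply, Pi.single_apply]
    split_ifs with hx
    · rw [hx]
    · rw [map_zero]
  simp only [ContinuousLinearMap.comp_apply]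
  rw [hs, amp_single, amp_single, hA.evalOne, hB.evalOne]
  refine ((Equiv.inv Λ).trans (Equiv.mulRight y)).tsum_eq _ |>.symm.trans (tsum_congr fun x => ?_)
  have e := fun x y => ContinuousLinearMap.ext_iff.1 (hLξ x y) h
  simp only [ContinuousLinearMap.comp_apply] at e
  simp only [lp.mapCLM_apply_coe, tens_apply, map_smul, e, hA _ _, hB _ _, Equiv.trans_apply,
    Equiv.inv_apply, Equiv.coe_mulRight, smul_eq_mul, mul_inv_cancel_right]
  ring

/-- The same substitution, made in the sum on the right. -/
lemma exchange_left_right (hA : IsLeftConv A a) (hB : IsRightConv B b)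
    (f : lp (fun _ : Λ => E') 2) :
    evalOne A (lp.mapCLM 2 (fun x => L x⁻¹) hC (fun x => hL x⁻¹) (amp E B
      (lp.mapCLM 2 ξ hC' hξ f))) =
    evalOne B (lp.mapCLM 2 L' hC'' hL' (amp E' A f)) := by
  classical
  suffices h : (evalOne A).comp ((lp.mapCLM 2 (fun x => L x⁻¹) hC (fun x => hL x⁻¹)).comp
      ((amp E B).comp (lp.mapCLM 2 ξ hC' hξ))) =
      (evalOne B).comp ((lp.mapCLM 2 L' hC'' hL').comp
        (amp E' A)) from ContinuousLinearMap.ext_iff.1 h f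
  refine lp_ext_single fun y h => ?_
  have hs : lp.mapCLM 2 ξ hC' hξ (lp.single 2 y h) = lp.single 2 y (ξ y h) := by
    ext x
    rw [lp.mapCLM_apply_coe, lp.single_apply, lp.single_apply, Pi.single_apply, Pi.single_apply]
    split_ifs with hx
    · rw [hx]
    · rw [map_zero]
  simp only [ContinuousLinearMap.comp_apply]
  rw [hs, amp_single, amp_single, hA.evalOne, hB.evalOne]
  refine (((Equiv.inv Λ).trans (Equiv.mulRight y)).tsum_eq _ |>.symm.trans
    (tsum_congr fun x => ?_)).symm
  have e := fun x y => ContinuousLinearMap.ext_iff.1 (hLξ x y) h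
  simp only [ContinuousLinearMap.comp_apply] at e
  simp only [lp.mapCLM_apply_coe, tens_apply, map_smul, e, hA _ _, hB _ _, Equiv.trans_apply,
    Equiv.inv_apply, Equiv.coe_mulRight, smul_eq_mul, mul_inv_cancel_right]
  ring

end Alternating

section AlternatingBal

variable {d : ℕ} {Γ : Type u} {Λ : Type v} [Group Γ] [Group Λ]

section Ops

variable {E E' : Type*} [NormedAddCommGroup E] [InnerProductSpace ℂ E] [CompleteSpace E]
  [NormedAddCommGroup E'] [InnerProductSpace ℂ E'] [CompleteSpace E']

/-- The operators `B ∘ D(ξ) ∘ A` (for odd `i`) and `A ∘ D(ξ ∘ inv) ∘ B` (for even `i`). -/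
noncomputable def altOp (i : ℕ) (A B : EllTwo Λ →ₗᵢ[ℂ] EllTwo Λ) (ξ : Λ → E' →L[ℂ] E) (C : ℝ)
    (hC : 0 ≤ C) (hξ : ∀ x, ‖ξ x‖ ≤ C) : lp (fun _ : Λ => E') 2 →L[ℂ] lp (fun _ : Λ => E) 2 :=
  if Even i then
    (amp E A).comp ((lp.mapCLM 2 (fun x => ξ x⁻¹) hC fun x => hξ x⁻¹).comp (amp E' B))
  else (amp E B).comp ((lp.mapCLM 2 ξ hC hξ).comp (amp E' A))

/-- The functionals `f ↦ (B (D(L) (A f))) 1` (for even `i`) and `f ↦ (A (D(L ∘ inv) (B f))) 1`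
(for odd `i`). -/
noncomputable def altFun (i : ℕ) (A B : EllTwo Λ →ₗᵢ[ℂ] EllTwo Λ) (L : Λ → E →L[ℂ] ℂ) (C : ℝ)
    (hC : 0 ≤ C) (hL : ∀ x, ‖L x‖ ≤ C) : lp (fun _ : Λ => E) 2 →L[ℂ] ℂ :=
  if Even i then (evalOne B).comp ((lp.mapCLM 2 L hC hL).comp (amp E A))
  else (evalOne A).comp ((lp.mapCLM 2 (fun x => L x⁻¹) hC fun x => hL x⁻¹).comp (amp E B))

lemma norm_comp_comp_le {E₁ E₂ E₃ E₄ : Type*} [NormedAddCommGroup E₁] [NormedSpace ℂ E₁]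
    [NormedAddCommGroup E₂] [NormedSpace ℂ E₂] [NormedAddCommGroup E₃] [NormedSpace ℂ E₃]
    [NormedAddCommGroup E₄] [NormedSpace ℂ E₄] {R : E₃ →L[ℂ] E₄} {S : E₂ →L[ℂ] E₃}
    {T : E₁ →L[ℂ] E₂} {C : ℝ} (hC : 0 ≤ C) (hR : ‖R‖ ≤ 1) (hS : ‖S‖ ≤ C) (hT : ‖T‖ ≤ 1) :
    ‖R.comp (S.comp T)‖ ≤ C :=
  calc ‖R.comp (S.comp T)‖ ≤ ‖R‖ * (‖S‖ * ‖T‖) :=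
        (ContinuousLinearMap.opNorm_comp_le _ _).trans
          (mul_le_mul_of_nonneg_left (ContinuousLinearMap.opNorm_comp_le _ _) (norm_nonneg _))
    _ ≤ 1 * (C * 1) := by gcongr
    _ = C := by ring

lemma norm_altOp_le (i : ℕ) (A B : EllTwo Λ →ₗᵢ[ℂ] EllTwo Λ) (ξ : Λ → E' →L[ℂ] E) (C : ℝ)
    (hC : 0 ≤ C) (hξ : ∀ x, ‖ξ x‖ ≤ C) : ‖altOp i A B ξ C hC hξ‖ ≤ C := by
  unfold altOp
  split_ifs
  · exact norm_comp_comp_le hC (norm_amp_le A) (lp.norm_mapCLM_le _ _ _ _) (norm_amp_le B)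
  · exact norm_comp_comp_le hC (norm_amp_le B) (lp.norm_mapCLM_le _ _ _ _) (norm_amp_le A)

lemma norm_altFun_le (i : ℕ) (A B : EllTwo Λ →ₗᵢ[ℂ] EllTwo Λ) (L : Λ → E →L[ℂ] ℂ) (C : ℝ)
    (hC : 0 ≤ C) (hL : ∀ x, ‖L x‖ ≤ C) : ‖altFun i A B L C hC hL‖ ≤ C := by
  unfold altFun
  split_ifs
  · exact norm_comp_comp_le hC (norm_evalOne_le B) (lp.norm_mapCLM_le _ _ _ _) (norm_amp_le A)
  · exact norm_comp_comp_le hC (norm_evalOne_le A) (lp.norm_mapCLM_le _ _ _ _) (norm_amp_le B)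

variable {A B : Γ → EllTwo Λ →ₗᵢ[ℂ] EllTwo Λ} {a b : Γ → Λ → ℂ}

/-- The two adjacent convolutions are of the same kind and merge into the one for `g * h`. The
exchange absorbs `ξ` and makes the other two adjacent, and they merge too. -/
lemma altFun_altOp (hAm : ∀ g h, A (g * h) = (A g).comp (A h))
    (hBm : ∀ g h, B (g * h) = (B g).comp (B h)) (hA : ∀ g, IsLeftConv (A g) (a g))
    (hB : ∀ g, IsRightConv (B g) (b g)) {C C' C'' : ℝ} (hC : 0 ≤ C) (hC' : 0 ≤ C') (hC'' : 0 ≤ C'')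
    {L : Λ → E →L[ℂ] ℂ} {ξ : Λ → E' →L[ℂ] E} {L' : Λ → E' →L[ℂ] ℂ} (hL : ∀ x, ‖L x‖ ≤ C)
    (hξ : ∀ x, ‖ξ x‖ ≤ C') (hL' : ∀ x, ‖L' x‖ ≤ C'')
    (hLξ : ∀ x y, (L x).comp (ξ y) = L' (x * y)) (i : ℕ) (g h : Γ) :
    (altFun i (A g) (B g) L C hC hL).comp (altOp i (A h) (B h) ξ C' hC' hξ) =
      altFun (i + 1) (A (g * h)) (B (g * h)) L' C'' hC'' hL' := by
  refine ContinuousLinearMap.ext fun f => ?_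
  unfold altFun altOp
  by_cases hi : Even i
  · rw [if_pos hi, if_pos hi, if_neg (by simpa [Nat.even_add_one] using hi)]
    simp only [ContinuousLinearMap.comp_apply]
    rw [amp_amp, ← hAm, exchange_right_left hC hC' hC'' hL hξ hL' hLξ (hA (g * h)) (hB g), amp_amp,
      ← hBm]
  · rw [if_neg hi, if_neg hi, if_pos (by simpa [Nat.even_add_one] using hi)]
    simp only [ContinuousLinearMap.comp_apply]
    rw [amp_amp, ← hBm, exchange_left_right hC hC' hC'' hL hξ hL' hLξ (hA g) (hB (g * h)), amp_amp,
      ← hAm]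

-- The convolution applied to `δ₁` contributes one of the factors `a`, `b`, and evaluation at 1
-- after the other contributes the second; both parities give the same sum.
omit [Group Γ] in
open Classical in
lemma altFun_single (hA : ∀ g, IsLeftConv (A g) (a g)) (hB : ∀ g, IsRightConv (B g) (b g))
    (i : ℕ) (g : Γ) (L : Λ → E →L[ℂ] ℂ) (C : ℝ) (hC : 0 ≤ C) (hL : ∀ x, ‖L x‖ ≤ C) (v : E) :
    altFun i (A g) (B g) L C hC hL (lp.single 2 1 v) = ∑' x, a g x * b g x * L x v := by
  unfold altFun
  split_ifs
  · simp only [ContinuousLinearMap.comp_apply]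
    rw [amp_single, (hB g).evalOne]
    refine tsum_congr fun x => ?_
    rw [lp.mapCLM_apply_coe, tens_apply, map_smul, hA g, inv_one, mul_one, smul_eq_mul]
    ring
  · simp only [ContinuousLinearMap.comp_apply]
    rw [amp_single, (hA g).evalOne]
    refine ((Equiv.inv Λ).tsum_eq _).symm.trans (tsum_congr fun x => ?_)
    rw [lp.mapCLM_apply_coe, tens_apply, map_smul, hB g, mul_one, Equiv.inv_apply, inv_inv,
      smul_eq_mul]
    ring

end Ops

/-- Multipliers of `Λ` are transferred to `Γ` by pairs of convolution representations. -/
theorem Bal.conv (hd : 2 ≤ d) {A B : Γ → EllTwo Λ →ₗᵢ[ℂ] EllTwo Λ} {a b : Γ → Λ → ℂ}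
    (hAm : ∀ g h, A (g * h) = (A g).comp (A h)) (hBm : ∀ g h, B (g * h) = (B g).comp (B h))
    (hA : ∀ g, IsLeftConv (A g) (a g)) (hB : ∀ g, IsRightConv (B g) (b g)) {c : ℝ} {φ : Λ → ℂ}
    (h : Bal d c φ) : Bal d c fun g => ∑' x, a g x * b g x * φ x := by
  classical
  obtain ⟨H, _, _, _, L, mid, last, h1, h2, h3, h4, h5⟩ := h.normalBal hd
  have hc := Real.sqrt_nonneg c
  let mid' : ∀ i, Γ → lp (fun _ : Λ => H (i + 1)) 2 →L[ℂ] lp (fun _ : Λ => H i) 2 := fun i g =>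
    if hi : i < d - 2 then altOp i (A g) (B g) (mid i) 1 zero_le_one (h2 i hi) else 0
  let last' : Γ → lp (fun _ : Λ => ℂ) 2 →L[ℂ] lp (fun _ : Λ => H (d - 2)) 2 := fun g =>
    altOp (d - 2) (A g) (B g) last (√c) hc h3
  have key : ∀ (g : ℕ → Γ) (n : ℕ) (hn : n ≤ d - 2),
      (altFun 0 (A (g 0)) (B (g 0)) (L 0) (√c) hc (h1 0 (Nat.zero_le _))).comp
        (chain (H := fun i => lp (fun _ : Λ => H i) 2) mid' g n) =
      altFun n (A ((List.range (n + 1)).map g).prod) (B ((List.range (n + 1)).map g).prod)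
        (L n) (√c) hc (h1 n hn) := by
    intro g n
    induction n with
    | zero => intro _; ext; simp [chain]
    | succ n ih =>
      intro hn
      have hm : mid' n (g (n + 1)) =
          altOp n (A (g (n + 1))) (B (g (n + 1))) (mid n) 1 zero_le_one (h2 n hn) := dif_pos hn
      rw [chain, ← ContinuousLinearMap.comp_assoc, ih (by omega), hm, prod_range_succ g (n + 1),
        altFun_altOp hAm hBm hA hB hc zero_le_one hc (h1 n (by omega)) (h2 n hn) (h1 (n + 1) hn)
          (h4 n hn)]
  -- `last` is treated as one more middle map, with `φ'` in the role of the next functional, so a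
  -- final exchange leaves the sum against `φ`.
  let φ' : Λ → ℂ →L[ℂ] ℂ := fun x => ContinuousLinearMap.toSpanSingleton ℂ (φ x)
  have hφ' : ∀ x, ‖φ' x‖ ≤ √c * √c := by
    intro x
    have : φ' x = (L (d - 2) x).comp (last 1) := by
      ext
      simp [φ', h5]
    rw [this]
    exact (ContinuousLinearMap.opNorm_comp_le _ _).trans
      (mul_le_mul (h1 _ le_rfl x) (h3 1) (norm_nonneg _) hc)
  have hφL : ∀ x y, (L (d - 2) x).comp (last y) = φ' (x * y) := by
    intro x y
    ext
    simp [φ', h5]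
  refine (normalBal_of_data (H := fun i => lp (fun _ : Λ => H i) 2) hd
    (fun g => altFun 0 (A g) (B g) (L 0) (√c) hc (h1 0 (Nat.zero_le _))) mid'
    (fun g => ContinuousLinearMap.toSpanSingleton ℂ (last' g (lp.single 2 1 1)))
    (fun x => norm_altFun_le _ _ _ _ _ _ _) (fun i hi x => ?_) (fun x => ?_) fun g => ?_).bal hd
  · have hm : mid' i x = altOp i (A x) (B x) (mid i) 1 zero_le_one (h2 i hi) := dif_pos hi
    rw [hm]
    exact norm_altOp_le _ _ _ _ _ _ _
  · rw [ContinuousLinearMap.norm_toSpanSingleton]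
    have := (last' x).le_of_opNorm_le (norm_altOp_le _ _ _ _ _ _ _) (lp.single 2 1 1)
    rwa [lp.norm_single (by norm_num), norm_one, mul_one] at this
  · rw [← ContinuousLinearMap.comp_apply, key g _ le_rfl,
      ContinuousLinearMap.toSpanSingleton_apply_one, ← ContinuousLinearMap.comp_apply,
      altFun_altOp hAm hBm hA hB hc hc (by positivity) (h1 _ le_rfl) h3 hφ' hφL]
    obtain ⟨k, rfl⟩ : ∃ k, d = k + 2 := ⟨d - 2, by omega⟩
    rw [altFun_single hA hB, prod_range_succ g (k + 1)]
    refine tsum_congr fun x => ?_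
    simp [φ']

end AlternatingBal

end MdMult

/-! ### The kernel of an isomorphism of group von Neumann algebras -/

namespace MdMult

section Regular

variable {G : Type u} [Group G]

lemma star_leftReg (x : G) : star (leftReg x) = leftReg x⁻¹ := by
  rw [ContinuousLinearMap.star_eq_adjoint]
  refine ((ContinuousLinearMap.eq_adjoint_iff _ _).2 fun f g => ?_).symm
  rw [lp.inner_eq_tsum, lp.inner_eq_tsum, ← (Equiv.mulLeft x).tsum_eq
    fun y => inner ℂ ((f : G → ℂ) y) ((leftReg x g : G → ℂ) y)]
  exact tsum_congr fun y => by simp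

lemma leftReg_one : leftReg (1 : G) = 1 := by
  ext f y
  simp

lemma leftReg_mem_groupVN (x : G) : leftReg x ∈ groupVN G := by
  change leftReg x ∈ StarSubalgebra.centralizer ℂ _
  rw [StarSubalgebra.mem_centralizer_iff]
  intro y hy
  have h := (StarSubalgebra.mem_centralizer_iff ℂ).1 hy _ ⟨x, rfl⟩
  have h' := (StarSubalgebra.mem_centralizer_iff ℂ).1 (star_mem hy) _ ⟨x, rfl⟩
  exact ⟨h.1.symm, h'.1.symm⟩

lemma memℓp_translate_right (x : G) (f : EllTwo G) :
    Memℓp (fun y => (f : G → ℂ) (y * x)) 2 := by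
  have h := (memℓp_gen_iff (p := 2) (by norm_num)).1 (lp.memℓp f)
  exact memℓp_gen ((Equiv.mulRight x).summable_iff.2 h)

/-- The right regular representation: `(ρ(x) f)(y) = f(y x)`. -/
noncomputable def rightReg (x : G) : EllTwo G →L[ℂ] EllTwo G :=
  LinearMap.mkContinuous
    { toFun := fun f => ⟨fun y => (f : G → ℂ) (y * x), memℓp_translate_right x f⟩
      map_add' := fun _ _ => rfl
      map_smul' := fun _ _ => rfl } 1 (fun f => by
        rw [one_mul, lp.norm_eq_tsum_rpow (by norm_num), lp.norm_eq_tsum_rpow (by norm_num)]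
        refine le_of_eq ?_
        congr 1
        exact (Equiv.mulRight x).tsum_eq fun y => ‖(f : G → ℂ) y‖ ^ (2 : ℝ≥0∞).toReal)

@[simp] lemma rightReg_apply (x : G) (f : EllTwo G) (y : G) :
    (rightReg x f : G → ℂ) y = (f : G → ℂ) (y * x) := rfl

open Classical in
lemma rightReg_single (x : G) :
    rightReg x⁻¹ (lp.single 2 1 1) = (lp.single 2 x 1 : EllTwo G) := by
  ext y
  rw [rightReg_apply, lp.single_apply, lp.single_apply, Pi.single_apply, Pi.single_apply,
    mul_inv_eq_one]

lemma leftReg_mul_rightReg (x y : G) : leftReg x * rightReg y = rightReg y * leftReg x := by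
  ext f z
  simp [mul_assoc]

lemma rightReg_mul_comm (y : G) {T : EllTwo G →L[ℂ] EllTwo G} (hT : T ∈ groupVN G) :
    rightReg y * T = T * rightReg y := by
  have hT' : T ∈ StarSubalgebra.centralizer ℂ _ := hT
  refine ((StarSubalgebra.mem_centralizer_iff ℂ).1 hT' (rightReg y) ?_).1
  refine (StarSubalgebra.mem_centralizer_iff ℂ).2 ?_
  rintro _ ⟨x, rfl⟩
  rw [star_leftReg]
  exact ⟨leftReg_mul_rightReg _ _, leftReg_mul_rightReg _ _⟩

-- `T` commutes with right translations, and `δ_y` is a right translate of `δ₁`; so `T` is left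
-- convolution by `T δ₁`.
open Classical in
lemma groupVN_apply_single {T : EllTwo G →L[ℂ] EllTwo G} (hT : T ∈ groupVN G) (x y : G) :
    (T (lp.single 2 y 1) : G → ℂ) x = (T (lp.single 2 1 1) : G → ℂ) (x * y⁻¹) := by
  rw [← rightReg_single y, ← rightReg_apply]
  have := congrArg (fun S => S (lp.single 2 1 1 : EllTwo G)) (rightReg_mul_comm y⁻¹ hT)
  exact (congrArg (fun f : EllTwo G => f x) this).symm

open Classical in
lemma groupVN_separating {T : EllTwo G →L[ℂ] EllTwo G} (hT : T ∈ groupVN G)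
    (h : T (lp.single 2 1 1) = 0) : T = 0 := by
  refine lp_ext_single fun y c => ?_
  have hc : lp.single 2 y c = c • (lp.single 2 y (1 : ℂ) : EllTwo G) := by
    rw [← lp.single_smul, smul_eq_mul, mul_one]
  ext x
  rw [hc, map_smul, lp.coeFn_smul, Pi.smul_apply, groupVN_apply_single hT, h]
  simp

lemma memℓp_conj_inv (f : EllTwo G) :
    Memℓp (fun y => starRingEnd ℂ ((f : G → ℂ) y⁻¹)) 2 := by
  have h := (memℓp_gen_iff (p := 2) (by norm_num)).1 (lp.memℓp f)
  refine memℓp_gen ?_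
  simp only [RCLike.norm_conj]
  exact (Equiv.inv G).summable_iff.2 h

/-- The conjugation `(J f)(y) = conj (f (y⁻¹))` of `ℓ²(G)`. -/
noncomputable def conjInv : EllTwo G →ₛₗᵢ[starRingEnd ℂ] EllTwo G where
  toFun f := ⟨fun y => starRingEnd ℂ ((f : G → ℂ) y⁻¹), memℓp_conj_inv f⟩
  map_add' f g := lp.ext (funext fun _ => map_add (starRingEnd ℂ) _ _)
  map_smul' c f := by ext; simp
  norm_map' f := by
    rw [lp.norm_eq_tsum_rpow (by norm_num), lp.norm_eq_tsum_rpow (by norm_num)]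
    congr 1
    simp only [LinearMap.coe_mk, AddHom.coe_mk, RCLike.norm_conj]
    exact (Equiv.inv G).tsum_eq fun y => ‖(f : G → ℂ) y‖ ^ (2 : ℝ≥0∞).toReal

lemma conjInv_apply (f : EllTwo G) (y : G) :
    (conjInv f : G → ℂ) y = starRingEnd ℂ ((f : G → ℂ) y⁻¹) := rfl

lemma conjInv_conjInv (f : EllTwo G) : conjInv (conjInv f) = f := by
  ext y
  simp [conjInv_apply]

open Classical in
lemma conjInv_single (x : G) : conjInv (lp.single 2 x 1) = (lp.single 2 x⁻¹ 1 : EllTwo G) := by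
  ext y
  rw [conjInv_apply, lp.single_apply, lp.single_apply, Pi.single_apply, Pi.single_apply,
    inv_eq_iff_eq_inv]
  split_ifs <;> simp

/-- The operator `J A J`. -/
noncomputable def conjugate (A : EllTwo G →ₗᵢ[ℂ] EllTwo G) : EllTwo G →ₗᵢ[ℂ] EllTwo G :=
  (conjInv.comp A).comp conjInv

lemma conjugate_apply (A : EllTwo G →ₗᵢ[ℂ] EllTwo G) (f : EllTwo G) :
    conjugate A f = conjInv (A (conjInv f)) := rfl

lemma conjugate_comp (A B : EllTwo G →ₗᵢ[ℂ] EllTwo G) :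
    conjugate (A.comp B) = (conjugate A).comp (conjugate B) := by
  ext1 f
  simp [conjugate_apply, conjInv_conjInv]

/-- Inversion on the group exchanges left and right, and `J` sends `δ_y` to `δ_{y⁻¹}`. -/
lemma IsLeftConv.conjugate {A : EllTwo G →ₗᵢ[ℂ] EllTwo G} {a : G → ℂ} (h : IsLeftConv A a) :
    IsRightConv (conjugate A) fun s => starRingEnd ℂ (a s) := by
  intro x y
  rw [conjugate_apply, conjInv_single, conjInv_apply, h, inv_inv]

end Regular

section Kernel

variable {Γ : Type u} {Λ : Type v} [Group Γ] [Group Λ]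
  (θ : (groupVN Γ).toStarSubalgebra ≃⋆ₐ[ℂ] (groupVN Λ).toStarSubalgebra)

lemma norm_transport_apply (γ : Γ) (f : EllTwo Λ) :
    ‖(θ ⟨leftReg γ, leftReg_mem_groupVN γ⟩ : EllTwo Λ →L[ℂ] EllTwo Λ) f‖ = ‖f‖ := by
  refine (ContinuousLinearMap.norm_map_iff_adjoint_comp_self _).2 ?_ f
  rw [← ContinuousLinearMap.star_eq_adjoint, ← ContinuousLinearMap.mul_def]
  have h : star (⟨leftReg γ, leftReg_mem_groupVN γ⟩ : (groupVN Γ).toStarSubalgebra) *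
      ⟨leftReg γ, leftReg_mem_groupVN γ⟩ = 1 := by
    refine Subtype.ext ?_
    change star (leftReg γ) * leftReg γ = 1
    rw [star_leftReg, ContinuousLinearMap.mul_def, ← leftReg_mul, inv_mul_cancel, leftReg_one]
  have := congrArg (fun x => (θ x : EllTwo Λ →L[ℂ] EllTwo Λ)) h
  rw [map_mul, map_one] at this
  exact (congrArg (· * _) (congrArg Subtype.val (θ.map_star' _).symm)).trans this

/-- The isometry of `ℓ²(Λ)` corresponding to `λ(γ)` under an isomorphism `L(Γ) ≃ L(Λ)`. -/
noncomputable def transport (γ : Γ) : EllTwo Λ →ₗᵢ[ℂ] EllTwo Λ where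
  toLinearMap := (θ ⟨leftReg γ, leftReg_mem_groupVN γ⟩ : EllTwo Λ →L[ℂ] EllTwo Λ).toLinearMap
  norm_map' := norm_transport_apply θ γ

lemma transport_apply (γ : Γ) (f : EllTwo Λ) :
    transport θ γ f = (θ ⟨leftReg γ, leftReg_mem_groupVN γ⟩ : EllTwo Λ →L[ℂ] EllTwo Λ) f := rfl

lemma transport_mul (γ γ' : Γ) :
    transport θ (γ * γ') = (transport θ γ).comp (transport θ γ') := by
  ext1 f
  have h : (⟨leftReg (γ * γ'), leftReg_mem_groupVN _⟩ : (groupVN Γ).toStarSubalgebra) =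
      ⟨leftReg γ, leftReg_mem_groupVN γ⟩ * ⟨leftReg γ', leftReg_mem_groupVN γ'⟩ :=
    Subtype.ext (leftReg_mul γ γ')
  rw [transport_apply, h, map_mul]
  rfl

open Classical in
/-- The convolver `θ(λ(γ)) δ₁`. -/
noncomputable def symbol (γ : Γ) : EllTwo Λ := transport θ γ (lp.single 2 1 1)

lemma isLeftConv_transport (γ : Γ) : IsLeftConv (transport θ γ) (symbol θ γ) := fun x y =>
  groupVN_apply_single (θ ⟨leftReg γ, leftReg_mem_groupVN γ⟩).2 x y

lemma norm_symbol (γ : Γ) : ‖symbol θ γ‖ = 1 := by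
  classical
  rw [symbol, LinearIsometry.norm_map, lp.norm_single (by norm_num), norm_one]

lemma coe_normSq_symbol (γ : Γ) (s : Λ) :
    ((‖symbol θ γ s‖ ^ 2 : ℝ) : ℂ) = symbol θ γ s * starRingEnd ℂ (symbol θ γ s) := by
  rw [RCLike.mul_conj]
  push_cast
  rfl

variable {d : ℕ}

lemma hasSum_normSq_symbol (γ : Γ) : HasSum (fun s => ‖symbol θ γ s‖ ^ 2) 1 := by
  have h := lp.hasSum_norm (p := 2) (by norm_num) (symbol θ γ)
  rw [norm_symbol] at h
  simpa using h

-- For `ζ = S η` with an intertwiner `S`, the second factor is `⟨S* z, λ(γ) η⟩`, a coefficient of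
-- the regular representation of `Γ`. The rest is linearity.
open Classical in
lemma finApprox_symbol_mul (hd : 2 ≤ d) {ζ : EllTwo Λ}
    (hζ : ζ ∈ Submodule.span ℂ {ζ | ∃ S, VonNeumannAlgebra.IsIntertwiner θ S ∧ ∃ η, S η = ζ})
    (v w z : EllTwo Λ) :
    FinApprox d fun γ => inner ℂ w (conjugate (transport θ γ) v) *
      inner ℂ z (transport θ γ ζ) := by
  induction hζ using Submodule.span_induction with
  | mem ζ h =>
    obtain ⟨S, hS, η, rfl⟩ := h
    have e : ∀ γ, inner ℂ z (transport θ γ (S η)) =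
        inner ℂ (ContinuousLinearMap.adjoint S z) (leftReg γ η) := fun γ => by
      rw [ContinuousLinearMap.adjoint_inner_left, transport_apply]
      have := ContinuousLinearMap.ext_iff.1 (hS ⟨leftReg γ, leftReg_mem_groupVN γ⟩) η
      exact congrArg _ this.symm
    simp only [e]
    refine finApprox_mul_leftReg hd _ (fun g h => ?_) v w η _
    rw [transport_mul, conjugate_comp]
  | zero =>
    refine .of_finite_support (by simp)
  | add x y _ _ hx hy =>
    convert hx.add hy using 1
    ext γ
    simp [mul_add]
  | smul a x _ hx =>
    convert hx.smul a using 1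
    ext γ
    simp [mul_left_comm]

-- The column is a product of coefficients of `J A J` and of `A`, the latter at `δ₁`. Moving `δ₁` to
-- a nearby `ζ` in the span of the ranges of intertwiners costs at most `‖δ₁ - ζ‖`.
open Classical in
lemma finApprox_normSq_symbol (hd : 2 ≤ d) (s : Λ) :
    FinApprox d fun γ => ((‖symbol θ γ s‖ ^ 2 : ℝ) : ℂ) := by
  set δ : Λ → EllTwo Λ := fun t => lp.single 2 t 1 with hδ
  have nδ : ∀ t, ‖δ t‖ = 1 := fun t => by
    rw [hδ]
    simp only [lp.norm_single (p := 2) (by norm_num), norm_one]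
  have e : ∀ γ, ((‖symbol θ γ s‖ ^ 2 : ℝ) : ℂ) =
      inner ℂ (δ s⁻¹) (conjugate (transport θ γ) (δ 1)) * inner ℂ (δ s) (transport θ γ (δ 1)) := by
    intro γ
    have h1 : inner ℂ (δ s) (transport θ γ (δ 1)) = symbol θ γ s := by
      rw [hδ, lp.inner_single_left]
      simp [symbol]
    have h2 : inner ℂ (δ s⁻¹) (conjugate (transport θ γ) (δ 1)) =
        starRingEnd ℂ (symbol θ γ s) := by
      rw [hδ, lp.inner_single_left, (isLeftConv_transport θ γ).conjugate]
      simp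
    rw [coe_normSq_symbol, h1, h2, mul_comm]
  refine .of_forall_bal fun ε hε => ?_
  obtain ⟨ζ, hζ, hlt⟩ := Metric.mem_closure_iff.1
    (VonNeumannAlgebra.mem_closure_span_intertwiners θ (δ 1) fun y hy h =>
      groupVN_separating hy h) ε hε
  refine ⟨_, finApprox_symbol_mul θ hd hζ (δ 1) (δ s⁻¹) (δ s), ?_⟩
  have := bal_mul_coefficient (d := d) hd (fun γ => conjugate (transport θ γ))
    (fun g h => by rw [transport_mul, conjugate_comp]) (δ 1) (δ s⁻¹)
    (fun γ => (transport θ γ).toContinuousLinearMap)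
    (fun g h => by rw [transport_mul]; rfl)
    (fun g => LinearIsometry.norm_toContinuousLinearMap_le _) (δ 1 - ζ) (δ s) hε
    (by
      rw [nδ, nδ, nδ, one_mul, mul_one, mul_one, ← dist_eq_norm]
      exact hlt.le)
  convert this using 1
  ext γ
  simp only [Pi.sub_apply, e, LinearIsometry.coe_toContinuousLinearMap, map_sub, inner_sub_right,
    mul_sub]

/-- An isomorphism `L(Γ) ≃ L(Λ)` gives a transfer kernel from `Γ` to `Λ`. -/
theorem isTransferKernel_normSq_symbol (hd : 2 ≤ d) :
    IsTransferKernel d fun (γ : Γ) (s : Λ) => ‖symbol θ γ s‖ ^ 2 where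
  nonneg _ _ := by positivity
  hasSum := hasSum_normSq_symbol θ
  bal c φ _ h := by
    simp only [coe_normSq_symbol]
    exact Bal.conv hd (transport_mul θ) (fun g h => by rw [transport_mul, conjugate_comp])
      (isLeftConv_transport θ) (fun g => (isLeftConv_transport θ g).conjugate) h
  finApprox := finApprox_normSq_symbol θ hd

end Kernel

end MdMult

/-! ### Multipliers and cocycles -/

namespace MdMult

section CocycleOp

variable {X : Type w} [MeasurableSpace X] {ν : Measure X} {Λ : Type v} [MeasurableSpace Λ]
  [Countable Λ] [MeasurableSingletonClass Λ]
  {E F : Type*} [NormedAddCommGroup E] [NormedSpace ℂ E] [NormedAddCommGroup F] [NormedSpace ℂ F]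
  {b : X → Λ} (hb : Measurable b) {ξ : Λ → E →L[ℂ] F} {C : ℝ} (hξ : ∀ s, ‖ξ s‖ ≤ C)

include hb hξ in
lemma memLp_cocycleMul (f : Lp E 2 ν) : MemLp (fun x => ξ (b x) (f x)) 2 ν := by
  have h : AEStronglyMeasurable (fun x => ξ (b x)) ν :=
    ((StronglyMeasurable.of_discrete (f := ξ)).comp_measurable hb).aestronglyMeasurable
  exact (Lp.memLp f).of_le_mul
    ((ContinuousLinearMap.id ℂ (E →L[ℂ] F)).aestronglyMeasurable_comp₂ h (Lp.aestronglyMeasurable f))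
    (.of_forall fun x => (ξ (b x)).le_of_opNorm_le (hξ _) _)

/-- Pointwise application of a bounded operator field with countably many values. -/
noncomputable def cocycleMul (hξ : ∀ s, ‖ξ s‖ ≤ C) : Lp E 2 ν →L[ℂ] Lp F 2 ν :=
  LinearMap.mkContinuous
    { toFun := fun f => (memLp_cocycleMul hb hξ f).toLp _
      map_add' := fun f g => by
        rw [← MemLp.toLp_add]
        refine MemLp.toLp_congr _ _ ?_
        filter_upwards [Lp.coeFn_add f g] with x hx
        rw [hx, Pi.add_apply, map_add, Pi.add_apply]
      map_smul' := fun c f => by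
        rw [RingHom.id_apply, ← MemLp.toLp_const_smul]
        refine MemLp.toLp_congr _ _ ?_
        filter_upwards [Lp.coeFn_smul c f] with x hx
        rw [hx, Pi.smul_apply, map_smul, Pi.smul_apply] } C fun f => by
    refine Lp.norm_le_mul_norm_of_ae_le_mul ?_
    filter_upwards [MemLp.coeFn_toLp (memLp_cocycleMul hb hξ f)] with x hx
    exact (congrArg norm hx).trans_le ((ξ (b x)).le_of_opNorm_le (hξ _) _)

lemma cocycleMul_ae (f : Lp E 2 ν) :
    cocycleMul hb hξ f =ᵐ[ν] fun x => ξ (b x) (f x) :=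
  MemLp.coeFn_toLp (memLp_cocycleMul hb hξ f)

lemma norm_cocycleMul_le (hC : 0 ≤ C) : ‖(cocycleMul hb hξ : Lp E 2 ν →L[ℂ] Lp F 2 ν)‖ ≤ C :=
  LinearMap.mkContinuous_norm_le _ hC _

variable {T : X → X} (hT : MeasurePreserving T ν ν)

/-- The operator `f ↦ (x ↦ ξ (b x) (f (T x)))`. -/
noncomputable def cocycleOp (hξ : ∀ s, ‖ξ s‖ ≤ C) : Lp E 2 ν →L[ℂ] Lp F 2 ν :=
  (cocycleMul hb hξ).comp (Lp.compMeasurePreservingₗᵢ ℂ T hT).toContinuousLinearMap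

lemma cocycleOp_ae (f : Lp E 2 ν) : cocycleOp hb hT hξ f =ᵐ[ν] fun x => ξ (b x) (f (T x)) := by
  filter_upwards [cocycleMul_ae hb hξ (Lp.compMeasurePreservingₗᵢ ℂ T hT f),
    Lp.coeFn_compMeasurePreserving f hT] with x h1 h2
  exact h1.trans (congrArg _ h2)

lemma norm_cocycleOp_le (hC : 0 ≤ C) :
    ‖(cocycleOp hb hT hξ : Lp E 2 ν →L[ℂ] Lp F 2 ν)‖ ≤ C := by
  refine (ContinuousLinearMap.opNorm_comp_le _ _).trans ?_
  calc _ ≤ C * 1 := mul_le_mul (norm_cocycleMul_le hb hξ hC)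
        (LinearIsometry.norm_toContinuousLinearMap_le _) (norm_nonneg _) hC
    _ = C := mul_one C

end CocycleOp

/-- A measure preserving (right) action of `Γ` on `(X, ν)`, modulo null sets, with a measurable
cocycle with values in `Λ`. -/
structure IsCocycle {Γ : Type u} {Λ : Type v} [Group Γ] [Group Λ] [MeasurableSpace Λ] {X : Type w}
    [MeasurableSpace X] (ν : Measure X) (S : Γ → X → X) (β : Γ → X → Λ) : Prop where
  measurePreserving : ∀ g, MeasurePreserving (S g) ν ν
  measurable : ∀ g, Measurable (β g)
  act_one : ∀ᵐ x ∂ν, S 1 x = x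
  act_mul : ∀ g h, ∀ᵐ x ∂ν, S (g * h) x = S h (S g x)
  cocycle_one : ∀ᵐ x ∂ν, β 1 x = 1
  cocycle_mul : ∀ g h, ∀ᵐ x ∂ν, β (g * h) x = β g x * β h (S g x)

section Cocycle

variable {d : ℕ} {Γ : Type u} {Λ : Type v} [Group Γ] [Group Λ] {X : Type w}

/-- The point `S (g (n - 1)) (⋯ (S (g 0) x))`. -/
def orbit (S : Γ → X → X) (g : ℕ → Γ) (x : X) : ℕ → X
  | 0 => x
  | n + 1 => S (g n) (orbit S g x n)

variable [MeasurableSpace Λ] [MeasurableSpace X] {ν : Measure X}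
  {S : Γ → X → X} {β : Γ → X → Λ}

namespace IsCocycle

lemma measurePreserving_orbit (h : IsCocycle ν S β) (g : ℕ → Γ) (n : ℕ) :
    MeasurePreserving (fun x => orbit S g x n) ν ν := by
  induction n with
  | zero => exact MeasurePreserving.id ν
  | succ n ih => exact (h.measurePreserving (g n)).comp ih

lemma prod_ae (h : IsCocycle ν S β) (g : ℕ → Γ) (n : ℕ) : ∀ᵐ x ∂ν,
    S ((List.range n).map g).prod x = orbit S g x n ∧ β ((List.range n).map g).prod x =
      ((List.range n).map fun i => β (g i) (orbit S g x i)).prod := by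
  induction n with
  | zero =>
    filter_upwards [h.act_one, h.cocycle_one] with x h1 h2
    exact ⟨h1, h2⟩
  | succ n ih =>
    rw [prod_range_succ]
    filter_upwards [ih, h.act_mul ((List.range n).map g).prod (g n),
      h.cocycle_mul ((List.range n).map g).prod (g n)] with x h1 h2 h3
    rw [prod_range_succ, h2, h3, h1.1, h1.2]
    exact ⟨rfl, rfl⟩

/-- The middle maps use `g 1, …, g n`; the entry `g 0` belongs to the first map, which has already
moved the point to `S (g 0) x`. -/
lemma chain_ae (h : IsCocycle ν S β) {H : ℕ → Type*} [∀ i, NormedAddCommGroup (H i)]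
    [∀ i, InnerProductSpace ℂ (H i)] {mid : ∀ i, Λ → H (i + 1) →L[ℂ] H i}
    (mid' : ∀ i, Γ → Lp (H (i + 1)) 2 ν →L[ℂ] Lp (H i) 2 ν) (n : ℕ)
    (hmid : ∀ i < n, ∀ g f, mid' i g f =ᵐ[ν] fun x => mid i (β g x) (f (S g x)))
    (g : ℕ → Γ) (f : Lp (H n) 2 ν) : ∀ᵐ x ∂ν,
    chain (H := fun i => Lp (H i) 2 ν) mid' g n f (S (g 0) x) =
      chain mid (fun i => β (g i) (orbit S g x i)) n (f (orbit S g x (n + 1))) := by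
  induction n with
  | zero => exact .of_forall fun x => rfl
  | succ n ih =>
    have h1 := ih (fun i hi => hmid i (by omega)) (mid' n (g (n + 1)) f)
    have h2 := (h.measurePreserving_orbit g (n + 1)).quasiMeasurePreserving.ae
      (hmid n (by omega) (g (n + 1)) f)
    filter_upwards [h1, h2] with x h1 h2
    exact h1.trans (congrArg _ h2)

variable [Countable Λ] [MeasurableSingletonClass Λ]

lemma integral_comp [IsProbabilityMeasure ν] (h : IsCocycle ν S β) {φ : Λ → ℂ} {c : ℝ}
    (hφ : ∀ s, ‖φ s‖ ≤ c) (g : Γ) :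
    ∫ x, φ (β g x) ∂ν = ∑' s, (ν.real (β g ⁻¹' {s}) : ℂ) * φ s := by
  have hm : AEMeasurable (β g) ν := (h.measurable g).aemeasurable
  have := Measure.isProbabilityMeasure_map hm
  rw [← integral_map (f := φ) hm (StronglyMeasurable.of_discrete).aestronglyMeasurable,
    integral_countable (Integrable.of_bound (StronglyMeasurable.of_discrete).aestronglyMeasurable c
      (.of_forall hφ))]
  refine tsum_congr fun s => ?_
  rw [map_measureReal_apply (h.measurable g) (measurableSet_singleton s)]
  rfl

lemma hasSum [IsProbabilityMeasure ν] (h : IsCocycle ν S β) (g : Γ) :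
    HasSum (fun s => ν.real (β g ⁻¹' {s})) 1 := by
  have h1 : ∑' s, ν (β g ⁻¹' {s}) = 1 := by
    rw [← measure_iUnion (fun s t hst => Disjoint.preimage _ (by simpa using hst))
      fun s => h.measurable g (measurableSet_singleton s), ← Set.preimage_iUnion,
      Set.iUnion_of_singleton, Set.preimage_univ, measure_univ]
  have h2 := ENNReal.hasSum_toReal (h1.trans_ne ENNReal.one_ne_top)
  rw [← ENNReal.tsum_toReal_eq fun s => measure_ne_top _ _, h1, ENNReal.toReal_one] at h2
  exact h2

/-- Multipliers of `Λ` are transferred to `Γ` by cocycles. -/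
theorem bal [IsProbabilityMeasure ν] (h : IsCocycle ν S β) (hd : 2 ≤ d) {c : ℝ} {φ : Λ → ℂ}
    (hc : 0 ≤ c) (hφ : Bal d c φ) :
    Bal d c fun g => ∑' s, (ν.real (β g ⁻¹' {s}) : ℂ) * φ s := by
  have : d.AtLeastTwo := ⟨hd⟩
  have hφb := hφ.norm_apply_le hc
  obtain ⟨F, h1, h2, h3⟩ := hφ
  have hs := Real.sqrt_nonneg c
  let one : Lp ℂ 2 ν := Lp.const 2 ν 1
  have hone : ‖one‖ ≤ 1 := by
    refine (Lp.norm_const_le 2 ν 1).trans ?_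
    simp
  let mid' : ∀ i, Γ → Lp (F.H (i + 1)) 2 ν →L[ℂ] Lp (F.H i) 2 ν := fun i g =>
    if hi : i < d - 2 then cocycleOp (h.measurable g) (h.measurePreserving g) (h2 i hi) else 0
  let first' : Γ → Lp (F.H 0) 2 ν →L[ℂ] Lp ℂ 2 ν := fun g =>
    cocycleOp (h.measurable g) (h.measurePreserving g) h1
  let last' : Γ → Lp ℂ 2 ν →L[ℂ] Lp (F.H (d - 2)) 2 ν := fun g =>
    cocycleOp (h.measurable g) (h.measurePreserving g) h3
  have hmid : ∀ i (hi : i < d - 2) g, mid' i g =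
    cocycleOp (h.measurable g) (h.measurePreserving g) (h2 i hi) := fun i hi g => dif_pos hi
  -- The coefficient at the constant function 1 is the integral of `φ (β (g₁ ⋯ g_d) x)`, since the
  -- values of `β` along the orbit multiply to this argument.
  refine (normalBal_of_data (H := fun i => Lp (F.H i) 2 ν) hd
    (fun g => (innerSL ℂ one).comp (first' g)) mid'
    (fun g => ContinuousLinearMap.toSpanSingleton ℂ (last' g one))
    (fun g => ?_) (fun i hi g => ?_) (fun g => ?_) fun g => ?_).bal hd
  · refine (ContinuousLinearMap.opNorm_comp_le _ _).trans ?_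
    rw [innerSL_apply_norm]
    have := norm_cocycleOp_le (F := ℂ) (h.measurable g) h1 (h.measurePreserving g) hs
    calc _ ≤ 1 * √c := by gcongr
      _ = √c := one_mul _
  · rw [hmid i hi]
    exact norm_cocycleOp_le _ _ _ zero_le_one
  · rw [ContinuousLinearMap.norm_toSpanSingleton]
    refine ((last' g).le_of_opNorm_le (norm_cocycleOp_le _ _ _ hs) one).trans ?_
    calc _ ≤ √c * 1 := by gcongr
      _ = √c := mul_one _
  · rw [← h.integral_comp hφb, ContinuousLinearMap.comp_apply, innerSL_apply_apply,
      ContinuousLinearMap.toSpanSingleton_apply_one, L2.inner_def]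
    refine integral_congr_ae ?_
    have e1 : (one : X → ℂ) =ᵐ[ν] fun _ => 1 := Lp.coeFn_const ..
    have e2 := h.chain_ae (mid := F.mid) mid' (d - 2)
      (fun i hi g f => by rw [hmid i hi]; exact cocycleOp_ae _ _ _ f) g (last' (g (d - 1)) one)
    have e3 := (h.measurePreserving_orbit g (d - 2 + 1)).quasiMeasurePreserving.ae
      (cocycleOp_ae (h.measurable (g (d - 1))) h3 (h.measurePreserving (g (d - 1))) one)
    have e4 := (h.measurePreserving_orbit g (d - 2 + 1)).quasiMeasurePreserving.ae
      ((h.measurePreserving (g (d - 1))).quasiMeasurePreserving.ae e1)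
    have e5 := cocycleOp_ae (h.measurable (g 0)) h1 (h.measurePreserving (g 0))
      (chain (H := fun i => Lp (F.H i) 2 ν) mid' g (d - 2) (last' (g (d - 1)) one))
    filter_upwards [h.prod_ae g d, e1, e2, e3, e4, e5] with x h0 h1 h2 h3 h4 h5
    have hd1 : d - 2 + 1 = d - 1 := by omega
    rw [h0.2, F.factor, h1]
    refine Eq.trans ?_ (congrArg (inner ℂ (1 : ℂ)) h5).symm
    rw [h2, h3, h4, hd1]
    simp [orbit]

end IsCocycle

end Cocycle

end MdMult

/-! ### Strict fundamental domains -/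

namespace MdMult

/-- A measurable fundamental domain whose translates are disjoint, and not just disjoint up to null
sets. -/
structure IsStrictDomain (G : Type u) [Group G] {X : Type w} [MeasurableSpace X] [MulAction G X]
    (Ω : Set X) (m : Measure X) : Prop where
  measurableSet : MeasurableSet Ω
  eq_of_mem : ∀ (x : X) (g h : G), g • x ∈ Ω → h • x ∈ Ω → g = h
  covers : ∀ᵐ x ∂m, ∃ g : G, g • x ∈ Ω

section Domain

open scoped Pointwise

variable {G : Type u} [Group G] {X : Type w} [MeasurableSpace X] [MulAction G X] {m : Measure X}
  {Ω : Set X}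

lemma ae_smul [MeasurableConstSMul G X] [SMulInvariantMeasure G X m] (g : G) {p : X → Prop}
    (h : ∀ᵐ x ∂m, p x) : ∀ᵐ x ∂m, p (g • x) :=
  (measurePreserving_smul g m).quasiMeasurePreserving.ae h

/-- From a measurable subset of full measure in `D`, the points with a second translate in it are
removed. They are negligible because the translates of `D` are almost disjoint. -/
lemma exists_isStrictDomain [Countable G] [MeasurableConstSMul G X] [SMulInvariantMeasure G X m]
    {D : Set X} (hD : IsFundamentalDomain G D m) : ∃ Ω ⊆ D, IsStrictDomain G Ω m := by
  obtain ⟨T, hTD, hT, hTe⟩ := hD.nullMeasurableSet.exists_measurable_subset_ae_eq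
  have hdisj : ∀ᵐ x ∂m, ∀ g : G, g ≠ 1 → x ∈ D → g • x ∉ D := by
    refine ae_all_iff.2 fun g => ?_
    by_cases hg : g = 1
    · exact .of_forall fun x h => absurd hg h
    have h0 : m (g⁻¹ • D ∩ (1 : G) • D) = 0 := hD.aedisjoint (by simpa using hg)
    refine (measure_eq_zero_iff_ae_notMem.1 h0).mono fun x hx _ h1 h2 => hx ⟨?_, by simpa using h1⟩
    exact Set.mem_inv_smul_set_iff.2 h2
  have hset : {x | x ∈ T ∧ ∀ g : G, g ≠ 1 → g • x ∉ T} =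
      T ∩ ⋂ g : G, ⋂ _ : g ≠ 1, ((fun x => g • x) ⁻¹' T)ᶜ := by ext; simp
  refine ⟨{x | x ∈ T ∧ ∀ g : G, g ≠ 1 → g • x ∉ T}, fun x hx => hTD hx.1, ?_, ?_, ?_⟩
  · rw [hset]
    exact hT.inter (MeasurableSet.iInter fun g => MeasurableSet.iInter fun _ =>
      (measurable_const_smul g hT).compl)
  · intro x g h hg hh
    by_contra hne
    refine hg.2 (h * g⁻¹) (fun h1 => hne (mul_inv_eq_one.1 h1).symm) ?_
    rw [smul_smul, inv_mul_cancel_right]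
    exact hh.1
  · have h1 : ∀ᵐ x ∂m, ∀ g : G, (g • x ∈ T ↔ g • x ∈ D) ∧
        ∀ h : G, h ≠ 1 → g • x ∈ D → h • g • x ∉ D :=
      ae_all_iff.2 fun g => ae_smul g ((hTe.mem_iff).and hdisj)
    filter_upwards [hD.ae_covers, h1] with x ⟨g, hg⟩ h1
    exact ⟨g, (h1 g).1.2 hg, fun h hh h2 => (h1 g).2 h hh hg (hTD h2)⟩

lemma IsStrictDomain.isFundamentalDomain (h : IsStrictDomain G Ω m) :
    IsFundamentalDomain G Ω m where
  nullMeasurableSet := h.measurableSet.nullMeasurableSet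
  ae_covers := h.covers
  aedisjoint g g' hne := by
    refine (Set.disjoint_left.2 fun x hx hx' => hne ?_).aedisjoint
    exact inv_injective (h.eq_of_mem x _ _ (Set.mem_smul_set_iff_inv_smul_mem.1 hx)
      (Set.mem_smul_set_iff_inv_smul_mem.1 hx'))

lemma IsStrictDomain.measurableSet_exists_smul_mem [MeasurableConstSMul G X]
    (h : IsStrictDomain G Ω m) (F : Finset G) : MeasurableSet {x | ∃ g ∈ F, g • x ∈ Ω} := by
  have : {x | ∃ g ∈ F, g • x ∈ Ω} = ⋃ g ∈ F, (fun x => g • x) ⁻¹' Ω := by ext; simp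
  rw [this]
  exact F.measurableSet_biUnion fun g _ => measurable_const_smul g h.measurableSet

end Domain

/-! ### Truncating coefficients of the Koopman representation -/

section Koopman

variable {d : ℕ} {Γ : Type u} [Group Γ] {X : Type w} [MeasurableSpace X] [MulAction Γ X]
  [MeasurableConstSMul Γ X] {m : Measure X} [SMulInvariantMeasure Γ X m] {A B : Set X}

/-- The Koopman representation on `L²(X, m)`. -/
noncomputable def koopman (m : Measure X) [SMulInvariantMeasure Γ X m] (g : Γ) :
    Lp ℂ 2 m →L[ℂ] Lp ℂ 2 m :=
  (Lp.compMeasurePreservingₗᵢ ℂ (fun x => g⁻¹ • x)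
    (measurePreserving_smul g⁻¹ m)).toContinuousLinearMap

lemma koopman_apply (g : Γ) (f : Lp ℂ 2 m) : koopman m g f = DomMulAct.mk g⁻¹ • f := rfl

lemma koopman_mul (g h : Γ) : koopman m (g * h) = (koopman m g).comp (koopman m h) := by
  ext1 f
  rw [ContinuousLinearMap.comp_apply, koopman_apply, koopman_apply, koopman_apply, mul_inv_rev,
    DomMulAct.mk_mul, mul_smul]

/-- This is the Koopman coefficient at the indicators of `A` and `B`, whose norms are the square
roots of the measures. -/
lemma bal_measureReal_inter (hd : 2 ≤ d) (hA : MeasurableSet A) (hB : MeasurableSet B)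
    (hmA : m A ≠ ∞) (hmB : m B ≠ ∞) {c : ℝ} (hc : 0 < c) (h : m.real A * m.real B ≤ c ^ 2) :
    Bal d c fun g : Γ => (m.real (A ∩ (fun x => g⁻¹ • x) ⁻¹' B) : ℂ) := by
  have := bal_coefficient (d := d) hd (koopman (Γ := Γ) m) koopman_mul
    (fun g => LinearIsometry.norm_toContinuousLinearMap_le _) (indicatorConstLp 2 hB hmB 1)
    (indicatorConstLp 2 hA hmA 1) hc (by
      rw [norm_indicatorConstLp (by norm_num) (by norm_num),
        norm_indicatorConstLp (by norm_num) (by norm_num)]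
      simp only [norm_one, one_mul, ENNReal.toReal_ofNat, ← Real.sqrt_eq_rpow]
      rw [← Real.sqrt_mul measureReal_nonneg, mul_comm]
      exact Real.sqrt_le_iff.2 ⟨hc.le, h⟩)
  convert this using 2 with g
  rw [koopman_apply, DomMulAct.mk_smul_indicatorConstLp,
    L2.inner_indicatorConstLp_one_indicatorConstLp_one _ _ hmA
      (by rwa [SMulInvariantMeasure.measure_preimage_smul _ hB])]
  rfl

omit [SMulInvariantMeasure Γ X m] in
lemma exists_finset_measureReal_diff_lt [Countable Γ] {Ω : Set X} (hΩ : IsStrictDomain Γ Ω m)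
    (hA : MeasurableSet A) (hmA : m A ≠ ∞) {ε : ℝ} (hε : 0 < ε) :
    ∀ᶠ F : Finset Γ in atTop, m.real (A \ {x | ∃ g ∈ F, g • x ∈ Ω}) < ε := by
  have hm := hΩ.measurableSet_exists_smul_mem
  have h := tendsto_measure_iInter_atTop (μ := m)
    (s := fun F : Finset Γ => A \ {x | ∃ g ∈ F, g • x ∈ Ω})
    (fun F => (hA.diff (hm F)).nullMeasurableSet)
    (fun F F' hF x hx => ⟨hx.1, fun ⟨g, hg, hgx⟩ => hx.2 ⟨g, hF hg, hgx⟩⟩)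
    ⟨∅, measure_ne_top_of_subset Set.sdiff_subset hmA⟩
  have h0 : m (⋂ F : Finset Γ, A \ {x | ∃ g ∈ F, g • x ∈ Ω}) = 0 := by
    refine measure_eq_zero_iff_ae_notMem.2 (hΩ.covers.mono fun x ⟨g, hg⟩ hx => ?_)
    exact (Set.mem_iInter.1 hx {g}).2 ⟨g, Finset.mem_singleton_self g, hg⟩
  rw [h0] at h
  refine (h.eventually_lt_const (ENNReal.ofReal_pos.2 hε)).mono fun F hF => ?_
  exact (ENNReal.lt_ofReal_iff_toReal_lt hF.ne_top).1 hF

/-- Up to small measure, `A` and `B` lie in a finite union `E` of translates of `Ω`, and `E` meets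
only finitely many of its own translates. -/
lemma finApprox_measureReal_inter [Countable Γ] (hd : 2 ≤ d) {Ω : Set X}
    (hΩ : IsStrictDomain Γ Ω m) (hA : MeasurableSet A) (hB : MeasurableSet B)
    (hmA : m A ≠ ∞) (hmB : m B ≠ ∞) :
    FinApprox d fun g : Γ => (m.real (A ∩ (fun x => g⁻¹ • x) ⁻¹' B) : ℂ) := by
  refine .of_forall_bal fun ε hε => ?_
  have hA0 : 0 ≤ m.real A := measureReal_nonneg
  have hB0 : 0 ≤ m.real B := measureReal_nonneg
  -- Each truncation error is a coefficient whose squared bound is at most `δ` times the measure of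
  -- `A` or of `B`, to be kept below `(ε / 2) ^ 2`.
  set δ := (ε / 2) ^ 2 / (m.real A + m.real B + 1) with hδ
  have hδ0 : 0 < δ := by positivity
  obtain ⟨F, hFA, hFB⟩ := ((exists_finset_measureReal_diff_lt hΩ hA hmA hδ0).and
    (exists_finset_measureReal_diff_lt hΩ hB hmB hδ0)).exists
  set E : Set X := {x | ∃ g ∈ F, g • x ∈ Ω} with hE
  have hEm : MeasurableSet E := hΩ.measurableSet_exists_smul_mem F
  have hbd : ∀ t : ℝ, 0 ≤ t → t ≤ m.real A + m.real B → δ * t ≤ (ε / 2) ^ 2 := fun t _ ht => by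
    rw [hδ, div_mul_eq_mul_div, div_le_iff₀ (by positivity)]
    exact mul_le_mul_of_nonneg_left (by linarith) (by positivity)
  have h1 : Bal d (ε / 2) fun g : Γ => (m.real (A \ E ∩ (fun x => g⁻¹ • x) ⁻¹' B) : ℂ) := by
    refine bal_measureReal_inter hd (hA.diff hEm) hB (measure_ne_top_of_subset Set.sdiff_subset hmA)
      hmB (by positivity) ((mul_le_mul_of_nonneg_right hFA.le hB0).trans (hbd _ hB0 (by linarith)))
  have h2 : Bal d (ε / 2)
      fun g : Γ => (m.real (A ∩ E ∩ (fun x => g⁻¹ • x) ⁻¹' (B \ E)) : ℂ) := by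
    refine bal_measureReal_inter hd (hA.inter hEm) (hB.diff hEm)
      (measure_ne_top_of_subset Set.inter_subset_left hmA)
      (measure_ne_top_of_subset Set.sdiff_subset hmB) (by positivity) ?_
    have h3 : m.real (A ∩ E) ≤ m.real A := measureReal_mono Set.inter_subset_left hmA
    calc _ ≤ m.real A * δ := mul_le_mul h3 hFB.le measureReal_nonneg hA0
      _ = δ * m.real A := mul_comm _ _
      _ ≤ _ := hbd _ hA0 (by linarith)
  refine ⟨fun g => (m.real (A ∩ E ∩ (fun x => g⁻¹ • x) ⁻¹' (B ∩ E)) : ℂ),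
    .of_finite_support ?_, ?_⟩
  -- If `g • x` and `h • γ⁻¹ • x` both lie in `Ω`, strictness gives `g = h * γ⁻¹`.
  · refine (Set.Finite.image2 (fun g h : Γ => g⁻¹ * h) F.finite_toSet F.finite_toSet).subset ?_
    intro γ hγ
    have hne : (A ∩ E ∩ (fun x => γ⁻¹ • x) ⁻¹' (B ∩ E)).Nonempty := by
      refine Set.nonempty_iff_ne_empty.2 fun h0 => hγ ?_
      simp only [h0, measureReal_empty, Complex.ofReal_zero]
    obtain ⟨x, ⟨_, g, hg, hgx⟩, _, h, hh, hhx⟩ := hne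
    rw [smul_smul] at hhx
    refine ⟨g, hg, h, hh, ?_⟩
    rw [hΩ.eq_of_mem x _ _ hgx hhx]
    group
  · convert h1.add (by positivity) (by positivity) h2 using 1
    · ring
    ext g
    set p : X → X := fun x => g⁻¹ • x with hp
    have hEp : MeasurableSet (p ⁻¹' E) := measurable_const_smul g⁻¹ hEm
    have f1 : m (A ∩ p ⁻¹' B) ≠ ∞ := measure_ne_top_of_subset Set.inter_subset_left hmA
    have f2 : m (A ∩ p ⁻¹' B ∩ E) ≠ ∞ := measure_ne_top_of_subset Set.inter_subset_left f1
    -- `A ∩ p ⁻¹' B` splits into the points outside `E`, those in `E` with image outside `E`, and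
    -- the rest.
    have e1 := measureReal_inter_add_sdiff (μ := m) (s := A ∩ p ⁻¹' B) hEm f1
    have e2 := measureReal_inter_add_sdiff (μ := m) (s := A ∩ p ⁻¹' B ∩ E) hEp f2
    have s1 : (A ∩ p ⁻¹' B) \ E = A \ E ∩ p ⁻¹' B := by ext; simp; tauto
    have s2 : A ∩ p ⁻¹' B ∩ E ∩ p ⁻¹' E = A ∩ E ∩ p ⁻¹' (B ∩ E) := by ext; simp; tauto
    have s3 : (A ∩ p ⁻¹' B ∩ E) \ p ⁻¹' E = A ∩ E ∩ p ⁻¹' (B \ E) := by ext; simp; tauto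
    rw [s1] at e1
    rw [s2, s3] at e2
    simp only [Pi.sub_apply, Pi.add_apply]
    rw [← e1, ← e2]
    push_cast
    ring

end Koopman

end MdMult

/-! ### The cocycle of a measure equivalence coupling -/

namespace MdMult

section Return

variable {Λ : Type v} [Group Λ] {X : Type w} [MulAction Λ X] {Ω : Set X}

open Classical in
/-- An element of `Λ` moving `x` into `Ω`. -/
noncomputable def returnElt (Λ : Type v) [Group Λ] [MulAction Λ X] (Ω : Set X) (x : X) : Λ :=
  if h : ∃ t : Λ, t • x ∈ Ω then h.choose else 1

lemma returnElt_smul_mem {x : X} (h : ∃ t : Λ, t • x ∈ Ω) : returnElt Λ Ω x • x ∈ Ω := by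
  rw [returnElt, dif_pos h]
  exact h.choose_spec

variable [MeasurableSpace X] {m : Measure X}

namespace IsStrictDomain

lemma returnElt_eq (hΩ : IsStrictDomain Λ Ω m) {x : X} {t : Λ} (h : t • x ∈ Ω) :
    returnElt Λ Ω x = t :=
  hΩ.eq_of_mem x _ _ (returnElt_smul_mem ⟨t, h⟩) h

lemma returnElt_eq_one (hΩ : IsStrictDomain Λ Ω m) {x : X} (h : x ∈ Ω) : returnElt Λ Ω x = 1 :=
  hΩ.returnElt_eq (by rwa [one_smul])

lemma returnElt_smul (hΩ : IsStrictDomain Λ Ω m) {x : X} (h : ∃ t : Λ, t • x ∈ Ω) (s : Λ) :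
    returnElt Λ Ω (s • x) = returnElt Λ Ω x * s⁻¹ := by
  refine hΩ.returnElt_eq ?_
  rw [smul_smul, inv_mul_cancel_right]
  exact returnElt_smul_mem h

variable [MeasurableConstSMul Λ X] [Countable Λ]

lemma measurable_returnElt [MeasurableSpace Λ] (hΩ : IsStrictDomain Λ Ω m) :
    Measurable (returnElt Λ Ω) := by
  have hm : ∀ t : Λ, MeasurableSet {x : X | t • x ∈ Ω} := fun t =>
    measurable_const_smul t hΩ.measurableSet
  refine measurable_to_countable' fun t => ?_
  -- The second set accounts for the default value 1 at points with no translate in `Ω`.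
  have : returnElt Λ Ω ⁻¹' {t} =
      {x | t • x ∈ Ω} ∪ ((⋃ s : Λ, {x | s • x ∈ Ω})ᶜ ∩ {_x | t = 1}) := by
    ext x
    simp only [Set.mem_preimage, Set.mem_singleton_iff, Set.mem_union, Set.mem_inter_iff,
      Set.mem_compl_iff, Set.mem_iUnion, Set.mem_ofPred_eq]
    by_cases h : ∃ s : Λ, s • x ∈ Ω
    · refine ⟨fun e => .inl (e ▸ returnElt_smul_mem h), fun e => ?_⟩
      exact hΩ.returnElt_eq (e.resolve_right fun h' => h'.1 h)
    · rw [returnElt, dif_neg h]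
      exact ⟨fun e => .inr ⟨h, e.symm⟩, fun e => (e.resolve_left fun h' => h ⟨t, h'⟩).2.symm⟩
  rw [this]
  exact (hm t).union ((MeasurableSet.iUnion hm).compl.inter (MeasurableSet.const _))

lemma measurable_returnElt_smul (hΩ : IsStrictDomain Λ Ω m) :
    Measurable fun x : X => returnElt Λ Ω x • x := by
  let : MeasurableSpace Λ := ⊤
  intro B hB
  have : (fun x : X => returnElt Λ Ω x • x) ⁻¹' B =
      ⋃ t : Λ, returnElt Λ Ω ⁻¹' {t} ∩ (fun x => t • x) ⁻¹' B := by ext; simp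
  rw [this]
  exact MeasurableSet.iUnion fun t =>
    (hΩ.measurable_returnElt trivial).inter (measurable_const_smul t hB)

end IsStrictDomain

end Return

section Coupling

variable {d : ℕ} {Γ : Type u} {Λ : Type v} [Group Γ] [Group Λ] {X : Type w} [MulAction Γ X]
  [MulAction Λ X] {Ω : Set X}

/-- The action of `Γ` on a fundamental domain of `Λ`. -/
noncomputable def inducedAct (Γ : Type u) (Λ : Type v) [Group Γ] [Group Λ] [MulAction Γ X]
    [MulAction Λ X] (Ω : Set X) (γ : Γ) (x : X) : X :=
  returnElt Λ Ω (γ⁻¹ • x) • γ⁻¹ • x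

/-- The cocycle of a measure equivalence coupling. -/
noncomputable def returnCocycle (Γ : Type u) (Λ : Type v) [Group Γ] [Group Λ] [MulAction Γ X]
    [MulAction Λ X] (Ω : Set X) (γ : Γ) (x : X) : Λ :=
  (returnElt Λ Ω (γ⁻¹ • x))⁻¹

variable [MeasurableSpace X] {m : Measure X} [SMulCommClass Γ Λ X] [MeasurableConstSMul Γ X]
  [MeasurableConstSMul Λ X] [SMulInvariantMeasure Γ X m] [SMulInvariantMeasure Λ X m]
  [Countable Γ] [Countable Λ]

open ProbabilityTheory

-- Through its `Λ`-saturation `B'`, the set `B` extends to a `Λ`-invariant set, and the measure of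
-- an invariant set within a fundamental domain does not depend on the domain.
omit [Countable Γ] in
open scoped Pointwise in
lemma measure_inter_preimage_inducedAct (hΩ : IsStrictDomain Λ Ω m) (γ : Γ) {B : Set X}
    (hB : MeasurableSet B) : m (Ω ∩ inducedAct Γ Λ Ω γ ⁻¹' B) = m (Ω ∩ B) := by
  set cov : Set X := ⋃ t : Λ, (fun x => t • x) ⁻¹' Ω with hcov
  set B' : Set X := cov ∩ (fun x => returnElt Λ Ω x • x) ⁻¹' B with hB'
  have hcm : MeasurableSet cov :=
    MeasurableSet.iUnion fun t => measurable_const_smul t hΩ.measurableSet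
  have hBm : MeasurableSet B' := hcm.inter (hΩ.measurable_returnElt_smul hB)
  have hc : ∀ x, x ∈ cov ↔ ∃ t : Λ, t • x ∈ Ω := fun x => by simp [hcov]
  have hcs : ∀ (x : X) (s : Λ), s • x ∈ cov ↔ x ∈ cov := fun x s => by
    rw [hc, hc]
    exact ⟨fun ⟨t, ht⟩ => ⟨t * s, by rwa [mul_smul]⟩,
      fun ⟨t, ht⟩ => ⟨t * s⁻¹, by rwa [smul_smul, inv_mul_cancel_right]⟩⟩
  have hinv : ∀ (x : X) (s : Λ), s • x ∈ B' ↔ x ∈ B' := fun x s => by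
    by_cases hx : x ∈ cov
    · have e : returnElt Λ Ω (s • x) • s • x = returnElt Λ Ω x • x := by
        rw [hΩ.returnElt_smul ((hc x).1 hx), smul_smul, inv_mul_cancel_right]
      exact and_congr (hcs x s) (by rw [Set.mem_preimage, Set.mem_preimage, e])
    · exact ⟨fun h => absurd ((hcs x s).1 h.1) hx, fun h => absurd h.1 hx⟩
  have hp : MeasurableSet ((fun x => γ⁻¹ • x) ⁻¹' B') := measurable_const_smul γ⁻¹ hBm
  have h1 : m (Ω ∩ inducedAct Γ Λ Ω γ ⁻¹' B) = m ((fun x => γ⁻¹ • x) ⁻¹' B' ∩ Ω) := by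
    refine measure_congr ?_
    rw [eventuallyEq_set]
    filter_upwards [ae_smul γ⁻¹ hΩ.covers] with x hx
    have : γ⁻¹ • x ∈ cov := (hc _).2 hx
    exact ⟨fun h => ⟨⟨this, h.2⟩, h.1⟩, fun h => ⟨h.2, h.1.2⟩⟩
  -- As the actions commute, `γ • Ω` is again a fundamental domain of `Λ`.
  have h2 : m ((fun x => γ⁻¹ • x) ⁻¹' B' ∩ Ω) = m ((fun x => γ⁻¹ • x) ⁻¹' B' ∩ γ • Ω) := by
    refine hΩ.isFundamentalDomain.measure_set_eq (hΩ.isFundamentalDomain.smul_of_comm γ) hp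
      fun s => ?_
    ext x
    simp only [Set.mem_preimage]
    rw [smul_comm γ⁻¹ s x, hinv]
  have h3 : (fun x => γ⁻¹ • x) ⁻¹' B' ∩ γ • Ω = (fun x => γ⁻¹ • x) ⁻¹' (Ω ∩ B) := by
    ext x
    rw [Set.mem_inter_iff, Set.mem_smul_set_iff_inv_smul_mem, Set.mem_preimage, Set.mem_preimage]
    refine ⟨fun h => ⟨h.2, ?_⟩, fun h => ⟨⟨(hc _).2 ⟨1, by simpa using h.1⟩, ?_⟩, h.1⟩⟩
    · have := h.1.2
      rwa [Set.mem_preimage, hΩ.returnElt_eq_one h.2, one_smul] at this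
    · rw [Set.mem_preimage, hΩ.returnElt_eq_one h.1, one_smul]
      exact h.2
  rw [h1, h2, h3, SMulInvariantMeasure.measure_preimage_smul _ (hΩ.measurableSet.inter hB)]

omit [Countable Γ] in
lemma isCocycle_returnCocycle [MeasurableSpace Λ] [MeasurableSingletonClass Λ]
    (hΩ : IsStrictDomain Λ Ω m) :
    IsCocycle (cond m Ω) (inducedAct Γ Λ Ω) (returnCocycle Γ Λ Ω) := by
  have hac : cond m Ω ≪ m := cond_absolutelyContinuous
  have hmem : ∀ᵐ x ∂(cond m Ω), x ∈ Ω := ae_cond_mem hΩ.measurableSet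
  have hcov : ∀ g h : Γ, ∀ᵐ x ∂(cond m Ω), ∃ t : Λ, t • h⁻¹ • g⁻¹ • x ∈ Ω := fun g h =>
    hac.ae_le (ae_smul g⁻¹ (ae_smul h⁻¹ hΩ.covers))
  -- `inducedAct Γ Λ Ω g x` is a `Λ`-translate of `g⁻¹ • x`, and `h⁻¹` commutes with that
  -- translation. Both the action and the cocycle identities follow.
  have key : ∀ (g h : Γ) (x : X), (∃ t : Λ, t • h⁻¹ • g⁻¹ • x ∈ Ω) →
      returnElt Λ Ω (h⁻¹ • inducedAct Γ Λ Ω g x) =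
        returnElt Λ Ω ((g * h)⁻¹ • x) * (returnElt Λ Ω (g⁻¹ • x))⁻¹ := fun g h x hx => by
    rw [inducedAct, smul_comm h⁻¹, hΩ.returnElt_smul hx, mul_inv_rev, mul_smul]
  have hS : ∀ g : Γ, Measurable (inducedAct Γ Λ Ω g) := fun g =>
    hΩ.measurable_returnElt_smul.comp (measurable_const_smul g⁻¹)
  refine ⟨fun g => ⟨hS g, ?_⟩, fun g => ?_, ?_, fun g h => ?_, ?_, fun g h => ?_⟩
  · refine Measure.ext fun B hB => ?_
    rw [Measure.map_apply (hS g) hB, cond_apply hΩ.measurableSet, cond_apply hΩ.measurableSet]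
    exact congrArg _ (measure_inter_preimage_inducedAct hΩ g hB)
  · have : DiscreteMeasurableSpace Λ := inferInstance
    exact (Measurable.of_discrete (f := fun t : Λ => t⁻¹)).comp
      (hΩ.measurable_returnElt.comp (measurable_const_smul g⁻¹))
  · filter_upwards [hmem] with x hx
    rw [inducedAct, inv_one, one_smul, hΩ.returnElt_eq_one hx, one_smul]
  · filter_upwards [hcov g h] with x hx
    rw [inducedAct, inducedAct, key g h x hx, inducedAct, mul_smul, smul_comm h⁻¹, inv_smul_smul,
      mul_inv_rev, mul_smul]
  · filter_upwards [hmem] with x hx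
    rw [returnCocycle, inv_one, one_smul, hΩ.returnElt_eq_one hx, inv_one]
  · filter_upwards [hcov g h] with x hx
    rw [returnCocycle, returnCocycle, returnCocycle, key g h x hx, ← mul_inv_rev,
      inv_mul_cancel_right]

/-- A measure equivalence coupling gives a transfer kernel from `Γ` to `Λ`. -/
theorem isTransferKernel_returnCocycle (hd : 2 ≤ d) (hΩ : IsStrictDomain Λ Ω m) (h0 : m Ω ≠ 0)
    (htop : m Ω ≠ ∞) {Ω' : Set X} (hΩ' : IsStrictDomain Γ Ω' m) :
    IsTransferKernel d fun (γ : Γ) (s : Λ) => (cond m Ω).real (returnCocycle Γ Λ Ω γ ⁻¹' {s}) := by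
  let : MeasurableSpace Λ := ⊤
  have hβ := isCocycle_returnCocycle (Γ := Γ) hΩ
  have := cond_isProbabilityMeasure_of_finite h0 htop
  refine ⟨fun _ _ => measureReal_nonneg, hβ.hasSum, fun c φ hc hφ => hβ.bal hd hc hφ, fun s => ?_⟩
  -- Within `Ω`, the cocycle takes the value `s` exactly where `s⁻¹ • γ⁻¹ • x ∈ Ω`, up to a null
  -- set; so the column is a Koopman coefficient divided by `m Ω`.
  have hs : MeasurableSet ((fun x => s⁻¹ • x) ⁻¹' Ω) := measurable_const_smul s⁻¹ hΩ.measurableSet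
  convert (finApprox_measureReal_inter (d := d) hd hΩ' hΩ.measurableSet hs htop (by
    rwa [SMulInvariantMeasure.measure_preimage_smul _ hΩ.measurableSet])).smul
    (((m Ω).toReal⁻¹ : ℝ) : ℂ) using 1
  ext γ
  rw [Pi.smul_apply, smul_eq_mul, ← Complex.ofReal_mul, measureReal_def,
    cond_apply hΩ.measurableSet, ENNReal.toReal_mul, ENNReal.toReal_inv, measureReal_def]
  refine congrArg (fun t => (((m Ω).toReal⁻¹ * ENNReal.toReal t : ℝ) : ℂ)) (measure_congr ?_)
  rw [eventuallyEq_set]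
  filter_upwards [ae_smul γ⁻¹ hΩ.covers] with x hx
  refine and_congr_right fun _ => ?_
  rw [Set.mem_preimage, Set.mem_singleton_iff, returnCocycle, inv_eq_iff_eq_inv]
  exact ⟨fun h => h ▸ returnElt_smul_mem hx, fun h => hΩ.returnElt_eq h⟩

end Coupling

end MdMult

/-! ### Kernels in both directions -/

section Final

variable {Γ : Type u} {Λ : Type v} [Group Γ] [Group Λ]

lemma IsMECoupling.exists_isTransferKernel {X : Type w} [MeasurableSpace X] {m : Measure X}
    [MulAction Γ X] [MulAction Λ X] (h : IsMECoupling Γ Λ X m) [Countable Γ] [Countable Λ] {d : ℕ}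
    (hd : 2 ≤ d) : ∃ k : Γ → Λ → ℝ, IsTransferKernel d k := by
  have : SMulCommClass Γ Λ X := ⟨h.commute⟩
  have : MeasurableConstSMul Γ X := ⟨fun γ => (h.preserving_left γ).measurable⟩
  have : MeasurableConstSMul Λ X := ⟨fun s => (h.preserving_right s).measurable⟩
  have : SMulInvariantMeasure Γ X m :=
    ⟨fun γ _ hB => (h.preserving_left γ).measure_preimage hB.nullMeasurableSet⟩
  have : SMulInvariantMeasure Λ X m :=
    ⟨fun s _ hB => (h.preserving_right s).measure_preimage hB.nullMeasurableSet⟩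
  obtain ⟨D, hD, htop⟩ := h.domain_right
  obtain ⟨Ω, hΩD, hΩ⟩ := MdMult.exists_isStrictDomain hD
  obtain ⟨D', hD', -⟩ := h.domain_left
  obtain ⟨Ω', -, hΩ'⟩ := MdMult.exists_isStrictDomain hD'
  -- `Ω` lies in a domain of finite measure, and it is not null since its translates cover a space
  -- of nonzero measure.
  exact ⟨_, MdMult.isTransferKernel_returnCocycle hd hΩ
    (hΩ.isFundamentalDomain.measure_ne_zero h.ne_zero)
    (measure_ne_top_of_subset hΩD htop.ne) hΩ'⟩

lemma IsMECoupling.symm {X : Type w} [MeasurableSpace X] {m : Measure X} [MulAction Γ X]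
    [MulAction Λ X] (h : IsMECoupling Γ Λ X m) : IsMECoupling Λ Γ X m where
  standard := h.standard
  sigmaFinite := h.sigmaFinite
  ne_zero := h.ne_zero
  commute s γ x := (h.commute γ s x).symm
  preserving_left := h.preserving_right
  preserving_right := h.preserving_left
  free_left := h.free_right
  free_right := h.free_left
  domain_left := h.domain_right
  domain_right := h.domain_left

lemma exists_isTransferKernel (h : MeasureEquivalent.{u, v, w} Γ Λ ∨ WStarEquivalent Γ Λ) {d : ℕ}
    (hd : 2 ≤ d) :
    (∃ k : Γ → Λ → ℝ, IsTransferKernel d k) ∧ ∃ k : Λ → Γ → ℝ, IsTransferKernel d k := by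
  rcases h with ⟨_, _, X, _, m, _, _, h⟩ | ⟨⟨θ⟩⟩
  · exact ⟨h.exists_isTransferKernel hd, h.symm.exists_isTransferKernel hd⟩
  · exact ⟨⟨_, MdMult.isTransferKernel_normSq_symbol θ hd⟩,
      ⟨_, MdMult.isTransferKernel_normSq_symbol θ.symm hd⟩⟩

end Final

theorem mainTheorem2 (d : ℕ) [d.AtLeastTwo] (Γ : Type u) (Λ : Type v) [Group Γ] [Group Λ]
    (h : MeasureEquivalent.{u, v, w} Γ Λ ∨ WStarEquivalent Γ Λ) :
    (MdAP d Γ ↔ MdAP d Λ) ∧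
    (MdWeaklyAmenable d Γ ↔ MdWeaklyAmenable d Λ) ∧
    (MdWeakHaagerup d Γ ↔ MdWeakHaagerup d Λ) ∧
    cowlingHaagerupConst d Γ = cowlingHaagerupConst d Λ ∧
    weakHaagerupConst d Γ = weakHaagerupConst d Λ := by
  have hd : 2 ≤ d := Nat.AtLeastTwo.prop
  obtain ⟨⟨k, hk⟩, k', hk'⟩ := exists_isTransferKernel h hd
  obtain ⟨a1, a2, a3, a4, a5⟩ := hk.transfer fun φ hφ => MdMult.MemFourier.finApprox hd hφ
  obtain ⟨b1, b2, b3, b4, b5⟩ := hk'.transfer fun φ hφ => MdMult.MemFourier.finApprox hd hφ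
  exact ⟨⟨b1, a1⟩, ⟨b2, a2⟩, ⟨b3, a3⟩, le_antisymm a4 b4, le_antisymm a5 b5⟩
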